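/- **Conventions.** Labels are taken from a fixed infinite set $L$; $f\sslash g$ means first $f$, then $g$. A *meta-monoid* $\mathcal G$ is a family of sets $\mathcal G^X$, $X\subset L$ finite, with operations: stitching $m^{a,b}_c:\mathcal G^{\{a,b\}\cup S}\to\mathcal G^{\{c\}\cup S}$ ($a\ne b$, $\{a,b,c\}\cap S=\emptyset$), identity $e_a:\mathcal G^{X}\to\mathcal G^{X\cup\{a\}}$ and deletion $\eta_a:\mathcal G^{X\cup\{a\}}\to\mathcal G^{X}$ ($a\notin X$), disjoint union $\sqcup:\mathcal G^X\times\mathcal G^Y\to\mathcal G^{X\cup Y}$ ($X\cap Y=\emptyset$), and renaming $\sigma^a_b:\mathcal G^{S\cup\{a\}}\to\mathcal G^{S\cup\{b\}}$ ($\{a,b\}\cap S=\emptyset$). They satisfy, whenever both sides are defined, $m^{x,y}_u\sslash m^{u,z}_v=m^{y,z}_u\sslash m^{x,u}_v$; $e_a\sslash m^{a,b}_c=\sigma^b_c$; $e_b\sslash m^{a,b}_c=\sigma^a_c$; $e_a\sslash\sigma^a_b=e_b$; $\sigma^a_b\sslash\sigma^b_c=\sigma^a_c$; $\sigma^a_b\sslash\sigma^b_a=\mathrm{Id}$;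 $\sigma^a_b\sslash\eta_b=\eta_a$; $e_a\sslash\eta_a=\mathrm{Id}$; $m^{a,b}_c\sslash\sigma^c_d=m^{a,b}_d$; $\sigma^a_b\sslash m^{b,c}_d=m^{a,c}_d$; and $$(*)\qquad m^{a,b}_c\sslash\eta_c=\eta_b\sslash\eta_a;$$ moreover operations with distinct labels commute, and $\sqcup$ is commutative, associative and commutes with all other operations. A *homomorphism* of such families is a family of maps that commutes with all operations. **w-tangles.** A w-tangle diagram with (open, oriented) components labeled by $X$ is recorded by its Gauss diagram: for each $x\in X$ the sequence of passages of the component $x$ through positive and negative crossings, each crossing being passed once over and once under. (Virtual crossings and the position in the plane are not recorded; this accounts for planar isotopy, the virtual Reidemeister moves and the mixed moves.) $\mathcal W^X$ is the set of these diagrams modulo the moves $R2$, $R3$ (with all orientations and signs) and $OC$ (two consecutive overcrossings on a strand may be exchanged); $R1$ is not imposed. Stitching $m^{a,b}_c$ joins the head of $a$ to the tail of $b$; $e_a$ adds a strand without crossings; $\eta_a$ deletes a strand with all crossings on it; $\sqcup$ is juxtaposition; $\sigma^a_b$ relabels. $R^{\pm}_{a,b}\in\mathcal W^{\{a,b\}}$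 is the crossing of sign $\pm$ with overstrand $a$ and understrand $b$. **$\Gamma$-calculus.** Let $R_X=\mathbb Q(t_i:i\in X)$. $\Gamma^X$ is the set of pairs $(\omega,M)$, $\omega\in R_X$, $M$ an $X\times X$ matrix over $R_X$ (rows $y_i$, columns $x_j$), such that all variables can be set to $1$ in $\omega$ and $M$, and $M$ then becomes the identity matrix. The operations are: $e_a$ adds a row and a column $a$ with $1$ on the diagonal and $0$ elsewhere; $\sqcup$ multiplies the scalars and forms the block-diagonal matrix; $\eta_a$ deletes row and column $a$ and substitutes $t_a\to1$; $\sigma^a_b$ relabels row and column $a$ by $b$ and substitutes $t_a\to t_b$; and $$\left(\begin{array}{c|ccc}\omega&x_a&x_b&x_S\\\hline y_a&\alpha&\beta&\theta\\y_b&\gamma&\delta&\epsilon\\y_S&\phi&\psi&\Xi\end{array}\right)\sslash m^{a,b}_c=\left(\begin{array}{c|cc}(1-\gamma)\omega&x_c&x_S\\\hline y_c&\beta+\frac{\alpha\delta}{1-\gamma}&\theta+\frac{\alpha\epsilon}{1-\gamma}\\y_S&\psi+\frac{\phi\delta}{1-\gamma}&\Xi+\frac{\phi\epsilon}{1-\gamma}\end{array}\right)_{t_a,t_b\to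 t_c}.$$ Let $\Gamma_0^X\subset\Gamma^X$ be the set of $(\omega,M)$ with $M_{ij}|_{t_i\to1}=0$ for all $i\ne j$. **Proposition.** 1. $\mathcal W$ is a meta-monoid. 2. The operations of $\Gamma$ are well defined and satisfy all laws of a meta-monoid with the possible exception of $(*)$. The subsets $\Gamma_0^X$ are closed under the operations, and $\Gamma_0$ is a meta-monoid (so $(*)$ holds in it). 3. There is exactly one homomorphism $\varphi:\mathcal W\to\Gamma$ with $$\varphi(R^{\pm}_{a,b})=\left(\begin{array}{c|cc}1&x_a&x_b\\\hline y_a&1&1-t_a^{\pm1}\\y_b&0&t_a^{\pm1}\end{array}\right)\qquad(a\neq b).$$ Its values lie in the meta-monoid $\Gamma_0$. (As it is defined on $\mathcal W$, it respects $R2$, $R3$ and $OC$.) 4. $\varphi$ does not respect $R1$: for $a\ne b$ and any $c$, $\varphi(R^{\pm}_{a,b}\sslash m^{b,a}_c)$ has scalar part $t_c^{\pm1}$ and matrix part $1$, and it differs from the value of $\varphi$ on the strand $c$ without crossings. -/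

import Mathlib

open scoped Classical in
/-- `SubstTo v r c`: the rational function `r` admits the substitution `t_i → v i`
(it has a denominator that does not vanish under it), and the result is `c`. -/
def SubstTo {σ : Type*} {K : Type*} [Field K] [Algebra ℚ K] (v : σ → K)
    (r : FractionRing (MvPolynomial σ ℚ)) (c : K) : Prop :=
  ∃ p q : MvPolynomial σ ℚ, MvPolynomial.aeval v q ≠ 0 ∧
    r = algebraMap _ (FractionRing (MvPolynomial σ ℚ)) p / algebraMap _ _ q ∧
    c = MvPolynomial.aeval v p / MvPolynomial.aeval v q

namespace SubstTo

variable {σ K : Type*} [Field K] [Algebra ℚ K] {v : σ → K}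
  {r s : FractionRing (MvPolynomial σ ℚ)} {c d : K}

theorem ne_zero_of_aeval {q : MvPolynomial σ ℚ} (h : MvPolynomial.aeval v q ≠ 0) :
    algebraMap (MvPolynomial σ ℚ) (FractionRing (MvPolynomial σ ℚ)) q ≠ 0 := by
  intro h0
  have : q = 0 := by
    apply IsFractionRing.injective (MvPolynomial σ ℚ) (FractionRing (MvPolynomial σ ℚ))
    simpa using h0
  exact h (by simp [this])

theorem unique (h : SubstTo v r c) (h' : SubstTo v r d) : c = d := by
  obtain ⟨p, q, hq, hr, hc⟩ := h
  obtain ⟨p', q', hq', hr', hd⟩ := h'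
  have e := hr.symm.trans hr'
  rw [div_eq_div_iff (ne_zero_of_aeval hq) (ne_zero_of_aeval hq'), ← map_mul, ← map_mul] at e
  have e' := IsFractionRing.injective (MvPolynomial σ ℚ) (FractionRing (MvPolynomial σ ℚ)) e
  rw [hc, hd, div_eq_div_iff hq hq', ← map_mul, ← map_mul, e']

theorem poly (p : MvPolynomial σ ℚ) :
    SubstTo v (algebraMap _ (FractionRing (MvPolynomial σ ℚ)) p) (MvPolynomial.aeval v p) :=
  ⟨p, 1, by simp, by simp, by simp⟩

theorem zero : SubstTo v 0 0 := by simpa using poly (v := v) 0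

theorem one : SubstTo v 1 1 := by simpa using poly (v := v) 1

theorem add (h : SubstTo v r c) (h' : SubstTo v s d) : SubstTo v (r + s) (c + d) := by
  obtain ⟨p, q, hq, rfl, rfl⟩ := h
  obtain ⟨p', q', hq', rfl, rfl⟩ := h'
  refine ⟨p * q' + q * p', q * q', by simp [hq, hq'], ?_, ?_⟩
  · rw [div_add_div _ _ (ne_zero_of_aeval hq) (ne_zero_of_aeval hq')]
    simp
  · rw [div_add_div _ _ hq hq']
    simp

theorem mul (h : SubstTo v r c) (h' : SubstTo v s d) : SubstTo v (r * s) (c * d) := by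
  obtain ⟨p, q, hq, rfl, rfl⟩ := h
  obtain ⟨p', q', hq', rfl, rfl⟩ := h'
  refine ⟨p * p', q * q', by simp [hq, hq'], ?_, ?_⟩
  · rw [div_mul_div_comm]; simp
  · rw [div_mul_div_comm]; simp

theorem neg (h : SubstTo v r c) : SubstTo v (-r) (-c) := by
  obtain ⟨p, q, hq, rfl, rfl⟩ := h
  exact ⟨-p, q, hq, by simp [neg_div], by simp [neg_div]⟩

theorem sub (h : SubstTo v r c) (h' : SubstTo v s d) : SubstTo v (r - s) (c - d) := by
  simpa [sub_eq_add_neg] using h.add h'.neg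

theorem inv (h : SubstTo v r c) (hc : c ≠ 0) : SubstTo v r⁻¹ c⁻¹ := by
  obtain ⟨p, q, hq, rfl, rfl⟩ := h
  refine ⟨q, p, ?_, by simp, by simp⟩
  intro hp
  exact hc (by simp [hp])

theorem div (h : SubstTo v r c) (h' : SubstTo v s d) (hd : d ≠ 0) :
    SubstTo v (r / s) (c / d) := by
  simpa [div_eq_mul_inv] using h.mul (h'.inv hd)

end SubstTo

open scoped Classical in
/-- The result of the substitution `t_i → v i` in the rational function `r`
(`0` if the substitution makes no sense). -/
noncomputable def substRat {σ : Type*} {K : Type*} [Field K] [Algebra ℚ K] (v : σ → K)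
    (r : FractionRing (MvPolynomial σ ℚ)) : K :=
  if h : ∃ c, SubstTo v r c then h.choose else 0

theorem SubstTo.substRat_eq {σ K : Type*} [Field K] [Algebra ℚ K] {v : σ → K}
    {r : FractionRing (MvPolynomial σ ℚ)} {c : K} (h : SubstTo v r c) : substRat v r = c := by
  have h' : ∃ c, SubstTo v r c := ⟨c, h⟩
  rw [substRat, dif_pos h']
  exact h'.choose_spec.unique h

/-- If all `v i` take the value `1` when all variables are set to `1`, then substituting
`v` in a function regular at that point makes sense and does not change its value there. -/
theorem SubstTo.comp_one {σ τ : Type*} {v : σ → FractionRing (MvPolynomial τ ℚ)}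
    (hv : ∀ i, SubstTo (fun _ : τ => (1 : ℚ)) (v i) 1)
    {r : FractionRing (MvPolynomial σ ℚ)} {c : ℚ} (h : SubstTo (fun _ : σ => (1 : ℚ)) r c) :
    SubstTo v r (substRat v r) ∧ SubstTo (fun _ : τ => (1 : ℚ)) (substRat v r) c := by
  have key : ∀ p : MvPolynomial σ ℚ, SubstTo (fun _ : τ => (1 : ℚ))
      (MvPolynomial.aeval v p) (MvPolynomial.aeval (fun _ : σ => (1 : ℚ)) p) := by
    intro p
    induction p using MvPolynomial.induction_on with
    | C a =>
      have := SubstTo.poly (v := fun _ : τ => (1 : ℚ)) (MvPolynomial.C a)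
      rw [MvPolynomial.aeval_C, MvPolynomial.aeval_C]
      rw [MvPolynomial.aeval_C] at this
      rwa [IsScalarTower.algebraMap_apply ℚ (MvPolynomial τ ℚ)
        (FractionRing (MvPolynomial τ ℚ))]
    | add p q hp hq => simpa using hp.add hq
    | mul_X p i hp => simpa using hp.mul (hv i)
  obtain ⟨p, q, hq, rfl, rfl⟩ := h
  have hq0 : MvPolynomial.aeval v q ≠ 0 := by
    intro h0
    have := key q
    rw [h0] at this
    exact hq (this.unique SubstTo.zero)
  have h1 : SubstTo v (algebraMap _ (FractionRing (MvPolynomial σ ℚ)) p / algebraMap _ _ q)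
      (MvPolynomial.aeval v p / MvPolynomial.aeval v q) := ⟨p, q, hq0, rfl, rfl⟩
  rw [h1.substRat_eq]
  exact ⟨h1, (key p).div (key q) hq⟩

/-! ### Meta-monoids -/

section Index

variable {L : Type*} [DecidableEq L]

/-- `X = {a, b} ∪ S` and `Y = {c} ∪ S` with `a ≠ b` and `{a, b, c} ∩ S = ∅`. -/
def Stitches (a b c : L) (X Y : Finset L) : Prop :=
  ∃ S : Finset L, a ≠ b ∧ a ∉ S ∧ b ∉ S ∧ c ∉ S ∧ X = insert a (insert b S) ∧ Y = insert c S

/-- `Y = X ∪ {a}` with `a ∉ X`. -/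
def Extends (a : L) (X Y : Finset L) : Prop := a ∉ X ∧ Y = insert a X

/-- `Z = X ∪ Y` with `X ∩ Y = ∅`. -/
def Splits (X Y Z : Finset L) : Prop := Disjoint X Y ∧ Z = X ∪ Y

/-- `X = S ∪ {a}` and `Y = S ∪ {b}` with `{a, b} ∩ S = ∅`. -/
def Relabels (a b : L) (X Y : Finset L) : Prop :=
  ∃ S : Finset L, a ∉ S ∧ b ∉ S ∧ X = insert a S ∧ Y = insert b S

end Index

/-- Sets indexed by the finite sets of labels, with the operations of a meta-monoid
(no laws yet). The source and target label sets of an operation are explicit arguments,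
tied together by the side condition of the operation. -/
structure MetaMonoidOps (L : Type*) [DecidableEq L] where
  carrier : Finset L → Type*
  /-- stitching `m^{a,b}_c` -/
  stitch : ∀ {a b c : L} {X Y : Finset L}, Stitches a b c X Y → carrier X → carrier Y
  /-- identity `e_a` -/
  one : ∀ {a : L} {X Y : Finset L}, Extends a X Y → carrier X → carrier Y
  /-- deletion `η_a` -/
  del : ∀ {a : L} {X Y : Finset L}, Extends a X Y → carrier Y → carrier X
  /-- disjoint union -/
  union : ∀ {X Y Z : Finset L}, Splits X Y Z → carrier X → carrier Y → carrier Z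
  /-- renaming `σ^a_b` -/
  rename : ∀ {a b : L} {X Y : Finset L}, Relabels a b X Y → carrier X → carrier Y

/-- All the laws of a meta-monoid with the exception of `m^{a,b}_c ⫽ η_c = η_b ⫽ η_a`. -/
structure IsPreMetaMonoid {L : Type*} [DecidableEq L] (G : MetaMonoidOps L) : Prop where
  assoc : ∀ {x y z u v : L} {X Y Y' Z : Finset L} (h₁ : Stitches x y u X Y)
    (h₂ : Stitches u z v Y Z) (h₃ : Stitches y z u X Y') (h₄ : Stitches x u v Y' Z)
    (T : G.carrier X), G.stitch h₂ (G.stitch h₁ T) = G.stitch h₄ (G.stitch h₃ T)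
  left_one : ∀ {a b c : L} {X Y Z : Finset L} (h₁ : Extends a X Y) (h₂ : Stitches a b c Y Z)
    (h₃ : Relabels b c X Z) (T : G.carrier X), G.stitch h₂ (G.one h₁ T) = G.rename h₃ T
  right_one : ∀ {a b c : L} {X Y Z : Finset L} (h₁ : Extends b X Y) (h₂ : Stitches a b c Y Z)
    (h₃ : Relabels a c X Z) (T : G.carrier X), G.stitch h₂ (G.one h₁ T) = G.rename h₃ T
  one_rename : ∀ {a b : L} {X Y Z : Finset L} (h₁ : Extends a X Y) (h₂ : Relabels a b Y Z)
    (h₃ : Extends b X Z) (T : G.carrier X), G.rename h₂ (G.one h₁ T) = G.one h₃ T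
  rename_rename : ∀ {a b c : L} {X Y Z : Finset L} (h₁ : Relabels a b X Y)
    (h₂ : Relabels b c Y Z) (h₃ : Relabels a c X Z) (T : G.carrier X),
    G.rename h₂ (G.rename h₁ T) = G.rename h₃ T
  rename_back : ∀ {a b : L} {X Y : Finset L} (h₁ : Relabels a b X Y) (h₂ : Relabels b a Y X)
    (T : G.carrier X), G.rename h₂ (G.rename h₁ T) = T
  rename_del : ∀ {a b : L} {X Y Z : Finset L} (h₁ : Relabels a b X Y) (h₂ : Extends b Z Y)
    (h₃ : Extends a Z X) (T : G.carrier X), G.del h₂ (G.rename h₁ T) = G.del h₃ T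
  one_del : ∀ {a : L} {X Y : Finset L} (h : Extends a X Y) (T : G.carrier X),
    G.del h (G.one h T) = T
  stitch_rename : ∀ {a b c d : L} {X Y Z : Finset L} (h₁ : Stitches a b c X Y)
    (h₂ : Relabels c d Y Z) (h₃ : Stitches a b d X Z) (T : G.carrier X),
    G.rename h₂ (G.stitch h₁ T) = G.stitch h₃ T
  rename_stitch : ∀ {a b c d : L} {X Y Z : Finset L} (h₁ : Relabels a b X Y)
    (h₂ : Stitches b c d Y Z) (h₃ : Stitches a c d X Z) (T : G.carrier X),
    G.stitch h₂ (G.rename h₁ T) = G.stitch h₃ T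
  -- operations with distinct labels commute
  stitch_stitch_comm : ∀ {a b c d e f : L} {X Y Y' Z : Finset L},
    Disjoint ({a, b, c} : Finset L) {d, e, f} →
    ∀ (h₁ : Stitches a b c X Y) (h₂ : Stitches d e f Y Z) (h₃ : Stitches d e f X Y')
    (h₄ : Stitches a b c Y' Z) (T : G.carrier X),
    G.stitch h₂ (G.stitch h₁ T) = G.stitch h₄ (G.stitch h₃ T)
  stitch_one_comm : ∀ {a b c d : L} {X Y Y' Z : Finset L}, d ∉ ({a, b, c} : Finset L) →
    ∀ (h₁ : Stitches a b c X Y) (h₂ : Extends d Y Z) (h₃ : Extends d X Y')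
    (h₄ : Stitches a b c Y' Z) (T : G.carrier X),
    G.one h₂ (G.stitch h₁ T) = G.stitch h₄ (G.one h₃ T)
  stitch_del_comm : ∀ {a b c d : L} {X Y Y' Z : Finset L}, d ∉ ({a, b, c} : Finset L) →
    ∀ (h₁ : Stitches a b c X Y) (h₂ : Extends d Z Y) (h₃ : Extends d Y' X)
    (h₄ : Stitches a b c Y' Z) (T : G.carrier X),
    G.del h₂ (G.stitch h₁ T) = G.stitch h₄ (G.del h₃ T)
  stitch_rename_comm : ∀ {a b c d e : L} {X Y Y' Z : Finset L},
    Disjoint ({a, b, c} : Finset L) {d, e} →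
    ∀ (h₁ : Stitches a b c X Y) (h₂ : Relabels d e Y Z) (h₃ : Relabels d e X Y')
    (h₄ : Stitches a b c Y' Z) (T : G.carrier X),
    G.rename h₂ (G.stitch h₁ T) = G.stitch h₄ (G.rename h₃ T)
  one_one_comm : ∀ {a b : L} {X Y Y' Z : Finset L}, a ≠ b →
    ∀ (h₁ : Extends a X Y) (h₂ : Extends b Y Z) (h₃ : Extends b X Y') (h₄ : Extends a Y' Z)
    (T : G.carrier X), G.one h₂ (G.one h₁ T) = G.one h₄ (G.one h₃ T)
  one_del_comm : ∀ {a b : L} {X Y Y' Z : Finset L}, a ≠ b →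
    ∀ (h₁ : Extends a X Y) (h₂ : Extends b Z Y) (h₃ : Extends b Y' X) (h₄ : Extends a Y' Z)
    (T : G.carrier X), G.del h₂ (G.one h₁ T) = G.one h₄ (G.del h₃ T)
  one_rename_comm : ∀ {a b c : L} {X Y Y' Z : Finset L}, a ∉ ({b, c} : Finset L) →
    ∀ (h₁ : Extends a X Y) (h₂ : Relabels b c Y Z) (h₃ : Relabels b c X Y')
    (h₄ : Extends a Y' Z) (T : G.carrier X),
    G.rename h₂ (G.one h₁ T) = G.one h₄ (G.rename h₃ T)
  del_del_comm : ∀ {a b : L} {X Y Y' Z : Finset L}, a ≠ b →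
    ∀ (h₁ : Extends a Y X) (h₂ : Extends b Z Y) (h₃ : Extends b Y' X) (h₄ : Extends a Z Y')
    (T : G.carrier X), G.del h₂ (G.del h₁ T) = G.del h₄ (G.del h₃ T)
  del_rename_comm : ∀ {a b c : L} {X Y Y' Z : Finset L}, a ∉ ({b, c} : Finset L) →
    ∀ (h₁ : Extends a Y X) (h₂ : Relabels b c Y Z) (h₃ : Relabels b c X Y')
    (h₄ : Extends a Z Y') (T : G.carrier X),
    G.rename h₂ (G.del h₁ T) = G.del h₄ (G.rename h₃ T)
  rename_rename_comm : ∀ {a b c d : L} {X Y Y' Z : Finset L},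
    Disjoint ({a, b} : Finset L) {c, d} →
    ∀ (h₁ : Relabels a b X Y) (h₂ : Relabels c d Y Z) (h₃ : Relabels c d X Y')
    (h₄ : Relabels a b Y' Z) (T : G.carrier X),
    G.rename h₂ (G.rename h₁ T) = G.rename h₄ (G.rename h₃ T)
  -- disjoint union is commutative and associative, and commutes with the other operations
  union_comm : ∀ {X Y Z : Finset L} (h₁ : Splits X Y Z) (h₂ : Splits Y X Z) (T : G.carrier X)
    (U : G.carrier Y), G.union h₁ T U = G.union h₂ U T
  union_assoc : ∀ {X Y Z XY YZ XYZ : Finset L} (h₁ : Splits X Y XY) (h₂ : Splits XY Z XYZ)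
    (h₃ : Splits Y Z YZ) (h₄ : Splits X YZ XYZ) (T : G.carrier X) (U : G.carrier Y)
    (V : G.carrier Z), G.union h₂ (G.union h₁ T U) V = G.union h₄ T (G.union h₃ U V)
  union_stitch : ∀ {a b c : L} {X X' Y Z Z' : Finset L} (h₁ : Splits X Y Z)
    (h₂ : Stitches a b c Z Z') (h₃ : Stitches a b c X X') (h₄ : Splits X' Y Z')
    (T : G.carrier X) (U : G.carrier Y),
    G.stitch h₂ (G.union h₁ T U) = G.union h₄ (G.stitch h₃ T) U
  union_one : ∀ {a : L} {X X' Y Z Z' : Finset L} (h₁ : Splits X Y Z)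
    (h₂ : Extends a Z Z') (h₃ : Extends a X X') (h₄ : Splits X' Y Z')
    (T : G.carrier X) (U : G.carrier Y),
    G.one h₂ (G.union h₁ T U) = G.union h₄ (G.one h₃ T) U
  union_del : ∀ {a : L} {X X' Y Z Z' : Finset L} (h₁ : Splits X Y Z)
    (h₂ : Extends a Z' Z) (h₃ : Extends a X' X) (h₄ : Splits X' Y Z')
    (T : G.carrier X) (U : G.carrier Y),
    G.del h₂ (G.union h₁ T U) = G.union h₄ (G.del h₃ T) U
  union_rename : ∀ {a b : L} {X X' Y Z Z' : Finset L} (h₁ : Splits X Y Z)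
    (h₂ : Relabels a b Z Z') (h₃ : Relabels a b X X') (h₄ : Splits X' Y Z')
    (T : G.carrier X) (U : G.carrier Y),
    G.rename h₂ (G.union h₁ T U) = G.union h₄ (G.rename h₃ T) U

/-- The operations of `G` make it a meta-monoid. -/
structure IsMetaMonoid {L : Type*} [DecidableEq L] (G : MetaMonoidOps L) : Prop
    extends IsPreMetaMonoid G where
  stitch_del : ∀ {a b c : L} {X Y Z S : Finset L} (h₁ : Stitches a b c X Y)
    (h₂ : Extends c S Y) (h₃ : Extends b Z X) (h₄ : Extends a S Z) (T : G.carrier X),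
    G.del h₂ (G.stitch h₁ T) = G.del h₄ (G.del h₃ T)

/-- A family of maps that commutes with the meta-monoid operations. -/
structure MetaMonoidHom {L : Type*} [DecidableEq L] (G H : MetaMonoidOps L) where
  toFun : ∀ X : Finset L, G.carrier X → H.carrier X
  map_stitch : ∀ {a b c : L} {X Y : Finset L} (h : Stitches a b c X Y) (T : G.carrier X),
    toFun Y (G.stitch h T) = H.stitch h (toFun X T)
  map_one : ∀ {a : L} {X Y : Finset L} (h : Extends a X Y) (T : G.carrier X),
    toFun Y (G.one h T) = H.one h (toFun X T)
  map_del : ∀ {a : L} {X Y : Finset L} (h : Extends a X Y) (T : G.carrier Y),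
    toFun X (G.del h T) = H.del h (toFun Y T)
  map_union : ∀ {X Y Z : Finset L} (h : Splits X Y Z) (T : G.carrier X) (U : G.carrier Y),
    toFun Z (G.union h T U) = H.union h (toFun X T) (toFun Y U)
  map_rename : ∀ {a b : L} {X Y : Finset L} (h : Relabels a b X Y) (T : G.carrier X),
    toFun Y (G.rename h T) = H.rename h (toFun X T)

/-- The subsets `P` are closed under the operations of `G`. -/
structure MetaMonoidOps.IsClosed {L : Type*} [DecidableEq L] (G : MetaMonoidOps L)
    (P : ∀ X : Finset L, G.carrier X → Prop) : Prop where
  stitch : ∀ {a b c : L} {X Y : Finset L} (h : Stitches a b c X Y) (T : G.carrier X),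
    P X T → P Y (G.stitch h T)
  one : ∀ {a : L} {X Y : Finset L} (h : Extends a X Y) (T : G.carrier X),
    P X T → P Y (G.one h T)
  del : ∀ {a : L} {X Y : Finset L} (h : Extends a X Y) (T : G.carrier Y),
    P Y T → P X (G.del h T)
  union : ∀ {X Y Z : Finset L} (h : Splits X Y Z) (T : G.carrier X) (U : G.carrier Y),
    P X T → P Y U → P Z (G.union h T U)
  rename : ∀ {a b : L} {X Y : Finset L} (h : Relabels a b X Y) (T : G.carrier X),
    P X T → P Y (G.rename h T)

/-- The operations of `G` restricted to closed subsets. -/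
def MetaMonoidOps.restrict {L : Type*} [DecidableEq L] (G : MetaMonoidOps L)
    (P : ∀ X : Finset L, G.carrier X → Prop) (hP : G.IsClosed P) : MetaMonoidOps L where
  carrier X := {T : G.carrier X // P X T}
  stitch h T := ⟨G.stitch h T.1, hP.stitch h T.1 T.2⟩
  one h T := ⟨G.one h T.1, hP.one h T.1 T.2⟩
  del h T := ⟨G.del h T.1, hP.del h T.1 T.2⟩
  union h T U := ⟨G.union h T.1 U.1, hP.union h T.1 U.1 T.2 U.2⟩
  rename h T := ⟨G.rename h T.1, hP.rename h T.1 T.2⟩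

/-! ### `Γ`-calculus -/

section RatField

variable {L : Type*}

/-- The field `R_X = ℚ(t_i : i ∈ X)`. -/
abbrev RatField (X : Finset L) : Type _ := FractionRing (MvPolynomial X ℚ)

/-- The variable `t_i`. -/
noncomputable def tvar {X : Finset L} (i : X) : RatField X :=
  algebraMap (MvPolynomial X ℚ) (RatField X) (MvPolynomial.X i)

/-- `r` makes sense when all variables are set to `1`, and has the value `c` there. -/
def ValueAtOne {X : Finset L} (r : RatField X) (c : ℚ) : Prop :=
  SubstTo (fun _ : X => (1 : ℚ)) r c

theorem valueAtOne_tvar {X : Finset L} (i : X) : ValueAtOne (tvar i) 1 := by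
  have := SubstTo.poly (v := fun _ : X => (1 : ℚ)) (MvPolynomial.X i)
  rwa [MvPolynomial.aeval_X] at this

theorem ValueAtOne.subst {X Y : Finset L} {v : X → RatField Y} (hv : ∀ i, ValueAtOne (v i) 1)
    {r : RatField X} {c : ℚ} (h : ValueAtOne r c) : ValueAtOne (substRat v r) c :=
  (SubstTo.comp_one hv h).2

end RatField

section Gamma

variable {L : Type*} [DecidableEq L]

theorem Stitches.mem_left {a b c : L} {X Y : Finset L} (h : Stitches a b c X Y) : a ∈ X := by
  obtain ⟨S, -, -, -, -, rfl, -⟩ := h; simp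

theorem Stitches.mem_right {a b c : L} {X Y : Finset L} (h : Stitches a b c X Y) : b ∈ X := by
  obtain ⟨S, -, -, -, -, rfl, -⟩ := h; simp

theorem Stitches.ne {a b c : L} {X Y : Finset L} (h : Stitches a b c X Y) : a ≠ b := by
  obtain ⟨S, h, -⟩ := h; exact h

theorem Stitches.mem_new {a b c : L} {X Y : Finset L} (h : Stitches a b c X Y) : c ∈ Y := by
  obtain ⟨S, -, -, -, -, -, rfl⟩ := h; simp

theorem Stitches.mem_old {a b c i : L} {X Y : Finset L} (h : Stitches a b c X Y)
    (hi : i ∈ Y) (hc : i ≠ c) : i ∈ X ∧ i ≠ a ∧ i ≠ b := by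
  obtain ⟨S, -, h1, h2, -, rfl, rfl⟩ := h
  have hS : i ∈ S := by simpa [hc] using hi
  refine ⟨by simp [hS], ?_, ?_⟩
  · rintro rfl; exact h1 hS
  · rintro rfl; exact h2 hS

theorem Stitches.mem_rest {a b c i : L} {X Y : Finset L} (h : Stitches a b c X Y)
    (hi : i ∈ X) (ha : i ≠ a) (hb : i ≠ b) : i ∈ Y ∧ i ≠ c := by
  obtain ⟨S, -, -, -, h3, rfl, rfl⟩ := h
  have hS : i ∈ S := by simpa [ha, hb] using hi
  refine ⟨by simp [hS], ?_⟩
  rintro rfl; exact h3 hS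

/-- The row of the old matrix from which row `i` of the stitched matrix comes
(`y_c` comes from `y_a`). -/
def Stitches.row {a b c : L} {X Y : Finset L} (h : Stitches a b c X Y) (i : Y) : X :=
  if hi : i.1 = c then ⟨a, h.mem_left⟩ else ⟨i.1, (h.mem_old i.2 hi).1⟩

/-- The column of the old matrix from which column `j` of the stitched matrix comes
(`x_c` comes from `x_b`). -/
def Stitches.col {a b c : L} {X Y : Finset L} (h : Stitches a b c X Y) (j : Y) : X :=
  if hj : j.1 = c then ⟨b, h.mem_right⟩ else ⟨j.1, (h.mem_old j.2 hj).1⟩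

/-- The label after stitching: `a, b ↦ c`. -/
def Stitches.label {a b c : L} {X Y : Finset L} (h : Stitches a b c X Y) (i : X) : Y :=
  if hi : i.1 = a ∨ i.1 = b then ⟨c, h.mem_new⟩
  else ⟨i.1, (h.mem_rest i.2 (fun e => hi (Or.inl e)) (fun e => hi (Or.inr e))).1⟩

theorem Extends.mem_new {a : L} {X Y : Finset L} (h : Extends a X Y) : a ∈ Y := by
  rw [h.2]; simp

theorem Extends.mem_of_mem {a i : L} {X Y : Finset L} (h : Extends a X Y) (hi : i ∈ X) :
    i ∈ Y := by
  rw [h.2]; simp [hi]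

theorem Extends.mem_old {a i : L} {X Y : Finset L} (h : Extends a X Y) (hi : i ∈ Y)
    (ha : i ≠ a) : i ∈ X := by
  rw [h.2] at hi; simpa [ha] using hi

theorem Splits.mem_left {i : L} {X Y Z : Finset L} (h : Splits X Y Z) (hi : i ∈ X) : i ∈ Z := by
  rw [h.2]; simp [hi]

theorem Splits.mem_right {i : L} {X Y Z : Finset L} (h : Splits X Y Z) (hi : i ∈ Y) :
    i ∈ Z := by
  rw [h.2]; simp [hi]

theorem Relabels.symm {a b : L} {X Y : Finset L} (h : Relabels a b X Y) : Relabels b a Y X := by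
  obtain ⟨S, h1, h2, h3, h4⟩ := h
  exact ⟨S, h2, h1, h4, h3⟩

theorem Relabels.mem_new {a b : L} {X Y : Finset L} (h : Relabels a b X Y) : b ∈ Y := by
  obtain ⟨S, -, -, -, rfl⟩ := h; simp

theorem Relabels.mem_rest {a b i : L} {X Y : Finset L} (h : Relabels a b X Y) (hi : i ∈ X)
    (ha : i ≠ a) : i ∈ Y ∧ i ≠ b := by
  obtain ⟨S, -, h2, rfl, rfl⟩ := h
  have hS : i ∈ S := by simpa [ha] using hi
  refine ⟨by simp [hS], ?_⟩
  rintro rfl; exact h2 hS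

/-- The label after renaming: `a ↦ b`. -/
def Relabels.label {a b : L} {X Y : Finset L} (h : Relabels a b X Y) (i : X) : Y :=
  if hi : i.1 = a then ⟨b, h.mem_new⟩ else ⟨i.1, (h.mem_rest i.2 hi).1⟩

theorem Relabels.label_injective {a b : L} {X Y : Finset L} (h : Relabels a b X Y) :
    Function.Injective h.label := by
  intro i j hij
  unfold Relabels.label at hij
  split_ifs at hij with h1 h2 h2
  · exact Subtype.ext (h1.trans h2.symm)
  · exact absurd (congrArg Subtype.val hij).symm (h.mem_rest j.2 h2).2
  · exact absurd (congrArg Subtype.val hij) (h.mem_rest i.2 h1).2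
  · exact Subtype.ext (congrArg (fun z : Y => z.1) hij)

/-- The substitution `t_a → 1` from `R_Y` to `R_X`, where `Y = X ∪ {a}`. -/
noncomputable def Extends.subst {a : L} {X Y : Finset L} (h : Extends a X Y) (i : Y) :
    RatField X :=
  if hi : i.1 = a then 1 else tvar ⟨i.1, h.mem_old i.2 hi⟩

theorem Extends.valueAtOne_subst {a : L} {X Y : Finset L} (h : Extends a X Y) (i : Y) :
    ValueAtOne (h.subst i) 1 := by
  unfold Extends.subst
  split_ifs
  · exact SubstTo.one
  · exact valueAtOne_tvar _

/-- The set `Γ^X`: a scalar in `R_X` and an `X × X` matrix over `R_X` (rows labeled by `y_i`,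
columns by `x_j`), in which all variables can be set to `1`, the matrix then becoming the
identity. -/
@[ext]
structure Gamma (X : Finset L) where
  scalar : RatField X
  mat : Matrix X X (RatField X)
  scalar_regular : ∃ c, ValueAtOne scalar c
  mat_one : ∀ i j, ValueAtOne (mat i j) (if i = j then 1 else 0)

namespace Gamma

noncomputable def stitch {a b c : L} {X Y : Finset L} (h : Stitches a b c X Y) (T : Gamma X) :
    Gamma Y where
  scalar := substRat (fun i => tvar (h.label i))
    ((1 - T.mat ⟨b, h.mem_right⟩ ⟨a, h.mem_left⟩) * T.scalar)
  mat i j := substRat (fun i => tvar (h.label i))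
    (T.mat (h.row i) (h.col j) +
      T.mat (h.row i) ⟨a, h.mem_left⟩ * T.mat ⟨b, h.mem_right⟩ (h.col j) /
        (1 - T.mat ⟨b, h.mem_right⟩ ⟨a, h.mem_left⟩))
  scalar_regular := by
    obtain ⟨c, hc⟩ := T.scalar_regular
    exact ⟨_, ValueAtOne.subst (fun i => valueAtOne_tvar _)
      ((SubstTo.one.sub (T.mat_one _ _)).mul hc)⟩
  mat_one i j := by
    have hg : ValueAtOne (1 - T.mat ⟨b, h.mem_right⟩ ⟨a, h.mem_left⟩) 1 := by
      have := SubstTo.one.sub (T.mat_one ⟨b, h.mem_right⟩ ⟨a, h.mem_left⟩)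
      rwa [if_neg (fun e => h.ne (congrArg Subtype.val e).symm), sub_zero] at this
    have := ValueAtOne.subst (v := fun i => tvar (h.label i)) (fun i => valueAtOne_tvar _)
      ((T.mat_one (h.row i) (h.col j)).add
      (((T.mat_one (h.row i) ⟨a, h.mem_left⟩).mul (T.mat_one ⟨b, h.mem_right⟩ (h.col j))).div
        hg one_ne_zero))
    convert this using 1
    unfold Stitches.row Stitches.col
    by_cases hi : i.1 = c <;> by_cases hj : j.1 = c
    · have : i = j := Subtype.ext (hi.trans hj.symm)
      simp [hj, this, h.ne]
    · have hij : i ≠ j := fun e => hj (by rw [← e]; exact hi)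
      have := h.mem_old j.2 hj
      simp [hi, hj, hij, this.2.1.symm, this.2.2.symm]
    · have hij : i ≠ j := fun e => hi (by rw [e]; exact hj)
      have := h.mem_old i.2 hi
      simp [hi, hj, hij, this.2.1, this.2.2]
    · have h1 := h.mem_old i.2 hi
      simp [hi, hj, h1.2.1]

noncomputable def one {a : L} {X Y : Finset L} (h : Extends a X Y) (T : Gamma X) :
    Gamma Y where
  scalar := substRat (fun i : X => tvar ⟨i.1, h.mem_of_mem i.2⟩) T.scalar
  mat i j :=
    if hij : i.1 ≠ a ∧ j.1 ≠ a then
      substRat (fun i : X => tvar ⟨i.1, h.mem_of_mem i.2⟩)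
        (T.mat ⟨i.1, h.mem_old i.2 hij.1⟩ ⟨j.1, h.mem_old j.2 hij.2⟩)
    else if i = j then 1 else 0
  scalar_regular := by
    obtain ⟨c, hc⟩ := T.scalar_regular
    exact ⟨_, ValueAtOne.subst (fun i => valueAtOne_tvar _) hc⟩
  mat_one i j := by
    by_cases hij : i.1 ≠ a ∧ j.1 ≠ a
    · rw [dif_pos hij]
      have := ValueAtOne.subst (v := fun i : X => tvar (⟨i.1, h.mem_of_mem i.2⟩ : Y))
        (fun i => valueAtOne_tvar _)
        (T.mat_one ⟨i.1, h.mem_old i.2 hij.1⟩ ⟨j.1, h.mem_old j.2 hij.2⟩)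
      simpa only [Subtype.mk.injEq, Subtype.coe_inj] using this
    · rw [dif_neg hij]
      split_ifs
      · exact SubstTo.one
      · exact SubstTo.zero

noncomputable def del {a : L} {X Y : Finset L} (h : Extends a X Y) (T : Gamma Y) :
    Gamma X where
  scalar := substRat h.subst T.scalar
  mat i j := substRat h.subst (T.mat ⟨i.1, h.mem_of_mem i.2⟩ ⟨j.1, h.mem_of_mem j.2⟩)
  scalar_regular := by
    obtain ⟨c, hc⟩ := T.scalar_regular
    exact ⟨_, ValueAtOne.subst h.valueAtOne_subst hc⟩
  mat_one i j := by
    have := ValueAtOne.subst h.valueAtOne_subst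
      (T.mat_one ⟨i.1, h.mem_of_mem i.2⟩ ⟨j.1, h.mem_of_mem j.2⟩)
    simpa only [Subtype.mk.injEq, Subtype.coe_inj] using this

noncomputable def union {X Y Z : Finset L} (h : Splits X Y Z) (T : Gamma X) (U : Gamma Y) :
    Gamma Z where
  scalar := substRat (fun i : X => tvar ⟨i.1, h.mem_left i.2⟩) T.scalar *
    substRat (fun i : Y => tvar ⟨i.1, h.mem_right i.2⟩) U.scalar
  mat i j :=
    if hX : i.1 ∈ X ∧ j.1 ∈ X then
      substRat (fun i : X => tvar ⟨i.1, h.mem_left i.2⟩) (T.mat ⟨i.1, hX.1⟩ ⟨j.1, hX.2⟩)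
    else if hY : i.1 ∈ Y ∧ j.1 ∈ Y then
      substRat (fun i : Y => tvar ⟨i.1, h.mem_right i.2⟩) (U.mat ⟨i.1, hY.1⟩ ⟨j.1, hY.2⟩)
    else 0
  scalar_regular := by
    obtain ⟨c, hc⟩ := T.scalar_regular
    obtain ⟨d, hd⟩ := U.scalar_regular
    exact ⟨_, (ValueAtOne.subst (fun i => valueAtOne_tvar _) hc).mul
      (ValueAtOne.subst (fun i => valueAtOne_tvar _) hd)⟩
  mat_one i j := by
    by_cases hX : i.1 ∈ X ∧ j.1 ∈ X
    · rw [dif_pos hX]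
      have := ValueAtOne.subst (v := fun i : X => tvar (⟨i.1, h.mem_left i.2⟩ : Z))
        (fun i => valueAtOne_tvar _) (T.mat_one ⟨i.1, hX.1⟩ ⟨j.1, hX.2⟩)
      simpa only [Subtype.mk.injEq, Subtype.coe_inj] using this
    · rw [dif_neg hX]
      by_cases hY : i.1 ∈ Y ∧ j.1 ∈ Y
      · rw [dif_pos hY]
        have := ValueAtOne.subst (v := fun i : Y => tvar (⟨i.1, h.mem_right i.2⟩ : Z))
          (fun i => valueAtOne_tvar _) (U.mat_one ⟨i.1, hY.1⟩ ⟨j.1, hY.2⟩)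
        simpa only [Subtype.mk.injEq, Subtype.coe_inj] using this
      · rw [dif_neg hY]
        have hij : i ≠ j := by
          rintro rfl
          have := Finset.mem_union.1 (h.2 ▸ i.2 : i.1 ∈ X ∪ Y)
          simp only [and_self] at hX hY
          exact this.elim hX hY
        rw [if_neg hij]
        exact SubstTo.zero

noncomputable def rename {a b : L} {X Y : Finset L} (h : Relabels a b X Y) (T : Gamma X) :
    Gamma Y where
  scalar := substRat (fun i => tvar (h.label i)) T.scalar
  mat i j := substRat (fun i => tvar (h.label i)) (T.mat (h.symm.label i) (h.symm.label j))
  scalar_regular := by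
    obtain ⟨c, hc⟩ := T.scalar_regular
    exact ⟨_, ValueAtOne.subst (fun i => valueAtOne_tvar _) hc⟩
  mat_one i j := by
    have := ValueAtOne.subst (v := fun i => tvar (h.label i)) (fun i => valueAtOne_tvar _)
      (T.mat_one (h.symm.label i) (h.symm.label j))
    simpa [h.symm.label_injective.eq_iff] using this

/-- Every off-diagonal entry of row `y_i` vanishes under the substitution `t_i → 1`. -/
def RowCondition (X : Finset L) (T : Gamma X) : Prop :=
  ∀ i j : X, i ≠ j → SubstTo (fun k : X => if k = i then 1 else tvar k) (T.mat i j) 0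

end Gamma

/-- `Γ`-calculus. -/
noncomputable def gammaCalculus (L : Type*) [DecidableEq L] : MetaMonoidOps L where
  carrier X := Gamma X
  stitch h T := Gamma.stitch h T
  one h T := Gamma.one h T
  del h T := Gamma.del h T
  union h T U := Gamma.union h T U
  rename h T := Gamma.rename h T

end Gamma

/-! ### w-tangles -/

/-- A passage of a strand through a (non-virtual) crossing: the name of the crossing, whether
the strand is the overstrand there, and the sign of the crossing. -/
abbrev Pass : Type := ℕ × Bool × ℤˣ

/-- Passage over the crossing `n` of sign `s`. -/
def overpass (n : ℕ) (s : ℤˣ) : Pass := (n, true, s)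

/-- Passage under the crossing `n` of sign `s`. -/
def underpass (n : ℕ) (s : ℤˣ) : Pass := (n, false, s)

/-- The same crossing, seen from the other strand. -/
def Pass.other (p : Pass) : Pass := (p.1, !p.2.1, p.2.2)

/-- Renaming of crossings. -/
def Pass.relabel (f : ℕ → ℕ) (p : Pass) : Pass := (f p.1, p.2)

theorem Pass.relabel_injective {f : ℕ → ℕ} (hf : Function.Injective f) :
    Function.Injective (Pass.relabel f) := by
  intro p q h
  simp only [Pass.relabel, Prod.mk.injEq] at h
  exact Prod.ext (hf h.1) h.2

/-- A w-tangle diagram with strands labeled by `X`, recorded by its Gauss diagram: `code x`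
lists, in the order of the orientation of strand `x`, the passages of `x` through positive and
negative crossings. Each crossing is passed exactly twice, once over and once under. -/
@[ext]
structure GaussDiagram {L : Type*} (X : Finset L) where
  code : L → List Pass
  code_nil : ∀ x ∉ X, code x = []
  nodup : ∀ x, ((code x).map fun p => (p.1, p.2.1)).Nodup
  disj : ∀ x y, ∀ p ∈ code x, ∀ q ∈ code y, p.1 = q.1 → p.2.1 = q.2.1 → x = y
  pair : ∀ x, ∀ p ∈ code x, ∃ y, p.other ∈ code y

/-- `p` is immediately followed by `q` on some strand. -/
def Adjacent {L : Type*} (c : L → List Pass) (p q : Pass) : Prop := ∃ x, [p, q] <:+: c x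

/-- `p` and `q` are adjacent, in this order if `e = 1`, in the opposite order if `e = -1`. -/
def AdjacentSign {L : Type*} (c : L → List Pass) (e : ℤˣ) (p q : Pass) : Prop :=
  (e = 1 ∧ Adjacent c p q) ∨ (e = -1 ∧ Adjacent c q p)

/-- Exchange of the places of `p` and `q`. -/
def swapCode {L : Type*} (p q : Pass) (c : L → List Pass) : L → List Pass :=
  fun x => (c x).map (Equiv.swap p q)

/-- Removal of the crossings `n` and `m`. -/
def eraseCode {L : Type*} (n m : ℕ) (c : L → List Pass) : L → List Pass :=
  fun x => (c x).filter fun p => decide (p.1 ≠ n ∧ p.1 ≠ m)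

/-- The moves that define w-tangles, on the level of Gauss diagrams. -/
inductive GaussMove {L : Type*} {X : Finset L} : GaussDiagram X → GaussDiagram X → Prop
  /-- The names of the crossings are immaterial. -/
  | relabel {D D' : GaussDiagram X} (f : ℕ → ℕ) (hf : Function.Injective f)
      (h : D'.code = fun x => (D.code x).map (Pass.relabel f)) : GaussMove D D'
  /-- `R2`: one piece of strand passes over another one in two consecutive crossings of
  opposite signs; the two pieces are parallel or antiparallel. -/
  | r2 {D D' : GaussDiagram X} (n m : ℕ) (s : ℤˣ)
      (hover : Adjacent D.code (overpass n s) (overpass m (-s)))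
      (hunder : Adjacent D.code (underpass n s) (underpass m (-s)) ∨
        Adjacent D.code (underpass m (-s)) (underpass n s))
      (h : D'.code = eraseCode n m D.code) : GaussMove D D'
  /-- `R3`: crossing `n₁` is top over middle, `n₂` top over bottom, `n₃` middle over bottom.
  The signs determine how the three pieces of strand are oriented with respect to each other,
  hence the order of the crossings on the middle and on the bottom piece once that on the top
  piece is given. The move reverses all three orders. -/
  | r3 {D D' : GaussDiagram X} (n₁ n₂ n₃ : ℕ) (s₁ s₂ s₃ : ℤˣ)
      (h₁₂ : n₁ ≠ n₂) (h₁₃ : n₁ ≠ n₃) (h₂₃ : n₂ ≠ n₃)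
      (htop : Adjacent D.code (overpass n₁ s₁) (overpass n₂ s₂))
      (hmiddle : AdjacentSign D.code (s₂ * s₃) (underpass n₁ s₁) (overpass n₃ s₃))
      (hbottom : AdjacentSign D.code (s₁ * s₃) (underpass n₂ s₂) (underpass n₃ s₃))
      (h : D'.code = swapCode (overpass n₁ s₁) (overpass n₂ s₂) (swapCode (underpass n₁ s₁) (overpass n₃ s₃)
        (swapCode (underpass n₂ s₂) (underpass n₃ s₃) D.code))) : GaussMove D D'
  /-- `OC`: consecutive overcrossings commute. -/
  | oc {D D' : GaussDiagram X} (n m : ℕ) (s s' : ℤˣ)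
      (hover : Adjacent D.code (overpass n s) (overpass m s'))
      (h : D'.code = swapCode (overpass n s) (overpass m s') D.code) : GaussMove D D'

/-- The w-tangles with components labeled by `X`. -/
def WTangle {L : Type*} (X : Finset L) : Type _ :=
  Quot (GaussMove : GaussDiagram X → GaussDiagram X → Prop)

/-! Codes without repetitions, and filters on them. -/

section Code

variable {L : Type*}

/-- No passage occurs twice. -/
def CodeSimple (c : L → List Pass) : Prop :=
  (∀ x, (c x).Nodup) ∧ ∀ x y p, p ∈ c x → p ∈ c y → x = y

theorem GaussDiagram.simple {X : Finset L} (D : GaussDiagram X) : CodeSimple D.code :=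
  ⟨fun x => (D.nodup x).of_map _, fun x y p hx hy => D.disj x y p hx p hy rfl rfl⟩

theorem CodeSimple.swap {c : L → List Pass} (hc : CodeSimple c) (p q : Pass) :
    CodeSimple (swapCode p q c) := by
  refine ⟨fun x => (hc.1 x).map (Equiv.injective _), fun x y r hx hy => ?_⟩
  simp only [swapCode, List.mem_map] at hx hy
  obtain ⟨a, ha, rfl⟩ := hx
  obtain ⟨b, hb, hab⟩ := hy
  rw [(Equiv.injective _) hab] at hb
  exact hc.2 x y a ha hb

theorem Adjacent.mem {c : L → List Pass} {p q : Pass} (h : Adjacent c p q) :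
    ∃ x, p ∈ c x ∧ q ∈ c x := by
  obtain ⟨x, hx⟩ := h
  exact ⟨x, hx.subset (by simp), hx.subset (by simp)⟩

theorem AdjacentSign.mem {c : L → List Pass} {e : ℤˣ} {p q : Pass}
    (h : AdjacentSign c e p q) : ∃ x, p ∈ c x ∧ q ∈ c x := by
  rcases h with ⟨-, h⟩ | ⟨-, h⟩
  · exact h.mem
  · obtain ⟨x, h1, h2⟩ := h.mem
    exact ⟨x, h2, h1⟩

/-- A map of codes that is compatible with adjacency. -/
theorem AdjacentSign.imp {L' : Type*} {c : L → List Pass} {c' : L' → List Pass} {e : ℤˣ}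
    {p q p' q' : Pass} (h : AdjacentSign c e p q) (h1 : Adjacent c p q → Adjacent c' p' q')
    (h2 : Adjacent c q p → Adjacent c' q' p') : AdjacentSign c' e p' q' :=
  Or.imp (And.imp_right h1) (And.imp_right h2) h

theorem Adjacent.map {c : L → List Pass} {p q : Pass} (f : Pass → Pass) (h : Adjacent c p q) :
    Adjacent (fun x => (c x).map f) (f p) (f q) := by
  obtain ⟨x, hx⟩ := h
  exact ⟨x, by simpa using hx.map f⟩

theorem Adjacent.swap_of_ne {c : L → List Pass} {p q r s : Pass} (h : Adjacent c p q)
    (h1 : p ≠ r) (h2 : p ≠ s) (h3 : q ≠ r) (h4 : q ≠ s) : Adjacent (swapCode r s c) p q := by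
  have := h.map (Equiv.swap r s)
  rwa [Equiv.swap_apply_of_ne_of_ne h1 h2, Equiv.swap_apply_of_ne_of_ne h3 h4] at this

theorem Adjacent.filter {c : L → List Pass} {p q : Pass} (k : Pass → Bool)
    (h : Adjacent c p q) (hp : k p) (hq : k q) : Adjacent (fun x => (c x).filter k) p q := by
  obtain ⟨x, hx⟩ := h
  exact ⟨x, by simpa [hp, hq] using hx.filter k⟩

theorem swapCode_comm {c : L → List Pass} (p q : Pass) : swapCode p q c = swapCode q p c := by
  funext x
  simp only [swapCode, Equiv.swap_comm]

theorem filter_swap_of_visible {c : L → List Pass} {p q : Pass} (k : Pass → Bool)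
    (hp : k p) (hq : k q) :
    (fun x => (swapCode p q c x).filter k) = swapCode p q fun x => (c x).filter k := by
  funext x
  simp only [swapCode, List.filter_map]
  congr 1
  apply List.filter_congr
  intro r _
  by_cases h1 : r = p
  · subst h1; simp [hp, hq]
  by_cases h2 : r = q
  · subst h2; simp [hp, hq]
  simp [Equiv.swap_apply_of_ne_of_ne h1 h2]

theorem map_swap_of_notMem {l : List Pass} {p q : Pass} (hp : p ∉ l) (hq : q ∉ l) :
    l.map (Equiv.swap p q) = l := by
  conv_rhs => rw [← List.map_id l]
  apply List.map_congr_left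
  intro r hr
  rw [Equiv.swap_apply_of_ne_of_ne (by rintro rfl; exact hp hr) (by rintro rfl; exact hq hr)]
  rfl

theorem filter_swap_of_hidden {c : L → List Pass} (hc : CodeSimple c) {p q : Pass}
    (h : Adjacent c p q) (k : Pass → Bool) (hk : k p = false ∨ k q = false) :
    (fun x => (swapCode p q c x).filter k) = fun x => (c x).filter k := by
  obtain ⟨x0, hx0⟩ := h
  funext x
  by_cases hx : x = x0
  · subst hx
    obtain ⟨l, r, hlr⟩ := hx0
    have hnd := hc.1 x
    simp only [swapCode]
    rw [← hlr] at hnd ⊢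
    have e : l ++ [p, q] ++ r = l ++ (p :: q :: r) := by simp
    rw [e] at hnd ⊢
    rw [List.nodup_append] at hnd
    obtain ⟨-, h2, h3⟩ := hnd
    rw [List.nodup_cons, List.nodup_cons] at h2
    have hpl : p ∉ l := fun hh => h3 p hh p (by simp) rfl
    have hql : q ∉ l := fun hh => h3 q hh q (by simp) rfl
    have hpr : p ∉ r := fun hh => h2.1 (by simp [hh])
    have hqr : q ∉ r := h2.2.1
    simp only [List.map_append, List.map_cons, map_swap_of_notMem hpl hql,
      map_swap_of_notMem hpr hqr, Equiv.swap_apply_left, Equiv.swap_apply_right,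
      List.filter_append, List.filter_cons]
    rcases hk with hk | hk <;> simp [hk]
  · have hp : p ∉ c x := fun hh => hx (hc.2 x x0 p hh (hx0.subset (by simp)))
    have hq : q ∉ c x := fun hh => hx (hc.2 x x0 q hh (hx0.subset (by simp)))
    simp only [swapCode, map_swap_of_notMem hp hq]

theorem filter_swap_of_hidden' {c : L → List Pass} (hc : CodeSimple c) {e : ℤˣ} {p q : Pass}
    (h : AdjacentSign c e p q) (k : Pass → Bool) (hk : k p = false ∨ k q = false) :
    (fun x => (swapCode p q c x).filter k) = fun x => (c x).filter k := by
  rcases h with ⟨-, h⟩ | ⟨-, h⟩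
  · exact filter_swap_of_hidden hc h k hk
  · rw [swapCode_comm]
    exact filter_swap_of_hidden hc h k hk.symm

theorem mem_swapCode_iff {c : L → List Pass} (hc : CodeSimple c) {p q : Pass}
    (h : ∃ x, p ∈ c x ∧ q ∈ c x) (x : L) (r : Pass) : r ∈ swapCode p q c x ↔ r ∈ c x := by
  obtain ⟨x0, hp, hq⟩ := h
  by_cases hx : x = x0
  · subst hx
    simp only [swapCode, List.mem_map]
    constructor
    · rintro ⟨a, ha, rfl⟩
      by_cases h1 : a = p
      · subst h1; simpa using hq
      by_cases h2 : a = q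
      · subst h2; simpa using hp
      rwa [Equiv.swap_apply_of_ne_of_ne h1 h2]
    · intro hr
      by_cases h1 : r = p
      · subst h1; exact ⟨q, hq, by simp⟩
      by_cases h2 : r = q
      · subst h2; exact ⟨p, hp, by simp⟩
      exact ⟨r, hr, by rw [Equiv.swap_apply_of_ne_of_ne h1 h2]⟩
  · have hp' : p ∉ c x := fun hh => hx (hc.2 x x0 p hh hp)
    have hq' : q ∉ c x := fun hh => hx (hc.2 x x0 q hh hq)
    simp only [swapCode, map_swap_of_notMem hp' hq']

end Code

set_option linter.unusedSectionVars false

namespace GaussDiagram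

variable {L : Type*} [DecidableEq L]

/-- Follow strand `a` and then strand `b`; call the result `c`. -/
def stitchCode (a b c : L) (d : L → List Pass) : L → List Pass :=
  fun z => if z = c then d a ++ d b else if z = a ∨ z = b then [] else d z

/-- The strand of the stitched diagram to which strand `x` belongs. -/
def newStrand (a b c x : L) : L := if x = a ∨ x = b then c else x

theorem mem_stitchCode {a b c : L} {X Y : Finset L} (h : Stitches a b c X Y)
    {d : L → List Pass} (hd : ∀ x ∉ X, d x = []) (z : L) (p : Pass) :
    p ∈ stitchCode a b c d z ↔ ∃ x, p ∈ d x ∧ newStrand a b c x = z := by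
  unfold stitchCode newStrand
  constructor
  · intro hp
    split_ifs at hp with h1 h2
    · rcases List.mem_append.1 hp with hp | hp
      · exact ⟨a, hp, by simp [h1]⟩
      · exact ⟨b, hp, by simp [h1]⟩
    · simp at hp
    · exact ⟨z, hp, by rw [if_neg h2]⟩
  · rintro ⟨x, hx, rfl⟩
    by_cases h1 : x = a ∨ x = b
    · simp only [if_pos h1]
      rcases h1 with rfl | rfl <;> simp [hx]
    · have hxX : x ∈ X := by
        by_contra hh
        rw [hd x hh] at hx
        simp at hx
      push Not at h1
      have := (h.mem_rest hxX h1.1 h1.2).2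
      simp [h1, this, hx]

def stitch {a b c : L} {X Y : Finset L} (h : Stitches a b c X Y) (D : GaussDiagram X) :
    GaussDiagram Y where
  code := stitchCode a b c D.code
  code_nil z hz := by
    have h1 : z ≠ c := by rintro rfl; exact hz h.mem_new
    unfold stitchCode
    rw [if_neg h1]
    split_ifs with h2
    · rfl
    · push Not at h2
      exact D.code_nil z fun hX => hz (h.mem_rest hX h2.1 h2.2).1
  nodup z := by
    unfold stitchCode
    split_ifs
    · rw [List.map_append, List.nodup_append]
      refine ⟨D.nodup a, D.nodup b, ?_⟩
      rintro k hk k' hk' rfl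
      rw [List.mem_map] at hk hk'
      obtain ⟨p, hp, rfl⟩ := hk
      obtain ⟨q, hq, hpq⟩ := hk'
      simp only [Prod.mk.injEq] at hpq
      exact h.ne (D.disj a b p hp q hq hpq.1.symm hpq.2.symm)
    · simp
    · exact D.nodup z
  disj z w p hp q hq h1 h2 := by
    rw [mem_stitchCode h D.code_nil] at hp hq
    obtain ⟨x, hx, rfl⟩ := hp
    obtain ⟨y, hy, rfl⟩ := hq
    rw [D.disj x y p hx q hy h1 h2]
  pair z p hp := by
    rw [mem_stitchCode h D.code_nil] at hp
    obtain ⟨x, hx, rfl⟩ := hp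
    obtain ⟨y, hy⟩ := D.pair x p hx
    exact ⟨_, (mem_stitchCode h D.code_nil _ _).2 ⟨y, hy, rfl⟩⟩

/-- Rename strand `a` to `b`. -/
def renameCode (a b : L) (d : L → List Pass) : L → List Pass :=
  fun z => if z = b then d a else if z = a then [] else d z

theorem mem_renameCode {a b : L} {X Y : Finset L} (h : Relabels a b X Y)
    {d : L → List Pass} (hd : ∀ x ∉ X, d x = []) (z : L) (p : Pass) :
    p ∈ renameCode a b d z ↔ ∃ x, p ∈ d x ∧ (if x = a then b else x) = z := by
  unfold renameCode
  constructor
  · intro hp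
    split_ifs at hp with h1 h2
    · exact ⟨a, hp, by simp [h1]⟩
    · simp at hp
    · exact ⟨z, hp, by rw [if_neg h2]⟩
  · rintro ⟨x, hx, rfl⟩
    by_cases h1 : x = a
    · subst h1; simpa using hx
    · have hxX : x ∈ X := by
        by_contra hh
        rw [hd x hh] at hx
        simp at hx
      simp [h1, (h.mem_rest hxX h1).2, hx]

def rename {a b : L} {X Y : Finset L} (h : Relabels a b X Y) (D : GaussDiagram X) :
    GaussDiagram Y where
  code := renameCode a b D.code
  code_nil z hz := by
    have h1 : z ≠ b := by rintro rfl; exact hz h.mem_new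
    unfold renameCode
    rw [if_neg h1]
    split_ifs with h2
    · rfl
    · exact D.code_nil z fun hX => hz (h.mem_rest hX h2).1
  nodup z := by
    unfold renameCode
    split_ifs
    · exact D.nodup a
    · simp
    · exact D.nodup z
  disj z w p hp q hq h1 h2 := by
    rw [mem_renameCode h D.code_nil] at hp hq
    obtain ⟨x, hx, rfl⟩ := hp
    obtain ⟨y, hy, rfl⟩ := hq
    rw [D.disj x y p hx q hy h1 h2]
  pair z p hp := by
    rw [mem_renameCode h D.code_nil] at hp
    obtain ⟨x, hx, rfl⟩ := hp
    obtain ⟨y, hy⟩ := D.pair x p hx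
    exact ⟨_, (mem_renameCode h D.code_nil _ _).2 ⟨y, hy, rfl⟩⟩

/-- Add a strand `a` without crossings. -/
def one {a : L} {X Y : Finset L} (h : Extends a X Y) (D : GaussDiagram X) :
    GaussDiagram Y where
  code := D.code
  code_nil z hz := D.code_nil z fun hX => hz (h.mem_of_mem hX)
  nodup := D.nodup
  disj := D.disj
  pair := D.pair

/-- Is the crossing of `p` not on the strand `l`? -/
def offStrand (l : List Pass) (p : Pass) : Bool := decide (∀ q ∈ l, q.1 ≠ p.1)

/-- Delete strand `a`, together with all crossings on it. -/
def del {a : L} {X Y : Finset L} (h : Extends a X Y) (D : GaussDiagram Y) :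
    GaussDiagram X where
  code := fun z => (D.code z).filter (offStrand (D.code a))
  code_nil z hz := by
    by_cases ha : z = a
    · subst ha
      rw [List.filter_eq_nil_iff]
      intro p hp
      simp only [offStrand, decide_eq_true_eq]
      exact fun hh => hh p hp rfl
    · rw [D.code_nil z fun hY => hz (h.mem_old hY ha)]
      rfl
  nodup z := (D.nodup z).sublist (List.filter_sublist.map _)
  disj x y p hp q hq := D.disj x y p (List.mem_of_mem_filter hp) q (List.mem_of_mem_filter hq)
  pair x p hp := by
    rw [List.mem_filter] at hp
    obtain ⟨y, hy⟩ := D.pair x p hp.1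
    exact ⟨y, List.mem_filter.2 ⟨hy, hp.2⟩⟩

/-- Put two diagrams side by side; the crossings are renamed to keep them apart. -/
def unionCode (d e : L → List Pass) : L → List Pass :=
  fun z => (d z).map (Pass.relabel fun n => 2 * n) ++
    (e z).map (Pass.relabel fun n => 2 * n + 1)

theorem double_injective : Function.Injective fun n : ℕ => 2 * n := by
  intro a b h; simpa using h

theorem double_succ_injective : Function.Injective fun n : ℕ => 2 * n + 1 := by
  intro a b h; simpa using h

def union {X Y Z : Finset L} (h : Splits X Y Z) (D : GaussDiagram X) (E : GaussDiagram Y) :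
    GaussDiagram Z where
  code := unionCode D.code E.code
  code_nil z hz := by
    have h1 : z ∉ X := fun hh => hz (h.mem_left hh)
    have h2 : z ∉ Y := fun hh => hz (h.mem_right hh)
    simp [unionCode, D.code_nil z h1, E.code_nil z h2]
  nodup z := by
    simp only [unionCode, List.map_append, List.map_map]
    rw [List.nodup_append]
    refine ⟨?_, ?_, ?_⟩
    · have := (D.nodup z).map (f := fun k : ℕ × Bool => (2 * k.1, k.2)) (by
        rintro ⟨a, b⟩ ⟨c, d⟩ hh
        simpa using hh)
      simpa [List.map_map, Function.comp_def, Pass.relabel] using this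
    · have := (E.nodup z).map (f := fun k : ℕ × Bool => (2 * k.1 + 1, k.2)) (by
        rintro ⟨a, b⟩ ⟨c, d⟩ hh
        simpa using hh)
      simpa [List.map_map, Function.comp_def, Pass.relabel] using this
    · rintro k hk k' hk' rfl
      simp only [List.mem_map, Function.comp, Pass.relabel] at hk hk'
      obtain ⟨p, -, rfl⟩ := hk
      obtain ⟨q, -, hpq⟩ := hk'
      simp only [Prod.mk.injEq] at hpq
      omega
  disj x y p hp q hq h1 h2 := by
    simp only [unionCode, List.mem_append, List.mem_map] at hp hq
    rcases hp with ⟨p, hp, rfl⟩ | ⟨p, hp, rfl⟩ <;> rcases hq with ⟨q, hq, rfl⟩ | ⟨q, hq, rfl⟩ <;>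
      simp only [Pass.relabel] at h1 h2
    · exact D.disj x y p hp q hq (by omega) h2
    · omega
    · omega
    · exact E.disj x y p hp q hq (by omega) h2
  pair x p hp := by
    simp only [unionCode, List.mem_append, List.mem_map] at hp
    rcases hp with ⟨p, hp, rfl⟩ | ⟨p, hp, rfl⟩
    · obtain ⟨y, hy⟩ := D.pair x p hp
      exact ⟨y, List.mem_append_left _ (List.mem_map.2 ⟨_, hy, rfl⟩)⟩
    · obtain ⟨y, hy⟩ := E.pair x p hp
      exact ⟨y, List.mem_append_right _ (List.mem_map.2 ⟨_, hy, rfl⟩)⟩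

/-! The operations respect the moves. -/

/-- An operation on codes that commutes with maps and filters and preserves adjacency turns
moves into moves. -/
theorem move_of_natural {X Y : Finset L} {F : (L → List Pass) → L → List Pass}
    (hmap : ∀ (f : Pass → Pass) d, F (fun x => (d x).map f) = fun x => (F d x).map f)
    (hfilter : ∀ (k : Pass → Bool) d, F (fun x => (d x).filter k) = fun x => (F d x).filter k)
    (op : GaussDiagram X → GaussDiagram Y) (hop : ∀ D, (op D).code = F D.code)
    (hadj : ∀ (D : GaussDiagram X) p q, Adjacent D.code p q → Adjacent (F D.code) p q)
    {D D' : GaussDiagram X} (h : GaussMove D D') : GaussMove (op D) (op D') := by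
  cases h with
  | relabel f hf h =>
    exact .relabel f hf (by rw [hop, hop, h, hmap])
  | r2 n m s h1 h2 h =>
    refine .r2 n m s ?_ ?_ ?_
    · rw [hop]; exact hadj _ _ _ h1
    · rw [hop]; exact h2.imp (hadj _ _ _) (hadj _ _ _)
    · rw [hop, hop, h]; exact hfilter _ _
  | r3 n₁ n₂ n₃ s₁ s₂ s₃ h₁₂ h₁₃ h₂₃ h1 h2 h3 h =>
    refine .r3 n₁ n₂ n₃ s₁ s₂ s₃ h₁₂ h₁₃ h₂₃ ?_ ?_ ?_ ?_
    · rw [hop]; exact hadj _ _ _ h1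
    · rw [hop]; exact h2.imp (hadj _ _ _) (hadj _ _ _)
    · rw [hop]; exact h3.imp (hadj _ _ _) (hadj _ _ _)
    · rw [hop, hop, h]
      unfold swapCode
      rw [hmap, hmap, hmap]
  | oc n m s s' h1 h =>
    refine .oc n m s s' ?_ ?_
    · rw [hop]; exact hadj _ _ _ h1
    · rw [hop, hop, h]; exact hmap _ _

theorem move_stitch {a b c : L} {X Y : Finset L} (h : Stitches a b c X Y)
    {D D' : GaussDiagram X} (hD : GaussMove D D') : GaussMove (stitch h D) (stitch h D') := by
  refine move_of_natural (F := stitchCode a b c) ?_ ?_ (stitch h) (fun _ => rfl) ?_ hD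
  · intro f d
    funext z
    unfold stitchCode
    split_ifs <;> simp
  · intro f d
    funext z
    unfold stitchCode
    split_ifs <;> simp
  · rintro D p q ⟨x, hx⟩
    by_cases h1 : x = a
    · subst h1
      exact ⟨c, by
        simp only [stitchCode, if_true]
        exact hx.trans (List.prefix_append _ _).isInfix⟩
    by_cases h2 : x = b
    · subst h2
      exact ⟨c, by
        simp only [stitchCode, if_true]
        exact hx.trans (List.suffix_append _ _).isInfix⟩
    have hX : x ∈ X := by
      by_contra hh
      rw [D.code_nil x hh] at hx
      simp at hx
    have h3 := (h.mem_rest hX h1 h2).2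
    exact ⟨x, by simpa [stitchCode, h1, h2, h3] using hx⟩

theorem move_rename {a b : L} {X Y : Finset L} (h : Relabels a b X Y)
    {D D' : GaussDiagram X} (hD : GaussMove D D') : GaussMove (rename h D) (rename h D') := by
  refine move_of_natural (F := renameCode a b) ?_ ?_ (rename h) (fun _ => rfl) ?_ hD
  · intro f d
    funext z
    unfold renameCode
    split_ifs <;> simp
  · intro f d
    funext z
    unfold renameCode
    split_ifs <;> simp
  · rintro D p q ⟨x, hx⟩
    by_cases h1 : x = a
    · subst h1
      exact ⟨b, by simpa [renameCode] using hx⟩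
    have hX : x ∈ X := by
      by_contra hh
      rw [D.code_nil x hh] at hx
      simp at hx
    have h3 := (h.mem_rest hX h1).2
    exact ⟨x, by simpa [renameCode, h1, h3] using hx⟩

theorem move_one {a : L} {X Y : Finset L} (h : Extends a X Y)
    {D D' : GaussDiagram X} (hD : GaussMove D D') : GaussMove (one h D) (one h D') :=
  move_of_natural (F := id) (fun _ _ => rfl) (fun _ _ => rfl) (one h) (fun _ => rfl)
    (fun _ _ _ h => h) hD

/-- Putting a diagram next to a fixed one turns moves into moves. -/
theorem move_of_side {X Z : Finset L} {F : (L → List Pass) → L → List Pass} {g : ℕ → ℕ}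
    (hg : Function.Injective g)
    (hmap : ∀ (f f' : Pass → Pass) d, (∀ p, f' (p.relabel g) = (f p).relabel g) →
      (∀ p : Pass, p.1 ∉ Set.range g → f' p = p) →
      F (fun x => (d x).map f) = fun x => (F d x).map f')
    (hfilter : ∀ (k k' : Pass → Bool) d, (∀ p, k' (p.relabel g) = k p) →
      (∀ p : Pass, p.1 ∉ Set.range g → k' p = true) →
      F (fun x => (d x).filter k) = fun x => (F d x).filter k')
    (op : GaussDiagram X → GaussDiagram Z) (hop : ∀ D, (op D).code = F D.code)
    (hadj : ∀ d p q, Adjacent d p q → Adjacent (F d) (p.relabel g) (q.relabel g))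
    {D D' : GaussDiagram X} (h : GaussMove D D') : GaussMove (op D) (op D') := by
  have hswap : ∀ p q d, F (swapCode p q d) = swapCode (p.relabel g) (q.relabel g) (F d) := by
    intro p q d
    refine hmap _ _ d ?_ ?_
    · intro r
      exact ((Pass.relabel_injective hg).map_swap p q r).symm
    · intro r hr
      refine Equiv.swap_apply_of_ne_of_ne ?_ ?_ <;> rintro rfl <;> exact hr ⟨_, rfl⟩
  cases h with
  | relabel f hf h =>
    classical
    refine .relabel (fun n => if hn : ∃ m, g m = n then g (f hn.choose) else n) ?_ ?_
    · intro n n' hnn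
      by_cases h1 : ∃ m, g m = n <;> by_cases h2 : ∃ m, g m = n'
      · simp only [dif_pos h1, dif_pos h2] at hnn
        rw [← h1.choose_spec, ← h2.choose_spec, hf (hg hnn)]
      · simp only [dif_pos h1, dif_neg h2] at hnn
        exact absurd ⟨_, hnn⟩ h2
      · simp only [dif_neg h1, dif_pos h2] at hnn
        exact absurd ⟨_, hnn.symm⟩ h1
      · simpa only [dif_neg h1, dif_neg h2] using hnn
    · rw [hop, hop, h]
      refine hmap _ _ _ ?_ ?_
      · intro p
        have hp : ∃ m, g m = g p.1 := ⟨_, rfl⟩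
        have := hg hp.choose_spec
        simp only [Pass.relabel, dif_pos hp, this]
      · intro p hp
        have hp' : ¬ ∃ m, g m = p.1 := hp
        simp only [Pass.relabel, dif_neg hp']
  | r2 n m s h1 h2 h =>
    refine .r2 (g n) (g m) s ?_ ?_ ?_
    · rw [hop]; exact hadj _ _ _ h1
    · rw [hop]; exact h2.imp (hadj _ _ _) (hadj _ _ _)
    · rw [hop, hop, h]
      refine hfilter _ _ _ ?_ ?_
      · intro p
        simp [Pass.relabel, hg.eq_iff]
      · intro p hp
        simp only [ne_eq, decide_eq_true_eq]
        constructor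
        · rintro hh; exact hp ⟨_, hh.symm⟩
        · rintro hh; exact hp ⟨_, hh.symm⟩
  | r3 n₁ n₂ n₃ s₁ s₂ s₃ h₁₂ h₁₃ h₂₃ h1 h2 h3 h =>
    refine .r3 (g n₁) (g n₂) (g n₃) s₁ s₂ s₃ (hg.ne h₁₂) (hg.ne h₁₃) (hg.ne h₂₃) ?_ ?_ ?_ ?_
    · rw [hop]; exact hadj _ _ _ h1
    · rw [hop]; exact h2.imp (hadj _ _ _) (hadj _ _ _)
    · rw [hop]; exact h3.imp (hadj _ _ _) (hadj _ _ _)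
    · rw [hop, hop, h, hswap, hswap, hswap]
      rfl
  | oc n m s s' h1 h =>
    refine .oc (g n) (g m) s s' ?_ ?_
    · rw [hop]; exact hadj _ _ _ h1
    · rw [hop, hop, h, hswap]
      rfl

theorem move_union_left {X Y Z : Finset L} (h : Splits X Y Z) (E : GaussDiagram Y)
    {D D' : GaussDiagram X} (hD : GaussMove D D') : GaussMove (union h D E) (union h D' E) := by
  have hodd : ∀ p : Pass,
      (p.relabel fun n => 2 * n + 1).1 ∉ Set.range fun n : ℕ => 2 * n := by
    rintro p ⟨n, hn⟩
    simp only [Pass.relabel] at hn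
    omega
  refine move_of_side (F := fun d => unionCode d E.code) double_injective ?_ ?_
    (fun D => union h D E) (fun _ => rfl) ?_ hD
  · intro f f' d h1 h2
    funext z
    simp only [unionCode, List.map_append, List.map_map]
    congr 1
    · exact List.map_congr_left fun p _ => (h1 p).symm
    · exact List.map_congr_left fun p _ => (h2 _ (hodd p)).symm
  · intro k k' d h1 h2
    funext z
    simp only [unionCode, List.filter_append, List.filter_map]
    congr 1
    · exact congrArg _ (List.filter_congr fun p _ => (h1 p).symm)
    · exact congrArg _ (List.filter_eq_self.2 fun p _ => h2 _ (hodd p)).symm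
  · rintro d p q ⟨x, hx⟩
    refine ⟨x, ?_⟩
    have := hx.map (Pass.relabel fun n => 2 * n)
    exact List.IsInfix.trans (by simpa using this) (List.prefix_append _ _).isInfix

theorem move_union_right {X Y Z : Finset L} (h : Splits X Y Z) (D : GaussDiagram X)
    {E E' : GaussDiagram Y} (hE : GaussMove E E') : GaussMove (union h D E) (union h D E') := by
  have heven : ∀ p : Pass,
      (p.relabel fun n => 2 * n).1 ∉ Set.range fun n : ℕ => 2 * n + 1 := by
    rintro p ⟨n, hn⟩
    simp only [Pass.relabel] at hn
    omega
  refine move_of_side (F := fun d => unionCode D.code d) double_succ_injective ?_ ?_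
    (fun E => union h D E) (fun _ => rfl) ?_ hE
  · intro f f' d h1 h2
    funext z
    simp only [unionCode, List.map_append, List.map_map]
    congr 1
    · exact List.map_congr_left fun p _ => (h2 _ (heven p)).symm
    · exact List.map_congr_left fun p _ => (h1 p).symm
  · intro k k' d h1 h2
    funext z
    simp only [unionCode, List.filter_append, List.filter_map]
    congr 1
    · exact congrArg _ (List.filter_eq_self.2 fun p _ => h2 _ (heven p)).symm
    · exact congrArg _ (List.filter_congr fun p _ => (h1 p).symm)
  · rintro d p q ⟨x, hx⟩
    refine ⟨x, ?_⟩
    have := hx.map (Pass.relabel fun n => 2 * n + 1)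
    exact List.IsInfix.trans (by simpa using this) (List.suffix_append _ _).isInfix

theorem offStrand_congr {l l' : List Pass} (h : ∀ p, p ∈ l ↔ p ∈ l') :
    offStrand l = offStrand l' := by
  funext p
  simp [offStrand, h]

theorem offStrand_eq_false {l : List Pass} {p q : Pass} (hq : q ∈ l) (h : q.1 = p.1) :
    offStrand l p = false := by
  simp only [offStrand, decide_eq_false_iff_not]
  exact fun hh => hh q hq h

theorem offStrand_iff {l : List Pass} {p q : Pass} (h : q.1 = p.1) :
    offStrand l p = offStrand l q := by
  simp [offStrand, h]

/-- If the crossing of `p` is on strand `a`, then so is that of a passage `q` which shares its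
strand with `p`, provided that `p` itself is on `a`. -/
theorem on_or {X : Finset L} (D : GaussDiagram X) (a : L) {n : ℕ} {s : ℤˣ} {p q : Pass}
    (hn : offStrand (D.code a) (overpass n s) = false)
    (h1 : ∃ x, overpass n s ∈ D.code x ∧ p ∈ D.code x)
    (h2 : ∃ x, underpass n s ∈ D.code x ∧ q ∈ D.code x) :
    p ∈ D.code a ∨ q ∈ D.code a := by
  simp only [offStrand, decide_eq_false_iff_not] at hn
  push Not at hn
  obtain ⟨r, hr, hrn⟩ := hn
  obtain ⟨x, hx, hpx⟩ := h1
  obtain ⟨y, hy, hqy⟩ := h2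
  rcases hb : r.2.1 with _ | _
  · right
    rwa [D.disj a y r hr _ hy hrn hb]
  · left
    rwa [D.disj a x r hr _ hx hrn hb]

theorem move_del {a : L} {X Y : Finset L} (h : Extends a X Y)
    {D D' : GaussDiagram Y} (hD : GaussMove D D') :
    del h D = del h D' ∨ GaussMove (del h D) (del h D') := by
  cases hD with
  | relabel f hf e =>
    right
    refine .relabel f hf ?_
    funext z
    simp only [del, e, List.filter_map]
    congr 1
    apply List.filter_congr
    intro p _
    simp only [offStrand, Function.comp, Pass.relabel, ne_eq, List.forall_mem_map, hf.eq_iff]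
  | r2 n m s h1 h2 e =>
    have h2' : ∃ x, underpass n s ∈ D.code x ∧ underpass m (-s) ∈ D.code x := by
      rcases h2 with h2 | h2
      · exact h2.mem
      · obtain ⟨x, hx⟩ := h2.mem
        exact ⟨x, hx.2, hx.1⟩
    have hnm : offStrand (D.code a) (overpass n s) = offStrand (D.code a) (overpass m (-s)) := by
      rw [Bool.eq_iff_iff, ← not_iff_not, Bool.not_eq_true, Bool.not_eq_true]
      constructor
      · intro hn
        rcases on_or D a hn h1.mem h2' with hh | hh
        · exact offStrand_eq_false hh rfl
        · exact offStrand_eq_false hh rfl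
      · intro hm
        obtain ⟨x, hx⟩ := h1.mem
        obtain ⟨y, hy⟩ := h2'
        rcases on_or D a hm ⟨x, hx.2, hx.1⟩ ⟨y, hy.2, hy.1⟩ with hh | hh
        · exact offStrand_eq_false hh rfl
        · exact offStrand_eq_false hh rfl
    have hcode : ∀ z, (del h D').code z =
        ((D.code z).filter fun p => decide (p.1 ≠ n ∧ p.1 ≠ m)).filter
          (offStrand (D.code a)) := by
      intro z
      simp only [del, e, eraseCode, List.filter_filter]
      apply List.filter_congr
      intro p _
      rw [Bool.eq_iff_iff]
      simp only [offStrand, Bool.and_eq_true, decide_eq_true_eq, List.mem_filter]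
      constructor
      · rintro ⟨h3, h4⟩
        refine ⟨fun q hq hqp => h3 q ⟨hq, ?_⟩ hqp, h4⟩
        rwa [hqp]
      · rintro ⟨h3, h4⟩
        exact ⟨fun q hq => h3 q hq.1, h4⟩
    by_cases hn : offStrand (D.code a) (overpass n s) = true
    · have hm := hnm ▸ hn
      have hn' : offStrand (D.code a) (underpass n s) = true :=
        (offStrand_iff rfl).trans hn
      have hm' : offStrand (D.code a) (underpass m (-s)) = true :=
        (offStrand_iff rfl).trans hm
      right
      refine .r2 n m s (h1.filter _ hn hm)
        (h2.imp (fun h2 => h2.filter _ hn' hm') (fun h2 => h2.filter _ hm' hn')) ?_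
      funext z
      rw [hcode]
      simp only [del, eraseCode, List.filter_filter]
      apply List.filter_congr
      intro p _
      exact Bool.and_comm _ _
    · left
      rw [Bool.not_eq_true] at hn
      have hm := hnm ▸ hn
      apply GaussDiagram.ext
      funext z
      rw [hcode]
      simp only [del, List.filter_filter]
      apply List.filter_congr
      intro p _
      rw [Bool.eq_iff_iff]
      simp only [Bool.and_eq_true, decide_eq_true_eq]
      refine ⟨fun hp => ⟨hp, ?_, ?_⟩, fun hp => hp.1⟩
      · intro hpn
        rw [offStrand_iff (q := overpass n s) hpn.symm, hn] at hp
        exact absurd hp (by simp)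
      · intro hpm
        rw [offStrand_iff (q := overpass m (-s)) hpm.symm, hm] at hp
        exact absurd hp (by simp)
  | oc n m s s' h1 e =>
    have hk : offStrand (D'.code a) = offStrand (D.code a) :=
      offStrand_congr fun p => by rw [e]; exact mem_swapCode_iff D.simple h1.mem a p
    by_cases hnm : offStrand (D.code a) (overpass n s) = true ∧
        offStrand (D.code a) (overpass m s') = true
    · right
      refine .oc n m s s' (h1.filter _ hnm.1 hnm.2) ?_
      change (fun z => (D'.code z).filter (offStrand (D'.code a))) = _
      rw [hk, e]
      exact filter_swap_of_visible _ hnm.1 hnm.2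
    · left
      apply GaussDiagram.ext
      change _ = (fun z => (D'.code z).filter (offStrand (D'.code a)))
      rw [hk, e]
      refine (filter_swap_of_hidden D.simple h1 _ ?_).symm
      simpa [Classical.or_iff_not_imp_left] using hnm
  | r3 n₁ n₂ n₃ s₁ s₂ s₃ h₁₂ h₁₃ h₂₃ h1 h2 h3 e =>
    have c1 := D.simple.swap (underpass n₂ s₂) (underpass n₃ s₃)
    have c2 := c1.swap (underpass n₁ s₁) (overpass n₃ s₃)
    have e2 : AdjacentSign (swapCode (underpass n₂ s₂) (underpass n₃ s₃) D.code) (s₂ * s₃)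
        (underpass n₁ s₁) (overpass n₃ s₃) := by
      refine h2.imp (fun hh => hh.swap_of_ne ?_ ?_ ?_ ?_) (fun hh => hh.swap_of_ne ?_ ?_ ?_ ?_)
        <;> simp [overpass, underpass, h₁₂, h₁₃]
    have e1 : Adjacent (swapCode (underpass n₁ s₁) (overpass n₃ s₃)
        (swapCode (underpass n₂ s₂) (underpass n₃ s₃) D.code)) (overpass n₁ s₁) (overpass n₂ s₂) := by
      refine (h1.swap_of_ne ?_ ?_ ?_ ?_).swap_of_ne ?_ ?_ ?_ ?_
        <;> simp [overpass, underpass, h₁₃, h₂₃]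
    have hk : offStrand (D'.code a) = offStrand (D.code a) :=
      offStrand_congr fun p => by
        rw [e]
        exact (mem_swapCode_iff c2 e1.mem a p).trans
          ((mem_swapCode_iff c1 e2.mem a p).trans (mem_swapCode_iff D.simple h3.mem a p))
    obtain ⟨x, hx1, hx2⟩ := h1.mem
    obtain ⟨y, hy1, hy3⟩ := h2.mem
    obtain ⟨z, hz2, hz3⟩ := h3.mem
    have u1 : offStrand (D.code a) (underpass n₁ s₁) = offStrand (D.code a) (overpass n₁ s₁) :=
      offStrand_iff rfl
    have u2 : offStrand (D.code a) (underpass n₂ s₂) = offStrand (D.code a) (overpass n₂ s₂) :=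
      offStrand_iff rfl
    have u3 : offStrand (D.code a) (underpass n₃ s₃) = offStrand (D.code a) (overpass n₃ s₃) :=
      offStrand_iff rfl
    by_cases hall : offStrand (D.code a) (overpass n₁ s₁) = true ∧
        offStrand (D.code a) (overpass n₂ s₂) = true ∧ offStrand (D.code a) (overpass n₃ s₃) = true
    · obtain ⟨k1, k2, k3⟩ := hall
      right
      refine .r3 n₁ n₂ n₃ s₁ s₂ s₃ h₁₂ h₁₃ h₂₃ (h1.filter _ k1 k2)
        (h2.imp (fun hh => hh.filter _ (u1.trans k1) k3) (fun hh => hh.filter _ k3 (u1.trans k1)))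
        (h3.imp (fun hh => hh.filter _ (u2.trans k2) (u3.trans k3))
          (fun hh => hh.filter _ (u3.trans k3) (u2.trans k2))) ?_
      change (fun z => (D'.code z).filter (offStrand (D'.code a))) = _
      rw [hk, e, filter_swap_of_visible _ k1 k2, filter_swap_of_visible _ (u1.trans k1) k3,
        filter_swap_of_visible _ (u2.trans k2) (u3.trans k3)]
      rfl
    · have two : (offStrand (D.code a) (overpass n₁ s₁) = false ∨
          offStrand (D.code a) (overpass n₂ s₂) = false) ∧
          (offStrand (D.code a) (overpass n₁ s₁) = false ∨
          offStrand (D.code a) (overpass n₃ s₃) = false) ∧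
          (offStrand (D.code a) (overpass n₂ s₂) = false ∨
          offStrand (D.code a) (overpass n₃ s₃) = false) := by
        have i1 : offStrand (D.code a) (overpass n₁ s₁) = false →
            offStrand (D.code a) (overpass n₂ s₂) = false ∨
            offStrand (D.code a) (overpass n₃ s₃) = false := by
          intro hh
          rcases on_or D a hh ⟨x, hx1, hx2⟩ ⟨y, hy1, hy3⟩ with hm | hm
          · exact Or.inl (offStrand_eq_false hm rfl)
          · exact Or.inr (offStrand_eq_false hm rfl)
        have i2 : offStrand (D.code a) (overpass n₂ s₂) = false →
            offStrand (D.code a) (overpass n₁ s₁) = false ∨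
            offStrand (D.code a) (overpass n₃ s₃) = false := by
          intro hh
          rcases on_or D a hh ⟨x, hx2, hx1⟩ ⟨z, hz2, hz3⟩ with hm | hm
          · exact Or.inl (offStrand_eq_false hm rfl)
          · exact Or.inr (offStrand_eq_false hm rfl)
        have i3 : offStrand (D.code a) (overpass n₃ s₃) = false →
            offStrand (D.code a) (overpass n₁ s₁) = false ∨
            offStrand (D.code a) (overpass n₂ s₂) = false := by
          intro hh
          rcases on_or D a hh ⟨y, hy3, hy1⟩ ⟨z, hz3, hz2⟩ with hm | hm
          · exact Or.inl (offStrand_eq_false hm rfl)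
          · exact Or.inr (offStrand_eq_false hm rfl)
        revert hall i1 i2 i3
        cases offStrand (D.code a) (overpass n₁ s₁) <;> cases offStrand (D.code a) (overpass n₂ s₂) <;>
          cases offStrand (D.code a) (overpass n₃ s₃) <;> simp
      left
      apply GaussDiagram.ext
      change _ = (fun z => (D'.code z).filter (offStrand (D'.code a)))
      rw [hk, e, filter_swap_of_hidden c2 e1 _ two.1,
        filter_swap_of_hidden' c1 e2 _ (by rw [u1]; exact two.2.1),
        filter_swap_of_hidden' D.simple h3 _ (by rw [u2, u3]; exact two.2.2)]
      rfl

/-- The crossing of sign `s` with overstrand `a` and understrand `b`. -/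
def crossing (a b : L) (hab : a ≠ b) (s : ℤˣ) : GaussDiagram ({a, b} : Finset L) where
  code z := if z = a then [overpass 0 s] else if z = b then [underpass 0 s] else []
  code_nil z hz := by
    simp only [Finset.mem_insert, Finset.mem_singleton, not_or] at hz
    simp [hz]
  nodup z := by split_ifs <;> simp
  disj x y p hp q hq _ h2 := by
    split_ifs at hp hq <;> simp_all [overpass, underpass]
  pair x p hp := by
    split_ifs at hp with h1 h2
    · exact ⟨b, by simp_all [overpass, underpass, Pass.other, hab.symm]⟩
    · exact ⟨a, by simp_all [overpass, underpass, Pass.other]⟩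
    · simp at hp

/-- Strands labeled by `X`, without crossings. -/
def trivial (X : Finset L) : GaussDiagram X where
  code _ := []
  code_nil _ _ := rfl
  nodup _ := by simp
  disj x y p hp := by simp at hp
  pair x p hp := by simp at hp

end GaussDiagram

namespace WTangle

/-- The crossing `R^s_{a,b}` with overstrand `a` and understrand `b`. -/
def crossing {L : Type*} [DecidableEq L] (a b : L) (hab : a ≠ b) (s : ℤˣ) :
    WTangle ({a, b} : Finset L) :=
  Quot.mk _ (GaussDiagram.crossing a b hab s)

/-- The w-tangle without crossings. -/
def trivial {L : Type*} [DecidableEq L] (X : Finset L) : WTangle X :=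
  Quot.mk _ (GaussDiagram.trivial X)

end WTangle

/-- The w-tangles, with the operations of a meta-monoid. -/
def wTangles (L : Type*) [DecidableEq L] : MetaMonoidOps L where
  carrier X := WTangle X
  stitch h := Quot.map (GaussDiagram.stitch h) fun _ _ => GaussDiagram.move_stitch h
  one h := Quot.map (GaussDiagram.one h) fun _ _ => GaussDiagram.move_one h
  del h := Quot.lift (fun D => Quot.mk _ (GaussDiagram.del h D)) fun _ _ hD =>
    (GaussDiagram.move_del h hD).elim (fun e => congrArg _ e) (fun hm => Quot.sound hm)
  union h := Quot.map₂ (GaussDiagram.union h)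
    (fun D _ _ => GaussDiagram.move_union_right h D)
    (fun _ _ E => GaussDiagram.move_union_left h E)
  rename h := Quot.map (GaussDiagram.rename h) fun _ _ => GaussDiagram.move_rename h

/-- `T` has scalar `1` and the matrix with rows `(1, 1 - t_a^s)` and `(0, t_a^s)`, where the
labels are ordered as `a, b`. -/
def Gamma.IsCrossing {L : Type*} [DecidableEq L] (a b : L) (s : ℤˣ)
    (T : Gamma ({a, b} : Finset L)) : Prop :=
  ∀ (ha : a ∈ ({a, b} : Finset L)) (hb : b ∈ ({a, b} : Finset L)),
    T.scalar = 1 ∧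
    T.mat ⟨a, ha⟩ ⟨a, ha⟩ = 1 ∧ T.mat ⟨a, ha⟩ ⟨b, hb⟩ = 1 - tvar ⟨a, ha⟩ ^ (s : ℤ) ∧
    T.mat ⟨b, hb⟩ ⟨a, ha⟩ = 0 ∧ T.mat ⟨b, hb⟩ ⟨b, hb⟩ = tvar ⟨a, ha⟩ ^ (s : ℤ)

/-- `φ` sends every crossing `R^s_{a,b}` to the matrix of the crossing, with scalar `1`. -/
def SendsCrossings {L : Type*} [DecidableEq L]
    (φ : MetaMonoidHom (wTangles L) (gammaCalculus L)) : Prop :=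
  ∀ (a b : L) (hab : a ≠ b) (s : ℤˣ),
    Gamma.IsCrossing a b s (φ.toFun {a, b} (WTangle.crossing a b hab s))

/-- The strand `c` with a single kink, made from a crossing of sign `s` by stitching the head of
its understrand `b` to the tail of its overstrand `a`. -/
def WTangle.kink {L : Type*} [DecidableEq L] {a b c : L} (hab : a ≠ b) (s : ℤˣ)
    (h : Stitches b a c ({a, b} : Finset L) {c}) : WTangle ({c} : Finset L) :=
  (wTangles L).stitch h (WTangle.crossing a b hab s)

/-- `T` has scalar `t_c^s` and matrix part `1`. -/
def Gamma.IsKink {L : Type*} [DecidableEq L] (c : L) (s : ℤˣ)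
    (T : Gamma ({c} : Finset L)) : Prop :=
  ∀ hc : c ∈ ({c} : Finset L), T.scalar = tvar ⟨c, hc⟩ ^ (s : ℤ) ∧ T.mat = 1

/-! ### Substitutions -/

/-! The homomorphism is a multivariable Burau–Alexander invariant. The underpasses cut each strand
of a diagram into arcs; an overpass does not end an arc. Color the arcs by elements of a field so
that, at a crossing of sign `s` whose overstrand carries the variable `t`, the colors of the lower
strand before and after it satisfy `after = (1 - t^s) * over + t^s * before`. The colors at the
tails of the strands are given, those of the arcs that start at crossings are the unknowns, and
there is one equation for each crossing. The scalar of the invariant is the determinant of this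
square system; the entry `(i, j)` of its matrix is the color at the head of `j` when the tail of `i`
has color `1` and all other tails have color `0`. At `t = 1` colors are constant along strands.
Hence the determinant does not vanish there (`det_one_ne_zero`), the matrix becomes the identity
(`color_one`), and everything is regular at that point.

The stitching formula of `Γ` is the elimination of one unknown: the color `k` at the tail of `b`
must equal that at the head of `a`, so `k = M i a + k * M b a`, and `M i j` becomes `M i j + M i a *
M b j / (1 - M b a)` (`exists_isColoring_stitch`). On the linear system this is a change of rank
one, which multiplies the determinant by `1 - M b a` (`det_stitch`). Disjoint unions give block
matrices. Eliminations commute (`feedback_comm`), which proves associativity in `Γ`. The law `(*)`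
holds on `Γ_0` since, once `t_b = 1`, the row of `b` vanishes off the diagonal and the correction
term disappears.

Invariance under the moves is reduced to small diagrams. Every diagram is recovered by stitching
from a diagram in which a strand has been cut (`stitch_split`). Cutting around a move isolates two
or three short pieces, which then split off as a disjoint union, so it suffices to compare diagrams
made of these pieces only (`gamma_eq_of_local`, `gamma_eq_of_local_two`). There the determinants are
`1` and the colors at the heads are compared by hand.

Cutting also shows that w-tangles are generated by crossings under stitching and union, apart from
the diagrams without crossings (`WTangle.induction`). This gives the uniqueness of the homomorphism,
the row condition for its values, and its compatibility with deletions: the last passes from the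
generators to all w-tangles by means of `(*)`, which is available because the values lie in `Γ_0`.
Renaming is covered by the unit law, being the addition of a trivial strand followed by a stitching.
-/

namespace SubstTo

variable {σ K : Type*} [Field K] [Algebra ℚ K] {v : σ → K}

theorem sum {ι : Type*} (s : Finset ι) {f : ι → FractionRing (MvPolynomial σ ℚ)} {g : ι → K}
    (h : ∀ i ∈ s, SubstTo v (f i) (g i)) : SubstTo v (∑ i ∈ s, f i) (∑ i ∈ s, g i) := by
  classical
  induction s using Finset.induction_on with
  | empty => simpa using zero
  | insert a s ha ih =>
    rw [Finset.sum_insert ha, Finset.sum_insert ha]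
    exact (h a (by simp)).add (ih fun i hi => h i (by simp [hi]))

theorem prod {ι : Type*} (s : Finset ι) {f : ι → FractionRing (MvPolynomial σ ℚ)} {g : ι → K}
    (h : ∀ i ∈ s, SubstTo v (f i) (g i)) : SubstTo v (∏ i ∈ s, f i) (∏ i ∈ s, g i) := by
  classical
  induction s using Finset.induction_on with
  | empty => simpa using one
  | insert a s ha ih =>
    rw [Finset.prod_insert ha, Finset.prod_insert ha]
    exact (h a (by simp)).mul (ih fun i hi => h i (by simp [hi]))

theorem ofInt (n : ℤ) : SubstTo v (n : FractionRing (MvPolynomial σ ℚ)) (n : K) := by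
  simpa using poly (v := v) (n : MvPolynomial σ ℚ)

theorem det {n : Type*} [Fintype n] [DecidableEq n]
    {A : Matrix n n (FractionRing (MvPolynomial σ ℚ))} {B : Matrix n n K}
    (h : ∀ i j, SubstTo v (A i j) (B i j)) : SubstTo v A.det B.det := by
  rw [Matrix.det_apply', Matrix.det_apply']
  exact sum _ fun τ _ => (ofInt _).mul (prod _ fun i _ => h _ _)

theorem zpow_units {r : FractionRing (MvPolynomial σ ℚ)} {c : K} (h : SubstTo v r c)
    (hc : c ≠ 0) (s : ℤˣ) : SubstTo v (r ^ (s : ℤ)) (c ^ (s : ℤ)) := by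
  rcases Int.units_eq_one_or s with rfl | rfl
  · simpa using h
  · simpa using h.inv hc

/-- Makes evaluation at the variables themselves the identity, so that statements about arbitrary
substitutions specialize to statements about the elements of `Γ`. -/
theorem self (r : FractionRing (MvPolynomial σ ℚ)) :
    SubstTo (fun i => algebraMap (MvPolynomial σ ℚ) (FractionRing (MvPolynomial σ ℚ))
      (MvPolynomial.X i)) r r := by
  have key : ∀ p : MvPolynomial σ ℚ, MvPolynomial.aeval
      (fun i => algebraMap (MvPolynomial σ ℚ) (FractionRing (MvPolynomial σ ℚ)) (MvPolynomial.X i)) p =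
      algebraMap _ (FractionRing (MvPolynomial σ ℚ)) p := by
    intro p
    induction p using MvPolynomial.induction_on with
    | C a =>
      rw [MvPolynomial.aeval_C, IsScalarTower.algebraMap_apply ℚ (MvPolynomial σ ℚ)
        (FractionRing (MvPolynomial σ ℚ))]
      rfl
    | add p q hp hq => simp [hp, hq]
    | mul_X p i hp => simp [hp]
  obtain ⟨p, q, hq, rfl⟩ := IsFractionRing.div_surjective (A := MvPolynomial σ ℚ) r
  refine ⟨p, q, ?_, rfl, by rw [key, key]⟩
  rw [key]
  exact IsFractionRing.to_map_ne_zero_of_mem_nonZeroDivisors hq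

/-- Substitutions compose. -/
theorem trans {τ : Type*} {u : τ → FractionRing (MvPolynomial σ ℚ)} {u' : τ → K}
    (hu : ∀ i, SubstTo v (u i) (u' i)) {r : FractionRing (MvPolynomial τ ℚ)}
    {s : FractionRing (MvPolynomial σ ℚ)} (h : SubstTo u r s) {c : K} (h' : SubstTo v s c)
    {d : K} (hd : SubstTo u' r d) : c = d := by
  have key : ∀ p : MvPolynomial τ ℚ, SubstTo v (MvPolynomial.aeval u p)
      (MvPolynomial.aeval u' p) := by
    intro p
    induction p using MvPolynomial.induction_on with
    | C a =>
      have := SubstTo.poly (v := v) (MvPolynomial.C a)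
      rw [MvPolynomial.aeval_C, MvPolynomial.aeval_C]
      rw [MvPolynomial.aeval_C] at this
      rwa [IsScalarTower.algebraMap_apply ℚ (MvPolynomial σ ℚ)
        (FractionRing (MvPolynomial σ ℚ))]
    | add p q hp hq => simpa using hp.add hq
    | mul_X p i hp => simpa using hp.mul (hu i)
  obtain ⟨p, q, hq, hr, rfl⟩ := hd
  -- The denominator that works for the composite `u'` also works for `u`: if it vanished under `u`,
  -- then its further image under `v` would vanish too.
  have hq0 : MvPolynomial.aeval u q ≠ 0 := by
    intro h0
    have := key q
    rw [h0] at this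
    exact hq (this.unique SubstTo.zero)
  have hs : SubstTo u r (MvPolynomial.aeval u p / MvPolynomial.aeval u q) := ⟨p, q, hq0, hr, rfl⟩
  rw [h.unique hs] at h'
  exact h'.unique ((key p).div (key q) hq)

end SubstTo

/-- All substitutions in use send the point `t = 1` to itself. A function regular at that point has
a denominator that is nonzero there, and such a denominator survives the substitution; no other
condition on denominators ever arises. -/
theorem substRat_spec {L : Type*} {X Z : Finset L} {v : X → RatField Z}
    (hv : ∀ i, ValueAtOne (v i) 1) {r : RatField X} {c : ℚ} (h : ValueAtOne r c) :
    SubstTo v r (substRat v r) := (SubstTo.comp_one hv h).1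

theorem substRat_substRat {L : Type*} {X Y Z : Finset L} {v : X → RatField Y}
    {w : Y → RatField Z} (hv : ∀ i, ValueAtOne (v i) 1) (hw : ∀ i, ValueAtOne (w i) 1)
    {r : RatField X} {c : ℚ} (h : ValueAtOne r c) :
    substRat w (substRat v r) = substRat (fun i => substRat w (v i)) r := by
  refine SubstTo.trans (v := w) (u := v) (fun i => substRat_spec hw (hv i)) (substRat_spec hv h)
    (substRat_spec hw (h.subst hv)) (substRat_spec (fun i => (hv i).subst hw) h)

theorem substRat_tvar {L : Type*} {X : Finset L} {K : Type*} [Field K] [Algebra ℚ K]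
    (v : X → K) (i : X) : substRat v (tvar i) = v i := by
  have := SubstTo.poly (v := v) (MvPolynomial.X i)
  rw [MvPolynomial.aeval_X] at this
  exact this.substRat_eq

theorem substRat_one {σ K : Type*} [Field K] [Algebra ℚ K] (v : σ → K) : substRat v 1 = 1 :=
  SubstTo.one.substRat_eq

theorem substRat_tvar_self {L : Type*} {X : Finset L} (r : RatField X) :
    substRat (fun i : X => tvar i) r = r :=
  (SubstTo.self r).substRat_eq

theorem ValueAtOne.ne_zero {L : Type*} {X : Finset L} {r : RatField X} {c : ℚ}
    (h : ValueAtOne r c) (hc : c ≠ 0) : r ≠ 0 := by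
  rintro rfl
  exact hc (h.unique SubstTo.zero)

/-! ### Evaluation of the elements of `Γ` -/

/-- All the `w l` have the value `1` when all variables are set to `1`. -/
def UnitalAtOne {L : Type*} {Z : Finset L} (w : L → RatField Z) : Prop :=
  ∀ l, ValueAtOne (w l) 1

theorem UnitalAtOne.comp {L : Type*} {Z : Finset L} {w : L → RatField Z} (hw : UnitalAtOne w)
    (f : L → L) : UnitalAtOne (w ∘ f) := fun _ => hw _

theorem UnitalAtOne.ne_zero {L : Type*} {Z : Finset L} {w : L → RatField Z} (hw : UnitalAtOne w)
    (l : L) : w l ≠ 0 := (hw l).ne_zero one_ne_zero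

theorem UnitalAtOne.update {L : Type*} [DecidableEq L] {Z : Finset L} {w : L → RatField Z}
    (hw : UnitalAtOne w) (a : L) : UnitalAtOne (Function.update w a 1) := by
  intro l
  by_cases h : l = a
  · subst h; rw [Function.update_self]; exact SubstTo.one
  · simpa [h] using hw l

/-- The variable `t_l`, or `1` if there is no such variable in `R_X`. -/
noncomputable def weight {L : Type*} [DecidableEq L] (X : Finset L) (l : L) : RatField X :=
  if h : l ∈ X then tvar ⟨l, h⟩ else 1

theorem weight_coe {L : Type*} [DecidableEq L] {X : Finset L} (i : X) :
    weight X i = tvar i := by simp [weight]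

theorem unitalAtOne_weight {L : Type*} [DecidableEq L] (X : Finset L) :
    UnitalAtOne (weight X) := by
  intro l
  unfold weight
  split_ifs
  · exact valueAtOne_tvar _
  · exact SubstTo.one

namespace Gamma

variable {L : Type*} [DecidableEq L] {X Y Z : Finset L}

/-- The scalar of `T` after the substitution `t_i → w i`. -/
noncomputable def scalarAt (T : Gamma X) (w : L → RatField Z) : RatField Z :=
  substRat (fun k : X => w k) T.scalar

/-- The entry of the matrix of `T` after the substitution `t_i → w i`. -/
noncomputable def matAt (T : Gamma X) (w : L → RatField Z) (i j : L) : RatField Z :=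
  if h : i ∈ X ∧ j ∈ X then substRat (fun k : X => w k) (T.mat ⟨i, h.1⟩ ⟨j, h.2⟩) else 0

theorem matAt_of_mem (T : Gamma X) (w : L → RatField Z) {i j : L} (hi : i ∈ X) (hj : j ∈ X) :
    T.matAt w i j = substRat (fun k : X => w k) (T.mat ⟨i, hi⟩ ⟨j, hj⟩) :=
  dif_pos ⟨hi, hj⟩

theorem substTo_scalar (T : Gamma X) {w : L → RatField Z} (hw : UnitalAtOne w) :
    SubstTo (fun k : X => w k) T.scalar (T.scalarAt w) := by
  obtain ⟨c, hc⟩ := T.scalar_regular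
  unfold scalarAt
  exact substRat_spec (v := fun k : X => w k) (fun i => hw i) hc

theorem substTo_mat (T : Gamma X) {w : L → RatField Z} (hw : UnitalAtOne w) {i j : L}
    (hi : i ∈ X) (hj : j ∈ X) :
    SubstTo (fun k : X => w k) (T.mat ⟨i, hi⟩ ⟨j, hj⟩) (T.matAt w i j) := by
  rw [matAt_of_mem T w hi hj]
  exact substRat_spec (v := fun k : X => w k) (fun i => hw i) (T.mat_one _ _)

theorem valueAtOne_matAt (T : Gamma X) {w : L → RatField Z} (hw : UnitalAtOne w) {i j : L}
    (hi : i ∈ X) (hj : j ∈ X) : ValueAtOne (T.matAt w i j) (if i = j then 1 else 0) := by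
  rw [matAt_of_mem T w hi hj]
  have := (T.mat_one ⟨i, hi⟩ ⟨j, hj⟩).subst (v := fun k : X => w k) (fun k => hw k)
  simpa only [Subtype.mk.injEq] using this

theorem one_sub_matAt_ne_zero (T : Gamma X) {w : L → RatField Z} (hw : UnitalAtOne w) {i j : L}
    (hi : i ∈ X) (hj : j ∈ X) (hij : i ≠ j) : 1 - T.matAt w i j ≠ 0 := by
  have := SubstTo.one.sub (T.valueAtOne_matAt hw hi hj)
  rw [if_neg hij, sub_zero] at this
  exact ValueAtOne.ne_zero this one_ne_zero

theorem scalarAt_congr (T : Gamma X) {w w' : L → RatField Z} (h : ∀ l ∈ X, w l = w' l) :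
    T.scalarAt w = T.scalarAt w' := by
  unfold scalarAt
  congr 1
  funext k
  exact h k k.2

theorem matAt_congr (T : Gamma X) {w w' : L → RatField Z} (h : ∀ l ∈ X, w l = w' l) (i j : L) :
    T.matAt w i j = T.matAt w' i j := by
  have : (fun k : X => w k) = fun k : X => w' k := funext fun k => h k k.2
  unfold matAt
  rw [this]

theorem scalarAt_weight (T : Gamma X) : T.scalarAt (weight X) = T.scalar := by
  unfold scalarAt
  simp only [weight_coe]
  exact substRat_tvar_self _

theorem matAt_weight (T : Gamma X) (i j : X) : T.matAt (weight X) i j = T.mat i j := by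
  rw [matAt_of_mem T _ i.2 j.2]
  simp only [weight_coe]
  exact substRat_tvar_self _

/-- The substitution `weight X` changes nothing, so equality after all unital substitutions is
equality. The laws of `Γ` are checked in this form: labels range over `L` instead of subtypes, and
each operation acts on the variables by a change of `w`. -/
theorem ext_at {T U : Gamma X}
    (hs : ∀ w : L → RatField X, UnitalAtOne w → T.scalarAt w = U.scalarAt w)
    (hm : ∀ w : L → RatField X, UnitalAtOne w → ∀ i ∈ X, ∀ j ∈ X, T.matAt w i j = U.matAt w i j) :
    T = U := by
  apply Gamma.ext
  · rw [← scalarAt_weight, ← scalarAt_weight]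
    exact hs _ (unitalAtOne_weight X)
  · ext i j
    rw [← matAt_weight, ← matAt_weight]
    exact hm _ (unitalAtOne_weight X) i i.2 j j.2

/-- Join the output `p` to the input `q`. -/
def feedback {L K : Type*} [Field K] (p q : L) (M : L → L → K) (i j : L) : K :=
  M i j + M i p * M q j / (1 - M q p)

/-- Either order of elimination solves the same 2 × 2 system for the two joined wires. Its
determinant `(1 - M q' p') * (1 - M q p) - M q' p * M q p'` is symmetric in the two wires; the
hypotheses on the second pivots say that it does not vanish. -/
theorem feedback_comm {L K : Type*} [Field K] (M : L → L → K) {p q p' q' : L}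
    (h : 1 - M q p ≠ 0) (h' : 1 - M q' p' ≠ 0) (h1 : 1 - feedback p q M q' p' ≠ 0)
    (h2 : 1 - feedback p' q' M q p ≠ 0) (i j : L) :
    feedback p' q' (feedback p q M) i j = feedback p q (feedback p' q' M) i j := by
  unfold feedback at *
  have e1 : 1 - (M q' p' + M q' p * M q p' / (1 - M q p)) =
      ((1 - M q' p') * (1 - M q p) - M q' p * M q p') / (1 - M q p) := by
    field_simp; ring
  have e2 : 1 - (M q p + M q p' * M q' p / (1 - M q' p')) =
      ((1 - M q' p') * (1 - M q p) - M q' p * M q p') / (1 - M q' p') := by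
    field_simp; ring
  rw [e1] at h1
  rw [e2] at h2
  have hD : (1 - M q' p') * (1 - M q p) - M q' p * M q p' ≠ 0 := (div_ne_zero_iff.1 h1).1
  rw [e1, e2]
  generalize hd : (1 - M q' p') * (1 - M q p) - M q' p * M q p' = d at *
  field_simp
  subst hd
  ring

/-- Both sides are the determinant of the 2 × 2 system of the two joined wires, written as a product
of successive pivots. -/
theorem feedback_scalar_comm {L K : Type*} [Field K] (M : L → L → K) {p q p' q' : L}
    (h : 1 - M q p ≠ 0) (h' : 1 - M q' p' ≠ 0) :
    (1 - feedback p q M q' p') * (1 - M q p) = (1 - feedback p' q' M q p) * (1 - M q' p') := by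
  unfold feedback
  field_simp
  ring

/-- The old row from which the row `i` of a stitched matrix comes. -/
def oldRow (a c i : L) : L := if i = c then a else i

/-- The substitution `t_a, t_b → t_c` that belongs to stitching is absorbed into `w`: it becomes
composition with the map of labels `newStrand a b c`. -/
theorem scalarAt_stitch {a b c : L} (h : Stitches a b c X Y) (T : Gamma X) {w : L → RatField Z}
    (hw : UnitalAtOne w) : (stitch h T).scalarAt w =
      (1 - T.matAt (w ∘ GaussDiagram.newStrand a b c) b a) *
        T.scalarAt (w ∘ GaussDiagram.newStrand a b c) := by
  obtain ⟨r, hr⟩ := T.scalar_regular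
  have hv : (fun i : X => substRat (fun k : Y => w k) (tvar (h.label i))) =
      fun i : X => (w ∘ GaussDiagram.newStrand a b c) i := by
    funext i
    rw [substRat_tvar]
    simp only [Stitches.label, GaussDiagram.newStrand, Function.comp]
    split_ifs <;> rfl
  unfold scalarAt
  change substRat _ (substRat _ _) = _
  rw [substRat_substRat (fun i => valueAtOne_tvar _) (fun i => hw i)
    ((SubstTo.one.sub (T.mat_one _ _)).mul hr), hv]
  exact ((SubstTo.one.sub (T.substTo_mat (hw.comp _) h.mem_right h.mem_left)).mul
    (T.substTo_scalar (hw.comp _))).substRat_eq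

theorem matAt_stitch {a b c : L} (h : Stitches a b c X Y) (T : Gamma X) {w : L → RatField Z}
    (hw : UnitalAtOne w) {i j : L} (hi : i ∈ Y) (hj : j ∈ Y) : (stitch h T).matAt w i j =
      feedback a b (T.matAt (w ∘ GaussDiagram.newStrand a b c)) (oldRow a c i) (oldRow b c j) := by
  have hw' := hw.comp (GaussDiagram.newStrand a b c)
  have hv : (fun i : X => substRat (fun k : Y => w k) (tvar (h.label i))) =
      fun i : X => (w ∘ GaussDiagram.newStrand a b c) i := by
    funext i
    rw [substRat_tvar]
    simp only [Stitches.label, GaussDiagram.newStrand, Function.comp]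
    split_ifs <;> rfl
  have hrow : (h.row ⟨i, hi⟩ : L) = oldRow a c i := by
    unfold Stitches.row oldRow; split_ifs <;> rfl
  have hcol : (h.col ⟨j, hj⟩ : L) = oldRow b c j := by
    unfold Stitches.col oldRow; split_ifs <;> rfl
  have hne := T.one_sub_matAt_ne_zero hw' h.mem_right h.mem_left h.ne.symm
  have hg : ValueAtOne (1 - T.mat ⟨b, h.mem_right⟩ ⟨a, h.mem_left⟩) 1 := by
    have := SubstTo.one.sub (T.mat_one ⟨b, h.mem_right⟩ ⟨a, h.mem_left⟩)
    rwa [if_neg (fun e => h.ne (congrArg Subtype.val e).symm), sub_zero] at this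
  rw [matAt_of_mem _ _ hi hj]
  change substRat _ (substRat _ _) = _
  rw [substRat_substRat (fun i => valueAtOne_tvar _) (fun i => hw i)
    ((T.mat_one _ _).add (((T.mat_one _ _).mul (T.mat_one _ _)).div hg one_ne_zero)), hv]
  rw [← hrow, ← hcol]
  exact ((T.substTo_mat hw' (h.row ⟨i, hi⟩).2 (h.col ⟨j, hj⟩).2).add
    (((T.substTo_mat hw' (h.row ⟨i, hi⟩).2 h.mem_left).mul
    (T.substTo_mat hw' h.mem_right (h.col ⟨j, hj⟩).2)).div
    (SubstTo.one.sub (T.substTo_mat hw' h.mem_right h.mem_left)) hne)).substRat_eq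

theorem scalarAt_one {a : L} (h : Extends a X Y) (T : Gamma X) {w : L → RatField Z}
    (hw : UnitalAtOne w) : (one h T).scalarAt w = T.scalarAt w := by
  obtain ⟨r, hr⟩ := T.scalar_regular
  unfold scalarAt
  change substRat _ (substRat _ _) = _
  rw [substRat_substRat (fun i => valueAtOne_tvar _) (fun i => hw i) hr]
  simp only [substRat_tvar]

theorem matAt_one {a : L} (h : Extends a X Y) (T : Gamma X) {w : L → RatField Z}
    (hw : UnitalAtOne w) {i j : L} (hi : i ∈ Y) (hj : j ∈ Y) : (one h T).matAt w i j =
      if i ≠ a ∧ j ≠ a then T.matAt w i j else if i = j then 1 else 0 := by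
  rw [matAt_of_mem _ _ hi hj]
  by_cases hij : i ≠ a ∧ j ≠ a
  · rw [if_pos hij, matAt_of_mem _ _ (h.mem_old hi hij.1) (h.mem_old hj hij.2)]
    have : (one h T).mat ⟨i, hi⟩ ⟨j, hj⟩ = substRat (fun i : X => tvar (⟨i.1, h.mem_of_mem i.2⟩ : Y))
        (T.mat ⟨i, h.mem_old hi hij.1⟩ ⟨j, h.mem_old hj hij.2⟩) := dif_pos hij
    rw [this, substRat_substRat (fun i => valueAtOne_tvar _) (fun i => hw i) (T.mat_one _ _)]
    simp only [substRat_tvar]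
  · rw [if_neg hij]
    have : (one h T).mat ⟨i, hi⟩ ⟨j, hj⟩ = if (⟨i, hi⟩ : Y) = ⟨j, hj⟩ then 1 else 0 := dif_neg hij
    rw [this]
    simp only [Subtype.mk.injEq]
    split_ifs
    · exact SubstTo.one.substRat_eq
    · exact SubstTo.zero.substRat_eq

theorem scalarAt_del {a : L} (h : Extends a X Y) (T : Gamma Y) {w : L → RatField Z}
    (hw : UnitalAtOne w) : (del h T).scalarAt w = T.scalarAt (Function.update w a 1) := by
  obtain ⟨r, hr⟩ := T.scalar_regular
  unfold scalarAt
  change substRat _ (substRat _ _) = _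
  rw [substRat_substRat h.valueAtOne_subst (fun i => hw i) hr]
  congr 1
  funext i
  by_cases hi : i.1 = a
  · rw [Extends.subst, dif_pos hi, hi, Function.update_self, substRat_one]
  · rw [Extends.subst, dif_neg hi, Function.update_of_ne hi, substRat_tvar]

theorem matAt_del {a : L} (h : Extends a X Y) (T : Gamma Y) {w : L → RatField Z}
    (hw : UnitalAtOne w) {i j : L} (hi : i ∈ X) (hj : j ∈ X) :
    (del h T).matAt w i j = T.matAt (Function.update w a 1) i j := by
  rw [matAt_of_mem _ _ hi hj, matAt_of_mem _ _ (h.mem_of_mem hi) (h.mem_of_mem hj)]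
  change substRat _ (substRat _ _) = _
  rw [substRat_substRat h.valueAtOne_subst (fun i => hw i) (T.mat_one _ _)]
  congr 1
  funext i
  by_cases hi : i.1 = a
  · rw [Extends.subst, dif_pos hi, hi, Function.update_self, substRat_one]
  · rw [Extends.subst, dif_neg hi, Function.update_of_ne hi, substRat_tvar]

theorem scalarAt_union {V : Finset L} (h : Splits X Y V) (T : Gamma X) (U : Gamma Y)
    {w : L → RatField Z} (hw : UnitalAtOne w) :
    (union h T U).scalarAt w = T.scalarAt w * U.scalarAt w := by
  obtain ⟨r, hr⟩ := T.scalar_regular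
  obtain ⟨s, hs⟩ := U.scalar_regular
  have h1 : substRat (fun k : V => w k)
      (substRat (fun i : X => tvar (⟨i.1, h.mem_left i.2⟩ : V)) T.scalar) = T.scalarAt w := by
    rw [substRat_substRat (fun i => valueAtOne_tvar _) (fun i => hw i) hr]
    simp only [substRat_tvar, scalarAt]
  have h2 : substRat (fun k : V => w k)
      (substRat (fun i : Y => tvar (⟨i.1, h.mem_right i.2⟩ : V)) U.scalar) = U.scalarAt w := by
    rw [substRat_substRat (fun i => valueAtOne_tvar _) (fun i => hw i) hs]
    simp only [substRat_tvar, scalarAt]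
  rw [← h1, ← h2]
  exact ((substRat_spec (v := fun k : V => w k) (fun i => hw i) (hr.subst fun i => valueAtOne_tvar _)).mul
    (substRat_spec (v := fun k : V => w k) (fun i => hw i) (hs.subst fun i => valueAtOne_tvar _))).substRat_eq

/-- Entries outside the label set count as `0` in `matAt`, so a block-diagonal matrix is the sum of
its blocks. Commutativity and associativity of unions thereby become those of addition. -/
theorem matAt_union {V : Finset L} (h : Splits X Y V) (T : Gamma X) (U : Gamma Y)
    {w : L → RatField Z} (hw : UnitalAtOne w) (i j : L) :
    (union h T U).matAt w i j = T.matAt w i j + U.matAt w i j := by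
  have hd : ∀ l, l ∈ X → l ∉ Y := fun l hl => Finset.disjoint_left.1 h.1 hl
  by_cases hij : i ∈ V ∧ j ∈ V
  · rw [matAt_of_mem _ _ hij.1 hij.2]
    by_cases hX : i ∈ X ∧ j ∈ X
    · have e : (union h T U).mat ⟨i, hij.1⟩ ⟨j, hij.2⟩ =
        substRat (fun i : X => tvar (⟨i.1, h.mem_left i.2⟩ : V)) (T.mat ⟨i, hX.1⟩ ⟨j, hX.2⟩) :=
        dif_pos hX
      have e' : U.matAt w i j = 0 := dif_neg fun hh => hd i hX.1 hh.1
      rw [e, e', matAt_of_mem _ _ hX.1 hX.2, add_zero,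
        substRat_substRat (fun i => valueAtOne_tvar _) (fun i => hw i) (T.mat_one _ _)]
      simp only [substRat_tvar]
    · have e' : T.matAt w i j = 0 := dif_neg hX
      by_cases hY : i ∈ Y ∧ j ∈ Y
      · have e : (union h T U).mat ⟨i, hij.1⟩ ⟨j, hij.2⟩ =
          substRat (fun i : Y => tvar (⟨i.1, h.mem_right i.2⟩ : V)) (U.mat ⟨i, hY.1⟩ ⟨j, hY.2⟩) :=
          (dif_neg hX).trans (dif_pos hY)
        rw [e, e', matAt_of_mem _ _ hY.1 hY.2, zero_add,
          substRat_substRat (fun i => valueAtOne_tvar _) (fun i => hw i) (U.mat_one _ _)]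
        simp only [substRat_tvar]
      · have e : (union h T U).mat ⟨i, hij.1⟩ ⟨j, hij.2⟩ = 0 := (dif_neg hX).trans (dif_neg hY)
        have e2 : U.matAt w i j = 0 := dif_neg hY
        rw [e, e', e2, add_zero]
        exact SubstTo.zero.substRat_eq
  · have e1 : T.matAt w i j = 0 := dif_neg fun hh => hij ⟨h.mem_left hh.1, h.mem_left hh.2⟩
    have e2 : U.matAt w i j = 0 := dif_neg fun hh => hij ⟨h.mem_right hh.1, h.mem_right hh.2⟩
    rw [e1, e2, add_zero]
    exact dif_neg hij

/-- The label of strand `l` after `a` is renamed to `b`. -/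
def renamed (a b l : L) : L := if l = a then b else l

theorem scalarAt_rename {a b : L} (h : Relabels a b X Y) (T : Gamma X) {w : L → RatField Z}
    (hw : UnitalAtOne w) : (rename h T).scalarAt w = T.scalarAt (w ∘ renamed a b) := by
  obtain ⟨r, hr⟩ := T.scalar_regular
  unfold scalarAt
  change substRat _ (substRat _ _) = _
  rw [substRat_substRat (fun i => valueAtOne_tvar _) (fun i => hw i) hr]
  congr 1
  funext i
  rw [substRat_tvar]
  simp only [Relabels.label, renamed, Function.comp]
  split_ifs <;> rfl

theorem matAt_rename {a b : L} (h : Relabels a b X Y) (T : Gamma X) {w : L → RatField Z}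
    (hw : UnitalAtOne w) {i j : L} (hi : i ∈ Y) (hj : j ∈ Y) :
    (rename h T).matAt w i j =
      T.matAt (w ∘ renamed a b) (renamed b a i) (renamed b a j) := by
  have hl : ∀ (i : L) (hi : i ∈ Y), (h.symm.label ⟨i, hi⟩ : L) = renamed b a i := by
    intro i hi
    unfold Relabels.label renamed; split_ifs <;> rfl
  rw [matAt_of_mem _ _ hi hj]
  change substRat _ (substRat _ _) = _
  rw [substRat_substRat (fun i => valueAtOne_tvar _) (fun i => hw i) (T.mat_one _ _),
    ← hl i hi, ← hl j hj, matAt_of_mem _ _ (h.symm.label ⟨i, hi⟩).2 (h.symm.label ⟨j, hj⟩).2]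
  congr 1
  funext i
  rw [substRat_tvar]
  simp only [Relabels.label, renamed, Function.comp]
  split_ifs <;> rfl

end Gamma

/-! ### Membership of labels in the sources and targets of the operations -/

section Labels

variable {L : Type*} [DecidableEq L]

/-- The common part `S` is eliminated here and in the analogues for the other operations. What
remains is pure membership, from which every label identity below follows by case distinction. -/
theorem Stitches.labels {a b c : L} {X Y : Finset L} (h : Stitches a b c X Y) :
    a ≠ b ∧ a ∈ X ∧ b ∈ X ∧ c ∈ Y ∧ (c ∈ X → c = a ∨ c = b) ∧
      ∀ l, l ∈ Y ↔ l = c ∨ (l ∈ X ∧ l ≠ a ∧ l ≠ b) := by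
  obtain ⟨S, h1, h2, h3, h4, rfl, rfl⟩ := h
  refine ⟨h1, by simp, by simp, by simp, by simp [h4], fun l => ?_⟩
  simp only [Finset.mem_insert]
  grind

theorem Extends.labels {a : L} {X Y : Finset L} (h : Extends a X Y) :
    a ∉ X ∧ a ∈ Y ∧ ∀ l, l ∈ Y ↔ l = a ∨ l ∈ X := by
  obtain ⟨h, rfl⟩ := h
  simp [h]

theorem Splits.labels {X Y Z : Finset L} (h : Splits X Y Z) :
    ∀ l, (l ∈ Z ↔ l ∈ X ∨ l ∈ Y) ∧ (l ∈ X → l ∉ Y) := by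
  obtain ⟨h, rfl⟩ := h
  intro l
  exact ⟨by simp, fun hl => Finset.disjoint_left.1 h hl⟩

theorem Relabels.labels {a b : L} {X Y : Finset L} (h : Relabels a b X Y) :
    a ∈ X ∧ b ∈ Y ∧ (b ∈ X → b = a) ∧ ∀ l, l ∈ Y ↔ l = b ∨ (l ∈ X ∧ l ≠ a) := by
  obtain ⟨S, h1, h2, rfl, rfl⟩ := h
  refine ⟨by simp, by simp, by simp [h2], fun l => ?_⟩
  simp only [Finset.mem_insert]
  grind

end Labels

attribute [simp] UnitalAtOne.comp UnitalAtOne.update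

/-! ### The laws of a meta-monoid in `Γ` -/

namespace Gamma

variable {L : Type*} [DecidableEq L] {X Y Y' Z : Finset L}

/-- Associativity and the commutation of stitchings with distinct labels are both instances. Each
side joins the pairs `(a, b)` and `(a', b')` of the original matrix, in opposite orders: `e1` to
`e4` identify the second join of one side with the first join of the other, while `hr`, `hc` and
`hn` match the final rows, columns and variables. -/
theorem stitch_stitch {a b c d e f a' b' c' d' e' f' : L} (h₁ : Stitches a b c X Y)
    (h₂ : Stitches d e f Y Z) (h₃ : Stitches a' b' c' X Y') (h₄ : Stitches d' e' f' Y' Z)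
    (e1 : oldRow b c d = a') (e2 : oldRow a c e = b') (e3 : oldRow b' c' d' = a)
    (e4 : oldRow a' c' e' = b)
    (hr : ∀ i ∈ Z, oldRow a c (oldRow d f i) = oldRow a' c' (oldRow d' f' i))
    (hc : ∀ i ∈ Z, oldRow b c (oldRow e f i) = oldRow b' c' (oldRow e' f' i))
    (hn : ∀ i ∈ X, GaussDiagram.newStrand d e f (GaussDiagram.newStrand a b c i) =
      GaussDiagram.newStrand d' e' f' (GaussDiagram.newStrand a' b' c' i)) (T : Gamma X) :
    stitch h₂ (stitch h₁ T) = stitch h₄ (stitch h₃ T) := by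
  have key : ∀ w : L → RatField Z, UnitalAtOne w →
      1 - T.matAt ((w ∘ GaussDiagram.newStrand d e f) ∘ GaussDiagram.newStrand a b c) b a ≠ 0 ∧
      1 - T.matAt ((w ∘ GaussDiagram.newStrand d e f) ∘ GaussDiagram.newStrand a b c) b' a' ≠ 0 ∧
      1 - feedback a b (T.matAt ((w ∘ GaussDiagram.newStrand d e f) ∘
        GaussDiagram.newStrand a b c)) b' a' ≠ 0 ∧
      1 - feedback a' b' (T.matAt ((w ∘ GaussDiagram.newStrand d e f) ∘
        GaussDiagram.newStrand a b c)) b a ≠ 0 ∧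
      T.matAt ((w ∘ GaussDiagram.newStrand d e f) ∘ GaussDiagram.newStrand a b c) =
      T.matAt ((w ∘ GaussDiagram.newStrand d' e' f') ∘ GaussDiagram.newStrand a' b' c') := by
    intro w hw
    have hn' : T.matAt ((w ∘ GaussDiagram.newStrand d e f) ∘ GaussDiagram.newStrand a b c) =
        T.matAt ((w ∘ GaussDiagram.newStrand d' e' f') ∘ GaussDiagram.newStrand a' b' c') := by
      funext i j
      exact T.matAt_congr (fun l hl => congrArg w (hn l hl)) i j
    refine ⟨T.one_sub_matAt_ne_zero (by simp [hw]) h₁.mem_right h₁.mem_left h₁.ne.symm,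
      T.one_sub_matAt_ne_zero (by simp [hw]) h₃.mem_right h₃.mem_left h₃.ne.symm, ?_, ?_, hn'⟩
    -- The second pivot belongs to the matrix of `stitch h₁ T`, which is again an element of `Γ`; so
    -- it has the value `1` at `t = 1` and cannot vanish.
    · have := (stitch h₁ T).one_sub_matAt_ne_zero (hw.comp (GaussDiagram.newStrand d e f))
        h₂.mem_right h₂.mem_left h₂.ne.symm
      rwa [matAt_stitch h₁ T (hw.comp _) h₂.mem_right h₂.mem_left, e1, e2] at this
    · have := (stitch h₃ T).one_sub_matAt_ne_zero (hw.comp (GaussDiagram.newStrand d' e' f'))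
        h₄.mem_right h₄.mem_left h₄.ne.symm
      rwa [matAt_stitch h₃ T (hw.comp _) h₄.mem_right h₄.mem_left, e3, e4, ← hn'] at this
  apply ext_at
  · intro w hw
    obtain ⟨k1, k2, -, -, k5⟩ := key w hw
    rw [scalarAt_stitch h₂ _ hw, scalarAt_stitch h₁ _ (hw.comp _), scalarAt_stitch h₄ _ hw,
      scalarAt_stitch h₃ _ (hw.comp _), matAt_stitch h₁ T (hw.comp _) h₂.mem_right h₂.mem_left,
      matAt_stitch h₃ T (hw.comp _) h₄.mem_right h₄.mem_left, e1, e2, e3, e4, ← mul_assoc,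
      ← mul_assoc, ← k5, feedback_scalar_comm _ k1 k2]
    congr 1
    exact T.scalarAt_congr fun l hl => congrArg w (hn l hl)
  · intro w hw i hi j hj
    obtain ⟨k1, k2, k3, k4, k5⟩ := key w hw
    have l1 := h₂.labels
    have l2 := h₄.labels
    have hm : ∀ {d e f : L} {Y : Finset L} (h₂ : Stitches d e f Y Z) {i : L}, i ∈ Z →
        oldRow d f i ∈ Y ∧ oldRow e f i ∈ Y := by
      intro d e f Y h₂ i hi
      have := h₂.labels
      unfold oldRow
      grind
    have inner : ∀ {a b c d e f : L} {Y : Finset L} (h₁ : Stitches a b c X Y)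
        (h₂ : Stitches d e f Y Z) {i j : L}, i ∈ Z → j ∈ Z →
        (stitch h₂ (stitch h₁ T)).matAt w i j = feedback (oldRow b c d) (oldRow a c e)
          (feedback a b (T.matAt ((w ∘ GaussDiagram.newStrand d e f) ∘
            GaussDiagram.newStrand a b c)))
          (oldRow a c (oldRow d f i)) (oldRow b c (oldRow e f j)) := by
      intro a b c d e f Y h₁ h₂ i j hi hj
      rw [matAt_stitch h₂ _ hw hi hj, feedback,
        matAt_stitch h₁ T (hw.comp _) (hm h₂ hi).1 (hm h₂ hj).2,
        matAt_stitch h₁ T (hw.comp _) (hm h₂ hi).1 h₂.mem_left,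
        matAt_stitch h₁ T (hw.comp _) h₂.mem_right (hm h₂ hj).2,
        matAt_stitch h₁ T (hw.comp _) h₂.mem_right h₂.mem_left]
      rfl
    rw [inner h₁ h₂ hi hj, inner h₃ h₄ hi hj, e1, e2, e3, e4, hr i hi, hc j hj,
      feedback_comm _ k1 k2 k3 k4, k5]

end Gamma

namespace Gamma
variable {L : Type*} [DecidableEq L] {X Y Y' Z : Finset L}

theorem matAt_eq_zero (T : Gamma X) (w : L → RatField Z) {i j : L} (h : i ∉ X ∨ j ∉ X) :
    T.matAt w i j = 0 :=
  dif_neg (by tauto)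

/-- For a trivial strand `a` one has `M b a = 0` and `M a a = 1`. So the pivot is `1`, row `c`
receives `M a a * M b j = M b j`, and all other rows have `M i a = 0` and get no correction. -/
theorem left_one {a b c : L} (h₁ : Extends a X Y) (h₂ : Stitches a b c Y Z)
    (h₃ : Relabels b c X Z) (T : Gamma X) : stitch h₂ (one h₁ T) = rename h₃ T := by
  have l1 := h₁.labels
  have l2 := h₂.labels
  have l3 := h₃.labels
  have hn : ∀ (w : L → RatField Z), ∀ l ∈ X, (w ∘ GaussDiagram.newStrand a b c) l = (w ∘ renamed b c) l := by
    intro w l hl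
    simp only [Function.comp, GaussDiagram.newStrand, renamed]
    grind
  refine ext_at (fun w hw => ?_) (fun w hw i hi j hj => ?_)
  · rw [scalarAt_stitch h₂ _ hw, scalarAt_one h₁ _ (hw.comp _), scalarAt_rename h₃ _ hw,
      matAt_one h₁ _ (hw.comp _) h₂.mem_right h₂.mem_left, T.scalarAt_congr (hn w)]
    simp [h₂.ne.symm]
  · have e1 : oldRow a c i ∈ Y := by unfold oldRow; grind
    have e2 : oldRow b c j ∈ Y := by unfold oldRow; grind
    rw [matAt_stitch h₂ _ hw hi hj, feedback, matAt_one h₁ _ (hw.comp _) e1 e2,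
      matAt_one h₁ _ (hw.comp _) e1 h₂.mem_left, matAt_one h₁ _ (hw.comp _) h₂.mem_right e2,
      matAt_one h₁ _ (hw.comp _) h₂.mem_right h₂.mem_left, matAt_rename h₃ _ hw hi hj]
    simp only [T.matAt_congr (hn w)]
    simp only [oldRow, renamed]
    grind

/-- Here `M b b = 1` and the rest of row and column `b` is zero. Column `c` therefore receives `M i
a * M b b = M i a`, while the correction vanishes in the other columns. -/
theorem right_one {a b c : L} (h₁ : Extends b X Y) (h₂ : Stitches a b c Y Z)
    (h₃ : Relabels a c X Z) (T : Gamma X) : stitch h₂ (one h₁ T) = rename h₃ T := by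
  have l1 := h₁.labels
  have l2 := h₂.labels
  have l3 := h₃.labels
  have hn : ∀ (w : L → RatField Z), ∀ l ∈ X, (w ∘ GaussDiagram.newStrand a b c) l = (w ∘ renamed a c) l := by
    intro w l hl
    simp only [Function.comp, GaussDiagram.newStrand, renamed]
    grind
  refine ext_at (fun w hw => ?_) (fun w hw i hi j hj => ?_)
  · rw [scalarAt_stitch h₂ _ hw, scalarAt_one h₁ _ (hw.comp _), scalarAt_rename h₃ _ hw,
      matAt_one h₁ _ (hw.comp _) h₂.mem_right h₂.mem_left, T.scalarAt_congr (hn w)]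
    simp [h₂.ne.symm]
  · have e1 : oldRow a c i ∈ Y := by unfold oldRow; grind
    have e2 : oldRow b c j ∈ Y := by unfold oldRow; grind
    rw [matAt_stitch h₂ _ hw hi hj, feedback, matAt_one h₁ _ (hw.comp _) e1 e2,
      matAt_one h₁ _ (hw.comp _) e1 h₂.mem_left, matAt_one h₁ _ (hw.comp _) h₂.mem_right e2,
      matAt_one h₁ _ (hw.comp _) h₂.mem_right h₂.mem_left, matAt_rename h₃ _ hw hi hj]
    simp only [T.matAt_congr (hn w)]
    simp only [oldRow, renamed]
    grind

theorem stitch_rename {a b c d : L} (h₁ : Stitches a b c X Y)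
    (h₂ : Relabels c d Y Z) (h₃ : Stitches a b d X Z) (T : Gamma X) :
    rename h₂ (stitch h₁ T) = stitch h₃ T := by
  have l1 := h₁.labels
  have l2 := h₂.labels
  have l3 := h₃.labels
  have hn : ∀ (w : L → RatField Z), ∀ l ∈ X, ((w ∘ renamed c d) ∘ GaussDiagram.newStrand a b c) l =
      (w ∘ GaussDiagram.newStrand a b d) l := by
    intro w l hl
    simp only [Function.comp, GaussDiagram.newStrand, renamed]
    grind
  refine ext_at (fun w hw => ?_) (fun w hw i hi j hj => ?_)
  · rw [scalarAt_rename h₂ _ hw, scalarAt_stitch h₁ _ (hw.comp _), scalarAt_stitch h₃ _ hw,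
     T.scalarAt_congr (hn w), T.matAt_congr (hn w)]
  · have e1 : ∀ i ∈ Z, renamed d c i ∈ Y := by intro i hi; unfold renamed; grind
    rw [matAt_rename h₂ _ hw hi hj, matAt_stitch h₁ _ (hw.comp _) (e1 i hi) (e1 j hj),
      matAt_stitch h₃ _ hw hi hj]
    simp only [feedback, T.matAt_congr (hn w)]
    simp only [oldRow, renamed]
    grind
end Gamma

namespace Gamma
variable {L : Type*} [DecidableEq L] {X X' Y Y' Z Z' : Finset L}

theorem one_rename {a b : L} (h₁ : Extends a X Y) (h₂ : Relabels a b Y Z)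
    (h₃ : Extends b X Z) (T : Gamma X) :
    rename h₂ (one h₁ T) = one h₃ T := by
  have l₁ := h₁.labels
  have l₂ := h₂.labels
  have l₃ := h₃.labels
  have hn : ∀ w : L → RatField Z, ∀ l ∈ X, (w ∘ renamed a b) l = (w) l := by
    intro w l hl
    simp only [Function.comp, renamed]
    grind
  refine ext_at (fun w hw => ?_) (fun w hw i hi j hj => ?_)
  · rw [scalarAt_rename h₂ _ hw, scalarAt_one h₁ _ (hw.comp _), scalarAt_one h₃ _ hw, T.scalarAt_congr (hn w)]
  · have e : ∀ i ∈ Z, renamed b a i ∈ Y := by intro i hi; unfold renamed; grind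
    rw [matAt_rename h₂ _ hw hi hj, matAt_one h₁ _ (hw.comp _) (e i hi) (e j hj),
      matAt_one h₃ _ hw hi hj, T.matAt_congr (hn w)]
    simp only [renamed]
    grind

theorem rename_rename {a b c : L} (h₁ : Relabels a b X Y)
    (h₂ : Relabels b c Y Z) (h₃ : Relabels a c X Z) (T : Gamma X) :
    rename h₂ (rename h₁ T) = rename h₃ T := by
  have l₁ := h₁.labels
  have l₂ := h₂.labels
  have l₃ := h₃.labels
  have hn : ∀ w : L → RatField Z, ∀ l ∈ X, ((w ∘ renamed b c) ∘ renamed a b) l = (w ∘ renamed a c) l := by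
    intro w l hl
    simp only [Function.comp, renamed]
    grind
  refine ext_at (fun w hw => ?_) (fun w hw i hi j hj => ?_)
  · rw [scalarAt_rename h₂ _ hw, scalarAt_rename h₁ _ (hw.comp _), scalarAt_rename h₃ _ hw,
      T.scalarAt_congr (hn w)]
  · have e : ∀ i ∈ Z, renamed c b i ∈ Y := by intro i hi; unfold renamed; grind
    rw [matAt_rename h₂ _ hw hi hj, matAt_rename h₁ _ (hw.comp _) (e i hi) (e j hj),
      matAt_rename h₃ _ hw hi hj, T.matAt_congr (hn w)]
    simp only [renamed]
    grind

theorem rename_back {a b : L} (h₁ : Relabels a b X Y) (h₂ : Relabels b a Y X) (T : Gamma X) :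
    rename h₂ (rename h₁ T) = T := by
  have l₁ := h₁.labels
  have l₂ := h₂.labels
  have hn : ∀ w : L → RatField X, ∀ l ∈ X, ((w ∘ renamed b a) ∘ renamed a b) l = (w) l := by
    intro w l hl
    simp only [Function.comp, renamed]
    grind
  refine ext_at (fun w hw => ?_) (fun w hw i hi j hj => ?_)
  · rw [scalarAt_rename h₂ _ hw, scalarAt_rename h₁ _ (hw.comp _), T.scalarAt_congr (hn w)]
  · have e : ∀ i ∈ X, renamed a b i ∈ Y := by intro i hi; unfold renamed; grind
    rw [matAt_rename h₂ _ hw hi hj, matAt_rename h₁ _ (hw.comp _) (e i hi) (e j hj),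
      T.matAt_congr (hn w)]
    simp only [renamed]
    grind

theorem rename_del {a b : L} (h₁ : Relabels a b X Y) (h₂ : Extends b Z Y)
    (h₃ : Extends a Z X) (T : Gamma X) :
    del h₂ (rename h₁ T) = del h₃ T := by
  have l₁ := h₁.labels
  have l₂ := h₂.labels
  have l₃ := h₃.labels
  have hn : ∀ w : L → RatField Z, ∀ l ∈ X, (Function.update w b 1 ∘ renamed a b) l = (Function.update w a 1) l := by
    intro w l hl
    simp only [Function.comp, renamed, Function.update_apply]
    grind
  refine ext_at (fun w hw => ?_) (fun w hw i hi j hj => ?_)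
  · rw [scalarAt_del h₂ _ hw, scalarAt_rename h₁ _ (hw.update _), scalarAt_del h₃ _ hw,
      T.scalarAt_congr (hn w)]
  · rw [matAt_del h₂ _ hw hi hj, matAt_rename h₁ _ (hw.update _) (h₂.mem_of_mem hi) (h₂.mem_of_mem hj),
      matAt_del h₃ _ hw hi hj, T.matAt_congr (hn w)]
    simp only [renamed]
    grind

theorem one_del {a : L} (h : Extends a X Y) (T : Gamma X) :
    del h (one h T) = T := by
  have lh := h.labels
  have hn : ∀ w : L → RatField X, ∀ l ∈ X, (Function.update w a 1) l = (w) l := by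
    intro w l hl
    simp only [Function.update_apply]
    grind
  refine ext_at (fun w hw => ?_) (fun w hw i hi j hj => ?_)
  · rw [scalarAt_del h _ hw, scalarAt_one h _ (hw.update _), T.scalarAt_congr (hn w)]
  · rw [matAt_del h _ hw hi hj, matAt_one h _ (hw.update _) (h.mem_of_mem hi) (h.mem_of_mem hj),
      T.matAt_congr (hn w)]
    grind

theorem rename_stitch {a b c d : L} (h₁ : Relabels a b X Y)
    (h₂ : Stitches b c d Y Z) (h₃ : Stitches a c d X Z) (T : Gamma X) :
    stitch h₂ (rename h₁ T) = stitch h₃ T := by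
  have l₁ := h₁.labels
  have l₂ := h₂.labels
  have l₃ := h₃.labels
  have hn : ∀ w : L → RatField Z, ∀ l ∈ X, ((w ∘ GaussDiagram.newStrand b c d) ∘ renamed a b) l = (w ∘ GaussDiagram.newStrand a c d) l := by
    intro w l hl
    simp only [Function.comp, GaussDiagram.newStrand, renamed]
    grind
  refine ext_at (fun w hw => ?_) (fun w hw i hi j hj => ?_)
  · rw [scalarAt_stitch h₂ _ hw, scalarAt_rename h₁ _ (hw.comp _), scalarAt_stitch h₃ _ hw,
      matAt_rename h₁ _ (hw.comp _) h₂.mem_right h₂.mem_left, T.scalarAt_congr (hn w),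
      T.matAt_congr (hn w)]
    have e1 : renamed b a c = c := by unfold renamed; grind
    have e2 : renamed b a b = a := by unfold renamed; grind
    rw [e1, e2]
  · have e : ∀ i ∈ Z, oldRow b d i ∈ Y ∧ oldRow c d i ∈ Y := by intro i hi; unfold oldRow; grind
    rw [matAt_stitch h₂ _ hw hi hj, matAt_stitch h₃ _ hw hi hj, feedback, feedback,
      matAt_rename h₁ _ (hw.comp _) (e i hi).1 (e j hj).2,
      matAt_rename h₁ _ (hw.comp _) (e i hi).1 h₂.mem_left,
      matAt_rename h₁ _ (hw.comp _) h₂.mem_right (e j hj).2,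
      matAt_rename h₁ _ (hw.comp _) h₂.mem_right h₂.mem_left]
    simp only [T.matAt_congr (hn w)]
    simp only [oldRow, renamed]
    grind

theorem stitch_one_comm {a b c d : L} (hd : d ∉ ({a, b, c} : Finset L))
    (h₁ : Stitches a b c X Y) (h₂ : Extends d Y Z) (h₃ : Extends d X Y')
    (h₄ : Stitches a b c Y' Z) (T : Gamma X) :
    one h₂ (stitch h₁ T) = stitch h₄ (one h₃ T) := by
  have l₁ := h₁.labels
  have l₂ := h₂.labels
  have l₃ := h₃.labels
  have l₄ := h₄.labels
  simp only [Finset.mem_insert, Finset.mem_singleton] at hd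
  refine ext_at (fun w hw => ?_) (fun w hw i hi j hj => ?_)
  · rw [scalarAt_one h₂ _ hw, scalarAt_stitch h₁ _ hw, scalarAt_stitch h₄ _ hw,
      scalarAt_one h₃ _ (hw.comp _), matAt_one h₃ _ (hw.comp _) h₄.mem_right h₄.mem_left]
    grind
  · have e : ∀ i ∈ Z, oldRow a c i ∈ Y' ∧ oldRow b c i ∈ Y' := by intro i hi; unfold oldRow; grind
    rw [matAt_one h₂ _ hw hi hj, matAt_stitch h₄ _ hw hi hj, feedback,
      matAt_one h₃ _ (hw.comp _) (e i hi).1 (e j hj).2,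
      matAt_one h₃ _ (hw.comp _) (e i hi).1 h₄.mem_left,
      matAt_one h₃ _ (hw.comp _) h₄.mem_right (e j hj).2,
      matAt_one h₃ _ (hw.comp _) h₄.mem_right h₄.mem_left]
    by_cases hij : i ≠ d ∧ j ≠ d
    · have hi' : i ∈ Y := by grind
      have hj' : j ∈ Y := by grind
      rw [if_pos hij, matAt_stitch h₁ _ hw hi' hj', feedback]
      simp only [oldRow]
      grind
    · rw [if_neg hij]
      simp only [oldRow]
      grind

theorem stitch_del_comm {a b c d : L} (hd : d ∉ ({a, b, c} : Finset L))
    (h₁ : Stitches a b c X Y) (h₂ : Extends d Z Y) (h₃ : Extends d Y' X)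
    (h₄ : Stitches a b c Y' Z) (T : Gamma X) :
    del h₂ (stitch h₁ T) = stitch h₄ (del h₃ T) := by
  have l₁ := h₁.labels
  have l₂ := h₂.labels
  have l₃ := h₃.labels
  have l₄ := h₄.labels
  simp only [Finset.mem_insert, Finset.mem_singleton] at hd
  have hn : ∀ w : L → RatField Z, ∀ l ∈ X, (Function.update w d 1 ∘ GaussDiagram.newStrand a b c) l = (Function.update (w ∘ GaussDiagram.newStrand a b c) d 1) l := by
    intro w l hl
    simp only [Function.comp, GaussDiagram.newStrand, Function.update_apply]
    grind
  refine ext_at (fun w hw => ?_) (fun w hw i hi j hj => ?_)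
  · rw [scalarAt_del h₂ _ hw, scalarAt_stitch h₁ _ (hw.update _), scalarAt_stitch h₄ _ hw,
      scalarAt_del h₃ _ (hw.comp _), matAt_del h₃ _ (hw.comp _) h₄.mem_right h₄.mem_left,
      T.scalarAt_congr (hn w), T.matAt_congr (hn w)]
  · have e : ∀ i ∈ Z, oldRow a c i ∈ Y' ∧ oldRow b c i ∈ Y' := by intro i hi; unfold oldRow; grind
    rw [matAt_del h₂ _ hw hi hj, matAt_stitch h₁ _ (hw.update _) (h₂.mem_of_mem hi) (h₂.mem_of_mem hj),
      matAt_stitch h₄ _ hw hi hj, feedback, feedback,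
      matAt_del h₃ _ (hw.comp _) (e i hi).1 (e j hj).2,
      matAt_del h₃ _ (hw.comp _) (e i hi).1 h₄.mem_left,
      matAt_del h₃ _ (hw.comp _) h₄.mem_right (e j hj).2,
      matAt_del h₃ _ (hw.comp _) h₄.mem_right h₄.mem_left]
    simp only [T.matAt_congr (hn w)]

theorem stitch_rename_comm {a b c d e : L} (hd : Disjoint ({a, b, c} : Finset L) {d, e})
    (h₁ : Stitches a b c X Y) (h₂ : Relabels d e Y Z) (h₃ : Relabels d e X Y')
    (h₄ : Stitches a b c Y' Z) (T : Gamma X) :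
    rename h₂ (stitch h₁ T) = stitch h₄ (rename h₃ T) := by
  have l₁ := h₁.labels
  have l₂ := h₂.labels
  have l₃ := h₃.labels
  have l₄ := h₄.labels
  simp only [Finset.disjoint_left, Finset.mem_insert, Finset.mem_singleton] at hd
  have hn : ∀ w : L → RatField Z, ∀ l ∈ X, ((w ∘ renamed d e) ∘ GaussDiagram.newStrand a b c) l = ((w ∘ GaussDiagram.newStrand a b c) ∘ renamed d e) l := by
    intro w l hl
    simp only [Function.comp, GaussDiagram.newStrand, renamed]
    grind
  refine ext_at (fun w hw => ?_) (fun w hw i hi j hj => ?_)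
  · rw [scalarAt_rename h₂ _ hw, scalarAt_stitch h₁ _ (hw.comp _), scalarAt_stitch h₄ _ hw,
      scalarAt_rename h₃ _ (hw.comp _), matAt_rename h₃ _ (hw.comp _) h₄.mem_right h₄.mem_left,
      T.scalarAt_congr (hn w), T.matAt_congr (hn w)]
    simp only [renamed]
    grind
  · have e' : ∀ i ∈ Z, oldRow a c i ∈ Y' ∧ oldRow b c i ∈ Y' := by intro i hi; unfold oldRow; grind
    have e'' : ∀ i ∈ Z, renamed e d i ∈ Y := by intro i hi; unfold renamed; grind
    rw [matAt_rename h₂ _ hw hi hj, matAt_stitch h₁ _ (hw.comp _) (e'' i hi) (e'' j hj),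
      matAt_stitch h₄ _ hw hi hj, feedback, feedback,
      matAt_rename h₃ _ (hw.comp _) (e' i hi).1 (e' j hj).2,
      matAt_rename h₃ _ (hw.comp _) (e' i hi).1 h₄.mem_left,
      matAt_rename h₃ _ (hw.comp _) h₄.mem_right (e' j hj).2,
      matAt_rename h₃ _ (hw.comp _) h₄.mem_right h₄.mem_left]
    simp only [T.matAt_congr (hn w)]
    simp only [oldRow, renamed]
    grind

theorem one_one_comm {a b : L} (h₁ : Extends a X Y)
    (h₂ : Extends b Y Z) (h₃ : Extends b X Y') (h₄ : Extends a Y' Z) (T : Gamma X) :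
    one h₂ (one h₁ T) = one h₄ (one h₃ T) := by
  have l₁ := h₁.labels
  have l₂ := h₂.labels
  have l₃ := h₃.labels
  have l₄ := h₄.labels
  refine ext_at (fun w hw => ?_) (fun w hw i hi j hj => ?_)
  · rw [scalarAt_one h₂ _ hw, scalarAt_one h₁ _ hw, scalarAt_one h₄ _ hw, scalarAt_one h₃ _ hw]
  · rw [matAt_one h₂ _ hw hi hj, matAt_one h₄ _ hw hi hj]
    by_cases h : (i ≠ a ∧ j ≠ a) ∧ (i ≠ b ∧ j ≠ b)
    · rw [if_pos h.1, if_pos h.2, matAt_one h₁ _ hw (h₂.mem_old hi h.2.1) (h₂.mem_old hj h.2.2),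
        matAt_one h₃ _ hw (h₄.mem_old hi h.1.1) (h₄.mem_old hj h.1.2), if_pos h.1, if_pos h.2]
    · by_cases k1 : i ≠ b ∧ j ≠ b
      · have k2 : ¬ (i ≠ a ∧ j ≠ a) := fun hh => h ⟨hh, k1⟩
        rw [if_pos k1, if_neg k2, matAt_one h₁ _ hw (h₂.mem_old hi k1.1) (h₂.mem_old hj k1.2),
          if_neg k2]
      · rw [if_neg k1]
        by_cases k2 : i ≠ a ∧ j ≠ a
        · rw [if_pos k2, matAt_one h₃ _ hw (h₄.mem_old hi k2.1) (h₄.mem_old hj k2.2), if_neg k1]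
        · rw [if_neg k2]

theorem one_del_comm {a b : L} (h₁ : Extends a X Y)
    (h₂ : Extends b Z Y) (h₃ : Extends b Y' X) (h₄ : Extends a Y' Z) (T : Gamma X) :
    del h₂ (one h₁ T) = one h₄ (del h₃ T) := by
  have l₁ := h₁.labels
  have l₂ := h₂.labels
  have l₃ := h₃.labels
  have l₄ := h₄.labels
  refine ext_at (fun w hw => ?_) (fun w hw i hi j hj => ?_)
  · rw [scalarAt_del h₂ _ hw, scalarAt_one h₁ _ (hw.update _), scalarAt_one h₄ _ hw, scalarAt_del h₃ _ hw]
  · rw [matAt_del h₂ _ hw hi hj, matAt_one h₁ _ (hw.update _) (h₂.mem_of_mem hi) (h₂.mem_of_mem hj),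
      matAt_one h₄ _ hw hi hj]
    split_ifs with h
    · rw [matAt_del h₃ _ hw (h₄.mem_old hi h.1) (h₄.mem_old hj h.2)]
    · rfl
    · rfl

theorem one_rename_comm {a b c : L} (hd : a ∉ ({b, c} : Finset L)) (h₁ : Extends a X Y)
    (h₂ : Relabels b c Y Z) (h₃ : Relabels b c X Y') (h₄ : Extends a Y' Z) (T : Gamma X) :
    rename h₂ (one h₁ T) = one h₄ (rename h₃ T) := by
  have l₁ := h₁.labels
  have l₂ := h₂.labels
  have l₃ := h₃.labels
  have l₄ := h₄.labels
  simp only [Finset.mem_insert, Finset.mem_singleton] at hd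
  refine ext_at (fun w hw => ?_) (fun w hw i hi j hj => ?_)
  · rw [scalarAt_rename h₂ _ hw, scalarAt_one h₁ _ (hw.comp _), scalarAt_one h₄ _ hw,
      scalarAt_rename h₃ _ hw]
  · have e : ∀ i ∈ Z, renamed c b i ∈ Y := by intro i hi; unfold renamed; grind
    rw [matAt_rename h₂ _ hw hi hj, matAt_one h₁ _ (hw.comp _) (e i hi) (e j hj),
      matAt_one h₄ _ hw hi hj]
    by_cases h : i ≠ a ∧ j ≠ a
    · rw [if_pos h, matAt_rename h₃ _ hw (h₄.mem_old hi h.1) (h₄.mem_old hj h.2), if_pos]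
      simp only [renamed]
      grind
    · rw [if_neg h, if_neg]
      all_goals simp only [renamed]; grind

theorem del_del_comm {a b : L} (hd : a ≠ b) (h₁ : Extends a Y X)
    (h₂ : Extends b Z Y) (h₃ : Extends b Y' X) (h₄ : Extends a Z Y') (T : Gamma X) :
    del h₂ (del h₁ T) = del h₄ (del h₃ T) := by
  refine ext_at (fun w hw => ?_) (fun w hw i hi j hj => ?_)
  · rw [scalarAt_del h₂ _ hw, scalarAt_del h₁ _ (hw.update _), scalarAt_del h₄ _ hw,
      scalarAt_del h₃ _ (hw.update _), Function.update_comm hd]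
  · rw [matAt_del h₂ _ hw hi hj, matAt_del h₁ _ (hw.update _) (h₂.mem_of_mem hi) (h₂.mem_of_mem hj),
      matAt_del h₄ _ hw hi hj, matAt_del h₃ _ (hw.update _) (h₄.mem_of_mem hi) (h₄.mem_of_mem hj),
      Function.update_comm hd]

theorem del_rename_comm {a b c : L} (hd : a ∉ ({b, c} : Finset L)) (h₁ : Extends a Y X)
    (h₂ : Relabels b c Y Z) (h₃ : Relabels b c X Y') (h₄ : Extends a Z Y') (T : Gamma X) :
    rename h₂ (del h₁ T) = del h₄ (rename h₃ T) := by
  have l₁ := h₁.labels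
  have l₂ := h₂.labels
  have l₃ := h₃.labels
  have l₄ := h₄.labels
  simp only [Finset.mem_insert, Finset.mem_singleton] at hd
  have hn : ∀ w : L → RatField Z, ∀ l ∈ X, (Function.update (w ∘ renamed b c) a 1) l = (Function.update w a 1 ∘ renamed b c) l := by
    intro w l hl
    simp only [Function.comp, renamed, Function.update_apply]
    grind
  refine ext_at (fun w hw => ?_) (fun w hw i hi j hj => ?_)
  · rw [scalarAt_rename h₂ _ hw, scalarAt_del h₁ _ (hw.comp _), scalarAt_del h₄ _ hw,
      scalarAt_rename h₃ _ (hw.update _), T.scalarAt_congr (hn w)]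
  · have e : ∀ i ∈ Z, renamed c b i ∈ Y := by intro i hi; unfold renamed; grind
    rw [matAt_rename h₂ _ hw hi hj, matAt_del h₁ _ (hw.comp _) (e i hi) (e j hj),
      matAt_del h₄ _ hw hi hj, matAt_rename h₃ _ (hw.update _) (h₄.mem_of_mem hi) (h₄.mem_of_mem hj),
      T.matAt_congr (hn w)]

theorem rename_rename_comm {a b c d : L} (hd : Disjoint ({a, b} : Finset L) {c, d})
    (h₁ : Relabels a b X Y) (h₂ : Relabels c d Y Z) (h₃ : Relabels c d X Y')
    (h₄ : Relabels a b Y' Z) (T : Gamma X) :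
    rename h₂ (rename h₁ T) = rename h₄ (rename h₃ T) := by
  have l₁ := h₁.labels
  have l₂ := h₂.labels
  have l₃ := h₃.labels
  have l₄ := h₄.labels
  simp only [Finset.disjoint_left, Finset.mem_insert, Finset.mem_singleton] at hd
  have hn : ∀ w : L → RatField Z, ∀ l ∈ X, ((w ∘ renamed c d) ∘ renamed a b) l = ((w ∘ renamed a b) ∘ renamed c d) l := by
    intro w l hl
    simp only [Function.comp, renamed]
    grind
  refine ext_at (fun w hw => ?_) (fun w hw i hi j hj => ?_)
  · rw [scalarAt_rename h₂ _ hw, scalarAt_rename h₁ _ (hw.comp _), scalarAt_rename h₄ _ hw,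
      scalarAt_rename h₃ _ (hw.comp _), T.scalarAt_congr (hn w)]
  · have e : ∀ i ∈ Z, renamed d c i ∈ Y := by intro i hi; unfold renamed; grind
    have e' : ∀ i ∈ Z, renamed b a i ∈ Y' := by intro i hi; unfold renamed; grind
    rw [matAt_rename h₂ _ hw hi hj, matAt_rename h₁ _ (hw.comp _) (e i hi) (e j hj),
      matAt_rename h₄ _ hw hi hj, matAt_rename h₃ _ (hw.comp _) (e' i hi) (e' j hj),
      T.matAt_congr (hn w)]
    simp only [renamed]
    grind

theorem union_comm (h₁ : Splits X Y Z) (h₂ : Splits Y X Z) (T : Gamma X) (U : Gamma Y) :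
    union h₁ T U = union h₂ U T := by
  refine ext_at (fun w hw => ?_) (fun w hw i hi j hj => ?_)
  · rw [scalarAt_union h₁ _ _ hw, scalarAt_union h₂ _ _ hw, mul_comm]
  · rw [matAt_union h₁ _ _ hw, matAt_union h₂ _ _ hw, add_comm]

theorem union_assoc {XY YZ XYZ : Finset L} (h₁ : Splits X Y XY) (h₂ : Splits XY Z XYZ)
    (h₃ : Splits Y Z YZ) (h₄ : Splits X YZ XYZ) (T : Gamma X) (U : Gamma Y) (V : Gamma Z) :
    union h₂ (union h₁ T U) V = union h₄ T (union h₃ U V) := by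
  refine ext_at (fun w hw => ?_) (fun w hw i hi j hj => ?_)
  · rw [scalarAt_union h₂ _ _ hw, scalarAt_union h₁ _ _ hw, scalarAt_union h₄ _ _ hw,
      scalarAt_union h₃ _ _ hw, mul_assoc]
  · rw [matAt_union h₂ _ _ hw, matAt_union h₁ _ _ hw, matAt_union h₄ _ _ hw,
      matAt_union h₃ _ _ hw, add_assoc]

/-- Both joined strands belong to `T`, so that `U` enters neither the pivot nor the correction term,
and its variables are not affected. -/
theorem union_stitch {a b c : L} (h₁ : Splits X Y Z)
    (h₂ : Stitches a b c Z Z') (h₃ : Stitches a b c X X') (h₄ : Splits X' Y Z')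
    (T : Gamma X) (U : Gamma Y) :
    stitch h₂ (union h₁ T U) = union h₄ (stitch h₃ T) U := by
  have l₁ := h₁.labels
  have l₂ := h₂.labels
  have l₃ := h₃.labels
  have l₄ := h₄.labels
  have hn : ∀ w : L → RatField Z', ∀ l ∈ Y, (w ∘ GaussDiagram.newStrand a b c) l = (w) l := by
    intro w l hl
    simp only [Function.comp, GaussDiagram.newStrand]
    grind
  refine ext_at (fun w hw => ?_) (fun w hw i hi j hj => ?_)
  · rw [scalarAt_stitch h₂ _ hw, scalarAt_union h₁ _ _ (hw.comp _), scalarAt_union h₄ _ _ hw,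
      scalarAt_stitch h₃ _ hw, matAt_union h₁ _ _ (hw.comp _), U.scalarAt_congr (hn w),
      U.matAt_eq_zero _ (i := b) (by grind), add_zero, mul_assoc]
  · rw [matAt_stitch h₂ _ hw hi hj, feedback]
    simp only [matAt_union h₁ _ _ (hw.comp _)]
    rw [matAt_union h₄ _ _ hw, U.matAt_congr (hn w), U.matAt_eq_zero _ (i := b) (j := a) (by grind),
      U.matAt_eq_zero _ (i := b) (j := oldRow b c j) (by grind),
      U.matAt_eq_zero _ (i := oldRow a c i) (j := a) (by grind)]
    by_cases hij : i ∈ X' ∧ j ∈ X'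
    · rw [matAt_stitch h₃ _ hw hij.1 hij.2, feedback, U.matAt_eq_zero _ (i := i) (by grind),
        U.matAt_eq_zero _ (i := oldRow a c i) (by unfold oldRow; grind)]
      simp only [add_zero]
    · rw [matAt_eq_zero (stitch h₃ T) _ (by grind)]
      -- Outside the block of `X'` one factor of the correction term has its row or column outside
      -- `X`, and hence is zero.
      have hX : (i ∉ X' ∧ T.matAt (w ∘ GaussDiagram.newStrand a b c) (oldRow a c i) a = 0) ∨
          (j ∉ X' ∧ T.matAt (w ∘ GaussDiagram.newStrand a b c) b (oldRow b c j) = 0) := by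
        by_cases hi' : i ∈ X'
        · have hj' : j ∉ X' := fun hh => hij ⟨hi', hh⟩
          exact Or.inr ⟨hj', T.matAt_eq_zero _ (by unfold oldRow; grind)⟩
        · exact Or.inl ⟨hi', T.matAt_eq_zero _ (by unfold oldRow; grind)⟩
      rw [T.matAt_eq_zero _ (i := oldRow a c i) (j := oldRow b c j) (by unfold oldRow; grind)]
      -- The shift of labels only moves `c`, which is not in `Y`; an entry with a label outside `Y`
      -- is zero, and `a`, `b` are not in `Y` either.
      have hU : U.matAt w (oldRow a c i) (oldRow b c j) = U.matAt w i j := by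
        by_cases hh : i ∈ Y ∧ j ∈ Y
        · simp only [oldRow]; grind
        · rw [U.matAt_eq_zero _ (i := i) (j := j) (by grind), U.matAt_eq_zero]
          unfold oldRow; grind
      rw [hU]
      rcases hX with hX | hX <;> rw [hX.2] <;> simp

theorem union_one {a : L} (h₁ : Splits X Y Z)
    (h₂ : Extends a Z Z') (h₃ : Extends a X X') (h₄ : Splits X' Y Z')
    (T : Gamma X) (U : Gamma Y) :
    one h₂ (union h₁ T U) = union h₄ (one h₃ T) U := by
  have l₁ := h₁.labels
  have l₂ := h₂.labels
  have l₃ := h₃.labels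
  have l₄ := h₄.labels
  refine ext_at (fun w hw => ?_) (fun w hw i hi j hj => ?_)
  · rw [scalarAt_one h₂ _ hw, scalarAt_union h₁ _ _ hw, scalarAt_union h₄ _ _ hw, scalarAt_one h₃ _ hw]
  · rw [matAt_one h₂ _ hw hi hj, matAt_union h₁ _ _ hw, matAt_union h₄ _ _ hw]
    by_cases hij : i ∈ X' ∧ j ∈ X'
    · rw [matAt_one h₃ _ hw hij.1 hij.2, U.matAt_eq_zero _ (by grind)]
      grind
    · rw [matAt_eq_zero (one h₃ T) _ (by grind), T.matAt_eq_zero _ (by grind)]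
      by_cases hh : i ≠ a ∧ j ≠ a
      · rw [if_pos hh]
      · rw [if_neg hh, U.matAt_eq_zero _ (by grind), if_neg (by grind), zero_add]

theorem union_del {a : L} (h₁ : Splits X Y Z)
    (h₂ : Extends a Z' Z) (h₃ : Extends a X' X) (h₄ : Splits X' Y Z')
    (T : Gamma X) (U : Gamma Y) :
    del h₂ (union h₁ T U) = union h₄ (del h₃ T) U := by
  have l₁ := h₁.labels
  have l₂ := h₂.labels
  have l₃ := h₃.labels
  have l₄ := h₄.labels
  have hn : ∀ w : L → RatField Z', ∀ l ∈ Y, (Function.update w a 1) l = (w) l := by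
    intro w l hl
    simp only [Function.update_apply]
    grind
  refine ext_at (fun w hw => ?_) (fun w hw i hi j hj => ?_)
  · rw [scalarAt_del h₂ _ hw, scalarAt_union h₁ _ _ (hw.update _), scalarAt_union h₄ _ _ hw,
      scalarAt_del h₃ _ hw, U.scalarAt_congr (hn w)]
  · rw [matAt_del h₂ _ hw hi hj, matAt_union h₁ _ _ (hw.update _), matAt_union h₄ _ _ hw,
      U.matAt_congr (hn w)]
    by_cases hij : i ∈ X' ∧ j ∈ X'
    · rw [matAt_del h₃ _ hw hij.1 hij.2]
    · rw [matAt_eq_zero (del h₃ T) _ (by grind), T.matAt_eq_zero _ (by grind)]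

theorem union_rename {a b : L} (h₁ : Splits X Y Z)
    (h₂ : Relabels a b Z Z') (h₃ : Relabels a b X X') (h₄ : Splits X' Y Z')
    (T : Gamma X) (U : Gamma Y) :
    rename h₂ (union h₁ T U) = union h₄ (rename h₃ T) U := by
  have l₁ := h₁.labels
  have l₂ := h₂.labels
  have l₃ := h₃.labels
  have l₄ := h₄.labels
  have hn : ∀ w : L → RatField Z', ∀ l ∈ Y, (w ∘ renamed a b) l = (w) l := by
    intro w l hl
    simp only [Function.comp, renamed]
    grind
  refine ext_at (fun w hw => ?_) (fun w hw i hi j hj => ?_)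
  · rw [scalarAt_rename h₂ _ hw, scalarAt_union h₁ _ _ (hw.comp _), scalarAt_union h₄ _ _ hw,
      scalarAt_rename h₃ _ hw, U.scalarAt_congr (hn w)]
  · rw [matAt_rename h₂ _ hw hi hj, matAt_union h₁ _ _ (hw.comp _), matAt_union h₄ _ _ hw,
      U.matAt_congr (hn w)]
    have hU : U.matAt w (renamed b a i) (renamed b a j) = U.matAt w i j := by
      by_cases hh : i ∈ Y ∧ j ∈ Y
      · simp only [renamed]; grind
      · rw [U.matAt_eq_zero _ (i := i) (j := j) (by grind), U.matAt_eq_zero]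
        unfold renamed; grind
    rw [hU]
    by_cases hij : i ∈ X' ∧ j ∈ X'
    · rw [matAt_rename h₃ _ hw hij.1 hij.2]
    · rw [matAt_eq_zero (rename h₃ T) _ (by grind), T.matAt_eq_zero _ (by unfold renamed; grind)]

end Gamma

/-! ### The row condition and the meta-monoid `Γ_0` -/

namespace Gamma

variable {L : Type*} [DecidableEq L] {X Y Z : Finset L}

theorem isPreMetaMonoid (L : Type*) [DecidableEq L] : IsPreMetaMonoid (gammaCalculus L) where
  assoc h₁ h₂ h₃ h₄ T := by
    have l1 := h₁.labels
    have l2 := h₂.labels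
    have l3 := h₃.labels
    have l4 := h₄.labels
    refine stitch_stitch h₁ h₂ h₃ h₄ ?_ ?_ ?_ ?_ ?_ ?_ ?_ T <;>
      simp only [oldRow, GaussDiagram.newStrand] <;> grind
  stitch_stitch_comm hd h₁ h₂ h₃ h₄ T := by
    have l1 := h₁.labels
    have l2 := h₂.labels
    have l3 := h₃.labels
    have l4 := h₄.labels
    simp only [Finset.disjoint_left, Finset.mem_insert, Finset.mem_singleton] at hd
    refine stitch_stitch h₁ h₂ h₃ h₄ ?_ ?_ ?_ ?_ ?_ ?_ ?_ T <;>
      simp only [oldRow, GaussDiagram.newStrand] <;> grind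
  left_one := left_one
  right_one := right_one
  one_rename := one_rename
  rename_rename := rename_rename
  rename_back := rename_back
  rename_del := rename_del
  one_del := one_del
  stitch_rename := stitch_rename
  rename_stitch := rename_stitch
  stitch_one_comm := stitch_one_comm
  stitch_del_comm := stitch_del_comm
  stitch_rename_comm := stitch_rename_comm
  one_one_comm _ := one_one_comm
  one_del_comm _ := one_del_comm
  one_rename_comm := one_rename_comm
  del_del_comm := del_del_comm
  del_rename_comm := del_rename_comm
  rename_rename_comm := rename_rename_comm
  union_comm := union_comm
  union_assoc := union_assoc
  union_stitch := union_stitch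
  union_one := union_one
  union_del := union_del
  union_rename := union_rename

/-- The row condition sets a single variable to `1`. Every unital substitution with `w i = 1`
factors through that one. -/
theorem RowCondition.matAt_eq_zero {T : Gamma X} (h : RowCondition X T) {w : L → RatField Z}
    (hw : UnitalAtOne w) {i j : L} (hi : i ∈ X) (hj : j ∈ X) (hij : i ≠ j) (h1 : w i = 1) :
    T.matAt w i j = 0 := by
  refine (SubstTo.trans (v := fun k : X => w k) ?_
    (h ⟨i, hi⟩ ⟨j, hj⟩ (by simpa using hij)) SubstTo.zero (T.substTo_mat hw hi hj)).symm
  intro k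
  by_cases hk : k = ⟨i, hi⟩
  · subst hk
    rw [if_pos rfl, h1]
    exact SubstTo.one
  · rw [if_neg hk]
    have := SubstTo.poly (v := fun k : X => w k) (MvPolynomial.X k)
    rwa [MvPolynomial.aeval_X] at this

/-- One test substitution suffices: the generic one with `t_i` replaced by `1`, that is `weight X`
updated at `i`. -/
theorem rowCondition_of_matAt {T : Gamma X} (h : ∀ w : L → RatField X, UnitalAtOne w →
    ∀ i ∈ X, ∀ j ∈ X, i ≠ j → w i = 1 → T.matAt w i j = 0) : RowCondition X T := by
  intro i j hij
  have hw := (unitalAtOne_weight X).update (i : L)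
  have h0 := T.substTo_mat hw i.2 j.2
  rw [h _ hw i i.2 j j.2 (fun e => hij (Subtype.ext e)) (Function.update_self _ _ _)] at h0
  convert h0 using 1
  funext k
  by_cases hk : k = i
  · subst hk; simp
  · rw [if_neg hk, Function.update_of_ne (fun e => hk (Subtype.ext e)), weight_coe]

theorem isClosed_rowCondition (L : Type*) [DecidableEq L] :
    (gammaCalculus L).IsClosed RowCondition where
  stitch {a b c X Y} h T hT := by
    have l := h.labels
    refine rowCondition_of_matAt fun w hw i hi j hj hij h1 => ?_
    have hw' := hw.comp (GaussDiagram.newStrand a b c)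
    have e1 : oldRow a c i ∈ X := by unfold oldRow; grind
    have e2 : oldRow b c j ∈ X := by unfold oldRow; grind
    have k1 : T.matAt (w ∘ GaussDiagram.newStrand a b c) (oldRow a c i) (oldRow b c j) = 0 := by
      refine RowCondition.matAt_eq_zero hT hw' e1 e2 ?_ ?_ <;>
        simp only [oldRow, Function.comp, GaussDiagram.newStrand] <;> grind
    refine (matAt_stitch h T hw hi hj).trans ?_
    rw [feedback, k1]
    -- In row `c` the substitution makes both `t_a` and `t_b` equal to `1`, so the factor from row
    -- `b` vanishes. In any other row `i` the factor `M i a` vanishes, as an off-diagonal entry of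
    -- that row.
    by_cases hic : i = c
    · have k2 : T.matAt (w ∘ GaussDiagram.newStrand a b c) b (oldRow b c j) = 0 := by
        refine RowCondition.matAt_eq_zero hT hw' h.mem_right e2 ?_ ?_ <;>
          simp only [oldRow, Function.comp, GaussDiagram.newStrand] <;> grind
      rw [k2]
      simp
    · have k2 : T.matAt (w ∘ GaussDiagram.newStrand a b c) (oldRow a c i) a = 0 := by
        refine RowCondition.matAt_eq_zero hT hw' e1 h.mem_left ?_ ?_ <;>
          simp only [oldRow, Function.comp, GaussDiagram.newStrand] <;> grind
      rw [k2]
      simp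
  one {a X Y} h T hT := by
    have l := h.labels
    refine rowCondition_of_matAt fun w hw i hi j hj hij h1 => ?_
    refine (matAt_one h T hw hi hj).trans ?_
    split_ifs with h2
    · exact RowCondition.matAt_eq_zero hT hw (h.mem_old hi h2.1) (h.mem_old hj h2.2) hij h1
    · rfl
  del {a X Y} h T hT := by
    refine rowCondition_of_matAt fun w hw i hi j hj hij h1 => ?_
    refine (matAt_del h T hw hi hj).trans ?_
    refine RowCondition.matAt_eq_zero hT (hw.update _) (h.mem_of_mem hi) (h.mem_of_mem hj) hij ?_
    rw [Function.update_of_ne, h1]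
    rintro rfl
    exact h.1 hi
  union {X Y V} h T U hT hU := by
    refine rowCondition_of_matAt fun w hw i hi j hj hij h1 => ?_
    refine (matAt_union h T U hw i j).trans ?_
    have k1 : T.matAt w i j = 0 := by
      by_cases hX : i ∈ X ∧ j ∈ X
      · exact RowCondition.matAt_eq_zero hT hw hX.1 hX.2 hij h1
      · exact T.matAt_eq_zero _ (by tauto)
    have k2 : U.matAt w i j = 0 := by
      by_cases hY : i ∈ Y ∧ j ∈ Y
      · exact RowCondition.matAt_eq_zero hU hw hY.1 hY.2 hij h1
      · exact U.matAt_eq_zero _ (by tauto)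
    rw [k1, k2, add_zero]
  rename {a b X Y} h T hT := by
    have l := h.labels
    refine rowCondition_of_matAt fun w hw i hi j hj hij h1 => ?_
    refine (matAt_rename h T hw hi hj).trans ?_
    refine RowCondition.matAt_eq_zero hT (hw.comp _) ?_ ?_ ?_ ?_ <;>
      simp only [renamed, Function.comp] <;> grind

/-- Deleting the stitched strand sets `t_a = t_b = 1`. Row `b` then vanishes off the diagonal: `M b
a = 0` makes the pivot `1`, and `M b j = 0` removes the correction, so that only the deletion of
rows and columns is left. -/
theorem RowCondition.stitch_del {a b c : L} {S : Finset L} (h₁ : Stitches a b c X Y)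
    (h₂ : Extends c S Y) (h₃ : Extends b Z X) (h₄ : Extends a S Z) {T : Gamma X}
    (hT : RowCondition X T) : del h₂ (stitch h₁ T) = del h₄ (del h₃ T) := by
  have l1 := h₁.labels
  have l2 := h₂.labels
  have l3 := h₃.labels
  have l4 := h₄.labels
  have hn : ∀ w : L → RatField S, ∀ l ∈ X, (Function.update w c 1 ∘ GaussDiagram.newStrand a b c) l =
      Function.update (Function.update w a 1) b 1 l := by
    intro w l hl
    simp only [Function.comp, GaussDiagram.newStrand, Function.update_apply]
    grind
  refine ext_at (fun w hw => ?_) (fun w hw i hi j hj => ?_)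
  · rw [scalarAt_del h₂ _ hw, scalarAt_stitch h₁ _ (hw.update _), scalarAt_del h₄ _ hw,
      scalarAt_del h₃ _ (hw.update _), T.matAt_congr (hn w), T.scalarAt_congr (hn w),
      hT.matAt_eq_zero ((hw.update a).update b) h₁.mem_right h₁.mem_left h₁.ne.symm
        (Function.update_self _ _ _), sub_zero, one_mul]
  · have hia : i ≠ a := by grind
    have hjb : j ≠ b := by grind
    have hic : i ≠ c := by grind
    have hjc : j ≠ c := by grind
    rw [matAt_del h₂ _ hw hi hj, matAt_stitch h₁ _ (hw.update _) (h₂.mem_of_mem hi)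
      (h₂.mem_of_mem hj), matAt_del h₄ _ hw hi hj, matAt_del h₃ _ (hw.update _) (h₄.mem_of_mem hi)
      (h₄.mem_of_mem hj), feedback, T.matAt_congr (hn w), T.matAt_congr (hn w) b]
    simp only [oldRow, if_neg hic, if_neg hjc]
    rw [hT.matAt_eq_zero ((hw.update a).update b) h₁.mem_right
      (h₃.mem_of_mem (h₄.mem_of_mem hj)) hjb.symm (Function.update_self _ _ _)]
    simp

theorem isMetaMonoid_restrict (L : Type*) [DecidableEq L] : IsMetaMonoid
    ((gammaCalculus L).restrict RowCondition (isClosed_rowCondition L)) where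
  assoc h₁ h₂ h₃ h₄ T := Subtype.ext ((isPreMetaMonoid L).assoc h₁ h₂ h₃ h₄ T.1)
  stitch_stitch_comm hd h₁ h₂ h₃ h₄ T :=
    Subtype.ext ((isPreMetaMonoid L).stitch_stitch_comm hd h₁ h₂ h₃ h₄ T.1)
  left_one h₁ h₂ h₃ T := Subtype.ext (left_one h₁ h₂ h₃ T.1)
  right_one h₁ h₂ h₃ T := Subtype.ext (right_one h₁ h₂ h₃ T.1)
  one_rename h₁ h₂ h₃ T := Subtype.ext (one_rename h₁ h₂ h₃ T.1)
  rename_rename h₁ h₂ h₃ T := Subtype.ext (rename_rename h₁ h₂ h₃ T.1)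
  rename_back h₁ h₂ T := Subtype.ext (rename_back h₁ h₂ T.1)
  rename_del h₁ h₂ h₃ T := Subtype.ext (rename_del h₁ h₂ h₃ T.1)
  one_del h T := Subtype.ext (one_del h T.1)
  stitch_rename h₁ h₂ h₃ T := Subtype.ext (stitch_rename h₁ h₂ h₃ T.1)
  rename_stitch h₁ h₂ h₃ T := Subtype.ext (rename_stitch h₁ h₂ h₃ T.1)
  stitch_one_comm hd h₁ h₂ h₃ h₄ T := Subtype.ext (stitch_one_comm hd h₁ h₂ h₃ h₄ T.1)
  stitch_del_comm hd h₁ h₂ h₃ h₄ T := Subtype.ext (stitch_del_comm hd h₁ h₂ h₃ h₄ T.1)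
  stitch_rename_comm hd h₁ h₂ h₃ h₄ T := Subtype.ext (stitch_rename_comm hd h₁ h₂ h₃ h₄ T.1)
  one_one_comm _ h₁ h₂ h₃ h₄ T := Subtype.ext (one_one_comm h₁ h₂ h₃ h₄ T.1)
  one_del_comm _ h₁ h₂ h₃ h₄ T := Subtype.ext (one_del_comm h₁ h₂ h₃ h₄ T.1)
  one_rename_comm hd h₁ h₂ h₃ h₄ T := Subtype.ext (one_rename_comm hd h₁ h₂ h₃ h₄ T.1)
  del_del_comm hd h₁ h₂ h₃ h₄ T := Subtype.ext (del_del_comm hd h₁ h₂ h₃ h₄ T.1)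
  del_rename_comm hd h₁ h₂ h₃ h₄ T := Subtype.ext (del_rename_comm hd h₁ h₂ h₃ h₄ T.1)
  rename_rename_comm hd h₁ h₂ h₃ h₄ T := Subtype.ext (rename_rename_comm hd h₁ h₂ h₃ h₄ T.1)
  union_comm h₁ h₂ T U := Subtype.ext (union_comm h₁ h₂ T.1 U.1)
  union_assoc h₁ h₂ h₃ h₄ T U V := Subtype.ext (union_assoc h₁ h₂ h₃ h₄ T.1 U.1 V.1)
  union_stitch h₁ h₂ h₃ h₄ T U := Subtype.ext (union_stitch h₁ h₂ h₃ h₄ T.1 U.1)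
  union_one h₁ h₂ h₃ h₄ T U := Subtype.ext (union_one h₁ h₂ h₃ h₄ T.1 U.1)
  union_del h₁ h₂ h₃ h₄ T U := Subtype.ext (union_del h₁ h₂ h₃ h₄ T.1 U.1)
  union_rename h₁ h₂ h₃ h₄ T U := Subtype.ext (union_rename h₁ h₂ h₃ h₄ T.1 U.1)
  stitch_del h₁ h₂ h₃ h₄ T := Subtype.ext (T.2.stitch_del h₁ h₂ h₃ h₄)

end Gamma

/-! ### The laws of a meta-monoid for w-tangles -/

namespace GaussDiagram

variable {L : Type*} [DecidableEq L] {X X' Y Y' Z Z' : Finset L}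

theorem ext_on {D E : GaussDiagram X} (h : ∀ z ∈ X, D.code z = E.code z) : D = E := by
  apply GaussDiagram.ext
  funext z
  by_cases hz : z ∈ X
  · exact h z hz
  · rw [D.code_nil z hz, E.code_nil z hz]

theorem offStrand_nil : offStrand [] = fun _ => true := by
  funext p
  simp [offStrand]

/-- After `b` is deleted, strand `a` may have lost passages; but their crossings were on `b`, and so
they have already disappeared from all strands. The crossings that remain are those on neither
strand, which makes the order irrelevant. -/
theorem filter_del_del (D : GaussDiagram X) (a b z : L) :
    ((D.code z).filter (offStrand (D.code b))).filter
      (offStrand ((D.code a).filter (offStrand (D.code b)))) =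
    (D.code z).filter (offStrand (D.code a ++ D.code b)) := by
  rw [List.filter_filter]
  apply List.filter_congr
  intro p _
  rw [Bool.eq_iff_iff]
  simp only [offStrand, Bool.and_eq_true, decide_eq_true_eq, List.mem_filter, List.mem_append]
  constructor
  · rintro ⟨h1, h2⟩ q (hq | hq) hqp
    · exact h1 q ⟨hq, fun r hr hrq => h2 r hr (hrq.trans hqp)⟩ hqp
    · exact h2 q hq hqp
  · intro h
    exact ⟨fun q hq => h q (Or.inl hq.1), fun q hq => h q (Or.inr hq)⟩

end GaussDiagram

open GaussDiagram in
-- Nearly all laws hold as equalities of Gauss codes, before passing to the quotient. Only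
-- `union_comm` and `union_assoc` use a move, namely a renaming of crossings, because `unionCode`
-- changes the names of the crossings in an asymmetric way.
theorem wTangles_isMetaMonoid (L : Type*) [DecidableEq L] : IsMetaMonoid (wTangles L) where
  assoc h₁ h₂ h₃ h₄ T := by
    induction T using Quot.ind with | _ D
    have l1 := h₁.labels
    have l2 := h₂.labels
    have l3 := h₃.labels
    have l4 := h₄.labels
    refine congrArg (Quot.mk _) (ext_on fun z hz => ?_)
    simp only [stitch, stitchCode]
    grind
  left_one h₁ h₂ h₃ T := by
    induction T using Quot.ind with | _ D
    have l1 := h₁.labels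
    have l2 := h₂.labels
    have l3 := h₃.labels
    have n1 := D.code_nil
    refine congrArg (Quot.mk _) (ext_on fun z hz => ?_)
    simp only [stitch, stitchCode, one, rename, renameCode]
    grind
  right_one h₁ h₂ h₃ T := by
    induction T using Quot.ind with | _ D
    have l1 := h₁.labels
    have l2 := h₂.labels
    have l3 := h₃.labels
    have n1 := D.code_nil
    refine congrArg (Quot.mk _) (ext_on fun z hz => ?_)
    simp only [stitch, stitchCode, one, rename, renameCode]
    grind
  one_rename h₁ h₂ h₃ T := by
    induction T using Quot.ind with | _ D
    have l1 := h₁.labels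
    have l2 := h₂.labels
    have l3 := h₃.labels
    have n1 := D.code_nil
    refine congrArg (Quot.mk _) (ext_on fun z hz => ?_)
    simp only [one, rename, renameCode]
    grind
  rename_rename h₁ h₂ h₃ T := by
    induction T using Quot.ind with | _ D
    have l1 := h₁.labels
    have l2 := h₂.labels
    have l3 := h₃.labels
    have n1 := D.code_nil
    refine congrArg (Quot.mk _) (ext_on fun z hz => ?_)
    simp only [rename, renameCode]
    grind
  rename_back h₁ h₂ T := by
    induction T using Quot.ind with | _ D
    have l1 := h₁.labels
    have l2 := h₂.labels
    have n1 := D.code_nil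
    refine congrArg (Quot.mk _) (ext_on fun z hz => ?_)
    simp only [rename, renameCode]
    grind
  rename_del h₁ h₂ h₃ T := by
    induction T using Quot.ind with | _ D
    have l1 := h₁.labels
    have l2 := h₂.labels
    have l3 := h₃.labels
    have n1 := D.code_nil
    refine congrArg (Quot.mk _) (ext_on fun z hz => ?_)
    simp only [rename, renameCode, del]
    grind
  one_del h T := by
    induction T using Quot.ind with | _ D
    refine congrArg (Quot.mk _) (ext_on fun z hz => ?_)
    simp only [one, del, D.code_nil _ h.1, offStrand_nil]
    simp
  stitch_rename h₁ h₂ h₃ T := by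
    induction T using Quot.ind with | _ D
    have l1 := h₁.labels
    have l2 := h₂.labels
    have l3 := h₃.labels
    have n1 := D.code_nil
    refine congrArg (Quot.mk _) (ext_on fun z hz => ?_)
    simp only [rename, renameCode, stitch, stitchCode]
    grind
  rename_stitch h₁ h₂ h₃ T := by
    induction T using Quot.ind with | _ D
    have l1 := h₁.labels
    have l2 := h₂.labels
    have l3 := h₃.labels
    have n1 := D.code_nil
    refine congrArg (Quot.mk _) (ext_on fun z hz => ?_)
    simp only [rename, renameCode, stitch, stitchCode]
    grind
  stitch_stitch_comm hd h₁ h₂ h₃ h₄ T := by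
    induction T using Quot.ind with | _ D
    have l1 := h₁.labels
    have l2 := h₂.labels
    have l3 := h₃.labels
    have l4 := h₄.labels
    simp only [Finset.disjoint_left, Finset.mem_insert, Finset.mem_singleton] at hd
    refine congrArg (Quot.mk _) (ext_on fun z hz => ?_)
    simp only [stitch, stitchCode]
    grind
  stitch_one_comm hd h₁ h₂ h₃ h₄ T := by
    induction T using Quot.ind with | _ D
    rfl
  stitch_del_comm {a b c d X Y Y' Z} hd h₁ h₂ h₃ h₄ T := by
    induction T using Quot.ind with | _ D
    simp only [Finset.mem_insert, Finset.mem_singleton, not_or] at hd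
    refine congrArg (Quot.mk _) (ext_on fun z hz => ?_)
    have e : stitchCode a b c D.code d = D.code d := by simp [stitchCode, hd]
    simp only [stitch, del, e]
    simp only [stitchCode]
    split_ifs <;> simp
  stitch_rename_comm hd h₁ h₂ h₃ h₄ T := by
    induction T using Quot.ind with | _ D
    have l1 := h₁.labels
    have l2 := h₂.labels
    have l3 := h₃.labels
    have l4 := h₄.labels
    have n1 := D.code_nil
    simp only [Finset.disjoint_left, Finset.mem_insert, Finset.mem_singleton] at hd
    refine congrArg (Quot.mk _) (ext_on fun z hz => ?_)
    simp only [stitch, stitchCode, rename, renameCode]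
    grind
  one_one_comm hd h₁ h₂ h₃ h₄ T := by
    induction T using Quot.ind with | _ D
    rfl
  one_del_comm hd h₁ h₂ h₃ h₄ T := by
    induction T using Quot.ind with | _ D
    rfl
  one_rename_comm hd h₁ h₂ h₃ h₄ T := by
    induction T using Quot.ind with | _ D
    rfl
  del_del_comm {a b X Y Y' Z} hd h₁ h₂ h₃ h₄ T := by
    induction T using Quot.ind with | _ D
    refine congrArg (Quot.mk _) (ext_on fun z hz => ?_)
    refine (filter_del_del D b a z).trans (Eq.trans ?_ (filter_del_del D a b z).symm)
    rw [offStrand_congr (l' := D.code a ++ D.code b)]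
    intro p
    simp only [List.mem_append]
    tauto
  del_rename_comm {a b c X Y Y' Z} hd h₁ h₂ h₃ h₄ T := by
    induction T using Quot.ind with | _ D
    simp only [Finset.mem_insert, Finset.mem_singleton, not_or] at hd
    refine congrArg (Quot.mk _) (ext_on fun z hz => ?_)
    have e : renameCode b c D.code a = D.code a := by simp [renameCode, hd]
    simp only [rename, del, e]
    simp only [renameCode]
    split_ifs <;> simp
  rename_rename_comm hd h₁ h₂ h₃ h₄ T := by
    induction T using Quot.ind with | _ D
    have l1 := h₁.labels
    have l2 := h₂.labels
    have l3 := h₃.labels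
    have l4 := h₄.labels
    have n1 := D.code_nil
    simp only [Finset.disjoint_left, Finset.mem_insert, Finset.mem_singleton] at hd
    refine congrArg (Quot.mk _) (ext_on fun z hz => ?_)
    simp only [rename, renameCode]
    grind
  union_comm {X Y Z} h₁ h₂ T U := by
    induction T using Quot.ind with | _ D
    induction U using Quot.ind with | _ E
    -- The renaming exchanges `2 * n` and `2 * n + 1`.
    refine Quot.sound (.relabel (fun n => if n % 2 = 0 then n + 1 else n - 1) ?_ ?_)
    · intro m n h
      grind
    · have l := h₁.labels
      funext z
      change unionCode E.code D.code z = List.map _ (unionCode D.code E.code z)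
      simp only [unionCode, List.map_append, List.map_map]
      have e1 : (Pass.relabel fun n => if n % 2 = 0 then n + 1 else n - 1) ∘
          (Pass.relabel fun n => 2 * n) = Pass.relabel fun n => 2 * n + 1 := by
        funext p; simp [Pass.relabel]
      have e2 : (Pass.relabel fun n => if n % 2 = 0 then n + 1 else n - 1) ∘
          (Pass.relabel fun n => 2 * n + 1) = Pass.relabel fun n => 2 * n := by
        funext p; simp [Pass.relabel, Nat.add_mod]
      rw [e1, e2]
      -- Each strand has passages from at most one of the two diagrams, so the order of
      -- concatenation does not matter.
      by_cases hz : z ∈ X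
      · simp [E.code_nil z ((l z).2 hz)]
      · simp [D.code_nil z hz]
  union_assoc h₁ h₂ h₃ h₄ T U V := by
    induction T using Quot.ind with | _ D
    induction U using Quot.ind with | _ E
    induction V using Quot.ind with | _ F
    -- A crossing `n` of the three diagrams is called `4n`, `4n + 2`, `2n + 1` with one bracketing
    -- and `2n`, `4n + 1`, `4n + 3` with the other; the function translates the first names into the
    -- second.
    refine Quot.sound (.relabel (fun n => if n % 2 = 1 then 2 * n + 1 else
      if n % 4 = 0 then n / 2 else n - 1) ?_ ?_)
    · intro m n h
      grind
    · funext z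
      change unionCode D.code (unionCode E.code F.code) z =
        List.map _ (unionCode (unionCode D.code E.code) F.code z)
      simp only [unionCode, List.map_append, List.map_map, List.append_assoc]
      congr 1
      · congr 1
        funext p
        simp only [Pass.relabel, Function.comp]
        grind
      · congr 1
        · congr 1
          funext p
          simp only [Pass.relabel, Function.comp]
          grind
        · congr 1
          funext p
          simp only [Pass.relabel, Function.comp]
          grind
  union_stitch {a b c X X' Y Z Z'} h₁ h₂ h₃ h₄ T U := by
    induction T using Quot.ind with | _ D
    induction U using Quot.ind with | _ E
    have l1 := h₁.labels
    have l2 := h₂.labels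
    have l3 := h₃.labels
    have l4 := h₄.labels
    have ea : E.code a = [] := E.code_nil _ (by grind)
    have eb : E.code b = [] := E.code_nil _ (by grind)
    have ec : E.code c = [] := E.code_nil _ (by grind)
    refine congrArg (Quot.mk _) (ext_on fun z hz => ?_)
    simp only [stitch, stitchCode, union, unionCode]
    by_cases hc : z = c
    · subst hc
      simp [ea, eb, ec]
    · have hab : ¬ (z = a ∨ z = b) := by grind
      simp only [if_neg hc, if_neg hab]
  union_one h₁ h₂ h₃ h₄ T U := by
    induction T using Quot.ind with | _ D
    induction U using Quot.ind with | _ E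
    rfl
  union_del {a X X' Y Z Z'} h₁ h₂ h₃ h₄ T U := by
    induction T using Quot.ind with | _ D
    induction U using Quot.ind with | _ E
    have l1 := h₁.labels
    have l2 := h₂.labels
    have l3 := h₃.labels
    have l4 := h₄.labels
    have ea : E.code a = [] := E.code_nil _ (by grind)
    refine congrArg (Quot.mk _) (ext_on fun z hz => ?_)
    simp only [del, union, unionCode, ea, List.map_nil, List.append_nil, List.filter_append,
      List.filter_map]
    congr 1
    · congr 1
      apply List.filter_congr
      intro p _
      rw [Bool.eq_iff_iff]
      simp only [offStrand, Pass.relabel, Function.comp, decide_eq_true_eq, List.forall_mem_map]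
      exact forall₂_congr fun q _ => by omega
    · congr 1
      apply List.filter_eq_self.2
      intro p _
      simp only [offStrand, Pass.relabel, Function.comp, decide_eq_true_eq, List.forall_mem_map]
      intro q _
      omega
  union_rename {a b X X' Y Z Z'} h₁ h₂ h₃ h₄ T U := by
    induction T using Quot.ind with | _ D
    induction U using Quot.ind with | _ E
    have l1 := h₁.labels
    have l2 := h₂.labels
    have l3 := h₃.labels
    have l4 := h₄.labels
    have ea : E.code a = [] := E.code_nil _ (by grind)
    have eb : E.code b = [] := E.code_nil _ (by grind)
    refine congrArg (Quot.mk _) (ext_on fun z hz => ?_)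
    simp only [rename, renameCode, union, unionCode]
    by_cases hb : z = b
    · subst hb
      simp [ea, eb]
    · have hab : z ≠ a := by grind
      simp only [if_neg hb, if_neg hab]
  stitch_del {a b c X Y Z S} h₁ h₂ h₃ h₄ T := by
    induction T using Quot.ind with | _ D
    have l1 := h₁.labels
    have l2 := h₂.labels
    have l3 := h₃.labels
    have l4 := h₄.labels
    refine congrArg (Quot.mk _) (ext_on fun z hz => ?_)
    refine Eq.trans ?_ (filter_del_del D a b z).symm
    have e : stitchCode a b c D.code c = D.code a ++ D.code b := if_pos rfl
    have ez : stitchCode a b c D.code z = D.code z := by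
      simp only [stitchCode]
      grind
    simp only [stitch, del, e, ez]

/-! ### Arcs -/

section Arcs

variable {L : Type*}

/-- The last crossing under which `l` passes. -/
def lastUnder (l : List Pass) : Option ℕ := (l.filter fun p => !p.2.1).getLast?.map Prod.fst

/-- The arc of the strand `x` at the end of its initial segment `l`: the crossing after which
it starts, or the strand itself. -/
def arc (x : L) (l : List Pass) : L ⊕ ℕ := (lastUnder l).elim (.inl x) .inr

theorem lastUnder_append (l m : List Pass) :
    lastUnder (l ++ m) = (lastUnder m).or (lastUnder l) := by
  simp only [lastUnder, List.filter_append, List.getLast?_append]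
  cases (List.filter (fun p => !p.2.1) m).getLast? <;> simp

theorem lastUnder_over {p : Pass} (hp : p.2.1 = true) : lastUnder [p] = none := by
  simp [lastUnder, hp]

theorem lastUnder_under {p : Pass} (hp : p.2.1 = false) : lastUnder [p] = some p.1 := by
  simp [lastUnder, hp]

theorem lastUnder_mem {l : List Pass} {n : ℕ} (h : lastUnder l = some n) :
    ∃ s, underpass n s ∈ l := by
  simp only [lastUnder, Option.map_eq_some_iff] at h
  obtain ⟨⟨m, b, s⟩, h1, rfl⟩ := h
  have := List.mem_of_getLast? h1
  simp only [List.mem_filter, Bool.not_eq_eq_eq_not, Bool.not_true] at this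
  obtain ⟨h2, rfl⟩ := this
  exact ⟨s, h2⟩

theorem arc_append (x : L) (l m : List Pass) :
    arc x (l ++ m) = (lastUnder m).elim (arc x l) .inr := by
  simp only [arc, lastUnder_append]
  cases lastUnder m <;> simp

theorem arc_append_over (x : L) (l : List Pass) {p : Pass} (hp : p.2.1 = true) :
    arc x (l ++ [p]) = arc x l := by
  simp [arc_append, lastUnder_over hp]

theorem arc_append_under (x : L) (l : List Pass) {p : Pass} (hp : p.2.1 = false) :
    arc x (l ++ [p]) = .inr p.1 := by
  simp [arc_append, lastUnder_under hp]

theorem arc_nil (x : L) : arc x [] = .inl x := rfl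

theorem arc_eq_inr {x : L} {l : List Pass} {n : ℕ} (h : arc x l = .inr n) :
    ∃ s, underpass n s ∈ l := by
  apply lastUnder_mem
  unfold arc at h
  cases hl : lastUnder l with
  | none => simp [hl] at h
  | some m => simpa [hl] using h

theorem arc_eq_inl {x y : L} {l : List Pass} (h : arc x l = .inl y) : y = x := by
  unfold arc at h
  cases hl : lastUnder l with
  | none => simpa [hl] using h.symm
  | some m => simp [hl] at h

/-- The passage `p` is on the strand `x`, which is on the arc `r` just before it. -/
def PassAt (c : L → List Pass) (p : Pass) (x : L) (r : L ⊕ ℕ) : Prop :=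
  ∃ l m, c x = l ++ p :: m ∧ r = arc x l

theorem PassAt.mem {c : L → List Pass} {p : Pass} {x : L} {r : L ⊕ ℕ} (h : PassAt c p x r) :
    p ∈ c x := by
  obtain ⟨l, m, h, -⟩ := h
  simp [h]

theorem exists_passAt {c : L → List Pass} {p : Pass} {x : L} (h : p ∈ c x) :
    ∃ r, PassAt c p x r := by
  obtain ⟨l, m, h⟩ := List.append_of_mem h
  exact ⟨_, l, m, h, rfl⟩

theorem append_cons_inj {α : Type*} {l l' m m' : List α} {p : α} (h : (l ++ p :: m).Nodup)
    (e : l ++ p :: m = l' ++ p :: m') : l = l' := by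
  induction l generalizing l' with
  | nil =>
    cases l' with
    | nil => rfl
    | cons q l' =>
      simp only [List.nil_append, List.cons_append, List.cons.injEq] at e
      obtain ⟨rfl, rfl⟩ := e
      simp at h
  | cons q l ih =>
    cases l' with
    | nil =>
      simp only [List.nil_append, List.cons_append, List.cons.injEq] at e
      obtain ⟨rfl, rfl⟩ := e
      simp at h
    | cons q' l' =>
      simp only [List.cons_append, List.cons.injEq] at e
      rw [e.1, ih (List.nodup_cons.1 h).2 e.2]

/-- A passage occurs only once in the whole code, so it determines its strand and the initial
segment before it, and with that the arc. -/
theorem PassAt.unique {c : L → List Pass} (hc : CodeSimple c) {p : Pass} {x x' : L}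
    {r r' : L ⊕ ℕ} (h : PassAt c p x r) (h' : PassAt c p x' r') : x = x' ∧ r = r' := by
  obtain rfl := hc.2 x x' p h.mem h'.mem
  obtain ⟨l, m, h1, rfl⟩ := h
  obtain ⟨l', m', h1', rfl⟩ := h'
  refine ⟨rfl, congrArg _ (append_cons_inj (h1 ▸ hc.1 x) (h1.symm.trans h1'))⟩

theorem GaussDiagram.pass_unique {X : Finset L} (D : GaussDiagram X) {x y : L} {p q : Pass}
    (hp : p ∈ D.code x) (hq : q ∈ D.code y) (h1 : p.1 = q.1) (h2 : p.2.1 = q.2.1) :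
    p = q ∧ x = y := by
  obtain rfl := D.disj x y p hp q hq h1 h2
  exact ⟨List.inj_on_of_nodup_map (D.nodup x) hp hq (Prod.ext h1 h2), rfl⟩

/-- The crossings of a diagram, with their signs, overstrands, and the arcs before the upper and
the lower passage. -/
structure ArcData (L : Type*) where
  names : Finset ℕ
  sign : ℕ → ℤˣ
  overStrand : ℕ → L
  overArc : ℕ → L ⊕ ℕ
  underArc : ℕ → L ⊕ ℕ

/-- `d` describes the code `c`. -/
structure ArcData.Describes (d : ArcData L) (c : L → List Pass) : Prop where
  mem_names : ∀ x, ∀ p ∈ c x, p.1 ∈ d.names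
  over_at : ∀ n ∈ d.names, PassAt c (overpass n (d.sign n)) (d.overStrand n) (d.overArc n)
  under_at : ∀ n ∈ d.names, ∃ x, PassAt c (underpass n (d.sign n)) x (d.underArc n)

theorem GaussDiagram.exists_over_under {X : Finset L} (D : GaussDiagram X) {x : L} {p : Pass}
    (hp : p ∈ D.code x) :
    (∃ y, overpass p.1 p.2.2 ∈ D.code y) ∧ ∃ y, underpass p.1 p.2.2 ∈ D.code y := by
  obtain ⟨y, hy⟩ := D.pair x p hp
  obtain ⟨n, b, s⟩ := p
  cases b
  · exact ⟨⟨y, hy⟩, ⟨x, hp⟩⟩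
  · exact ⟨⟨x, hp⟩, ⟨y, hy⟩⟩

/-- The fields of `ArcData` are total functions on crossing names, so a default strand is needed for
the names that do not occur. -/
theorem GaussDiagram.exists_describes [Nonempty L] {X : Finset L} (D : GaussDiagram X) :
    ∃ d : ArcData L, d.Describes D.code := by
  classical
  let N : Finset ℕ := X.biUnion fun x => ((D.code x).map Prod.fst).toFinset
  have hN : ∀ n, n ∈ N ↔ ∃ x, ∃ p ∈ D.code x, p.1 = n := by
    intro n
    simp only [N, Finset.mem_biUnion, List.mem_toFinset, List.mem_map]
    constructor
    · rintro ⟨x, -, p, hp, rfl⟩; exact ⟨x, p, hp, rfl⟩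
    · rintro ⟨x, p, hp, rfl⟩
      refine ⟨x, ?_, p, hp, rfl⟩
      by_contra hx
      rw [D.code_nil x hx] at hp
      simp at hp
  have h : ∀ n, ∃ e : ℤˣ × L × (L ⊕ ℕ) × (L ⊕ ℕ), n ∈ N →
      PassAt D.code (overpass n e.1) e.2.1 e.2.2.1 ∧
        ∃ x, PassAt D.code (underpass n e.1) x e.2.2.2 := by
    intro n
    by_cases hn : n ∈ N
    · obtain ⟨x, p, hp, rfl⟩ := (hN n).1 hn
      obtain ⟨⟨y, hy⟩, z, hz⟩ := D.exists_over_under hp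
      obtain ⟨r, hr⟩ := exists_passAt hy
      obtain ⟨r', hr'⟩ := exists_passAt hz
      exact ⟨(_, y, r, r'), fun _ => ⟨hr, z, hr'⟩⟩
    · exact ⟨(1, Classical.arbitrary L, .inr 0, .inr 0), fun h => absurd h hn⟩
  choose e he using h
  exact ⟨⟨N, fun n => (e n).1, fun n => (e n).2.1, fun n => (e n).2.2.1, fun n => (e n).2.2.2⟩,
    fun x p hp => (hN _).2 ⟨x, p, hp, rfl⟩, fun n hn => (he n hn).1, fun n hn => (he n hn).2⟩

/-- Two descriptions of one diagram can differ only at names that do not occur. Quantities that use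
only the names in `names` therefore do not depend on the description. -/
theorem ArcData.Describes.agree {X : Finset L} {D : GaussDiagram X} {d d' : ArcData L}
    (h : d.Describes D.code) (h' : d'.Describes D.code) : d.names = d'.names ∧
      ∀ n ∈ d.names, d.sign n = d'.sign n ∧ d.overStrand n = d'.overStrand n ∧
        d.overArc n = d'.overArc n ∧ d.underArc n = d'.underArc n := by
  have hN : d.names = d'.names := by
    ext n
    exact ⟨fun hn => h'.mem_names _ _ (h.over_at n hn).mem,
      fun hn => h.mem_names _ _ (h'.over_at n hn).mem⟩
  refine ⟨hN, fun n hn => ?_⟩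
  have h1 := h.over_at n hn
  have h1' := h'.over_at n (hN ▸ hn)
  obtain ⟨x, h2⟩ := h.under_at n hn
  obtain ⟨x', h2'⟩ := h'.under_at n (hN ▸ hn)
  have hs : d.sign n = d'.sign n := by
    have := (D.pass_unique h1.mem h1'.mem rfl rfl).1
    simpa [overpass] using this
  rw [hs] at h1 h2
  exact ⟨hs, (h1.unique D.simple h1').1, (h1.unique D.simple h1').2, (h2.unique D.simple h2').2⟩

theorem PassAt.ref_mem {d : ArcData L} {c : L → List Pass} (h : d.Describes c) {p : Pass} {x : L}
    {n : ℕ} (hp : PassAt c p x (.inr n)) : n ∈ d.names := by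
  obtain ⟨l, m, h1, h2⟩ := hp
  obtain ⟨s, hs⟩ := arc_eq_inr h2.symm
  exact h.mem_names x (underpass n s) (by rw [h1]; exact List.mem_append_left _ hs)

theorem ArcData.Describes.over_mem {d : ArcData L} {c : L → List Pass} (h : d.Describes c)
    {n m : ℕ} (hn : n ∈ d.names) (hm : d.overArc n = .inr m) : m ∈ d.names :=
  PassAt.ref_mem h (hm ▸ h.over_at n hn)

theorem ArcData.Describes.under_mem {d : ArcData L} {c : L → List Pass} (h : d.Describes c)
    {n m : ℕ} (hn : n ∈ d.names) (hm : d.underArc n = .inr m) : m ∈ d.names := by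
  obtain ⟨x, hx⟩ := h.under_at n hn
  exact PassAt.ref_mem h (hm ▸ hx)

theorem ArcData.Describes.last_mem {d : ArcData L} {c : L → List Pass} (h : d.Describes c)
    {x : L} {m : ℕ} (hm : arc x (c x) = .inr m) : m ∈ d.names := by
  obtain ⟨s, hs⟩ := arc_eq_inr hm
  exact h.mem_names x _ hs

end Arcs

/-! ### The linear system of a diagram -/

namespace ArcData

variable {L K : Type*} [DecidableEq L] [Field K]

/-- The Alexander weight of a crossing. -/
def wt (d : ArcData L) (w : L → K) (n : ℕ) : K := w (d.overStrand n) ^ (d.sign n : ℤ)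

/-- A coloring of the arcs. -/
def IsColoring (d : ArcData L) (w : L → K) (f : L ⊕ ℕ → K) : Prop :=
  ∀ n ∈ d.names, f (.inr n) = (1 - d.wt w n) * f (d.overArc n) + d.wt w n * f (d.underArc n)

/-- The coefficients of the equations for the colors of the arcs after the crossings. -/
def coeff (d : ArcData L) (w : L → K) (n : ℕ) (r : L ⊕ ℕ) : K :=
  (1 - d.wt w n) * (if d.overArc n = r then 1 else 0) + d.wt w n * (if d.underArc n = r then 1 else 0)

/-- Rows stand for the equations of the crossings, columns for the arcs that start at crossings. The
indices run over all of `ℕ`, so that the blocks of different diagrams can be compared without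
changing types. -/
def matrix (d : ArcData L) (w : L → K) : Matrix ℕ ℕ K :=
  fun n m => (if n = m then 1 else 0) - d.coeff w n (.inr m)

/-- The determinant of the finite block `s` of `A`. -/
def detOn (s : Finset ℕ) (A : Matrix ℕ ℕ K) : K :=
  (A.submatrix (Subtype.val : s → ℕ) Subtype.val).det

/-- The matrix of the linear system of `d`. -/
def block (d : ArcData L) (w : L → K) : Matrix d.names d.names K :=
  (d.matrix w).submatrix Subtype.val Subtype.val

def det (d : ArcData L) (w : L → K) : K := detOn d.names (d.matrix w)

/-- The color of the arc `r`, when the arc at the tail of `x` has color `1` and those at the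
tails of the other strands have color `0`. -/
def color (d : ArcData L) (w : L → K) (x : L) : L ⊕ ℕ → K
  | .inl z => if z = x then 1 else 0
  | .inr n => if h : n ∈ d.names then
      ((d.block w).updateCol ⟨n, h⟩
        fun m => d.coeff w m (.inl x)).det / d.det w else 0

/-- References of `d` to crossings are to crossings of `d`. -/
def Closed (d : ArcData L) : Prop :=
  ∀ n ∈ d.names, ∀ m, d.overArc n = .inr m ∨ d.underArc n = .inr m → m ∈ d.names

theorem Describes.closed {d : ArcData L} {c : L → List Pass} (h : d.Describes c) : d.Closed :=
  fun _ hn _ hm => hm.elim (h.over_mem hn) (h.under_mem hn)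

/-- An arc `r` is either an unknown, picked out by the sum, or a tail, which has no column; the
subtracted term accounts for the second case. -/
theorem sum_ref {s : Finset ℕ} (f : L ⊕ ℕ → K) {r : L ⊕ ℕ} (hr : ∀ m, r = .inr m → m ∈ s) :
    ∑ m : s, (if r = .inr (m : ℕ) then (1 : K) else 0) * f (.inr m) =
      f r - Sum.elim (fun z => f (.inl z)) (fun _ => 0) r := by
  rcases r with z | n
  · simp
  · have := hr n rfl
    rw [Finset.sum_eq_single (⟨n, this⟩ : s)]
    · simp
    · rintro ⟨m, hm⟩ - hne
      rw [if_neg, zero_mul]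
      intro e
      exact hne (Subtype.ext (Sum.inr.inj e).symm)
    · simp

/-- The product is the defect of `f` from being a coloring plus the contribution of the tails. Thus
`f` is a coloring exactly when its unknown colors solve the inhomogeneous system whose right-hand
side comes from the tails. -/
theorem mulVec_matrix {d : ArcData L} (hd : d.Closed) (w : L → K) (f : L ⊕ ℕ → K)
    (n : d.names) :
    (d.block w).mulVec (fun m => f (.inr m)) n =
      f (.inr n) - ((1 - d.wt w n) * f (d.overArc n) + d.wt w n * f (d.underArc n)) +
      ((1 - d.wt w n) * Sum.elim (fun z => f (.inl z)) (fun _ => 0) (d.overArc n) +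
        d.wt w n * Sum.elim (fun z => f (.inl z)) (fun _ => 0) (d.underArc n)) := by
  have h1 := sum_ref f (s := d.names) (r := d.overArc n) fun m hm => hd n n.2 m (Or.inl hm)
  have h2 := sum_ref f (s := d.names) (r := d.underArc n) fun m hm => hd n n.2 m (Or.inr hm)
  have h3 : ∑ m : d.names, (if (n : ℕ) = m then (1 : K) else 0) * f (.inr m) = f (.inr n) := by
    rw [Finset.sum_eq_single n]
    · simp
    · intro m _ hne
      rw [if_neg, zero_mul]
      exact fun e => hne (Subtype.ext e.symm)
    · simp
  have : (d.block w).mulVec (fun m => f (.inr m)) n =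
      ∑ m : d.names, (if (n : ℕ) = m then (1 : K) else 0) * f (.inr m) -
      ((1 - d.wt w n) * ∑ m : d.names, (if d.overArc n = .inr (m : ℕ) then (1 : K) else 0) * f (.inr m) +
      d.wt w n * ∑ m : d.names, (if d.underArc n = .inr (m : ℕ) then (1 : K) else 0) * f (.inr m)) := by
    rw [Finset.mul_sum, Finset.mul_sum, ← Finset.sum_add_distrib, ← Finset.sum_sub_distrib]
    refine Finset.sum_congr rfl fun m _ => ?_
    simp only [block, Matrix.submatrix_apply, matrix, coeff]
    ring
  rw [this, h1, h2, h3]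
  ring

/-- A coloring is determined by the colors at the tails of the strands. -/
theorem IsColoring.unique {d : ArcData L} (hd : d.Closed) {w : L → K} (h0 : d.det w ≠ 0)
    {f g : L ⊕ ℕ → K} (hf : d.IsColoring w f) (hg : d.IsColoring w g)
    (h : ∀ z, f (.inl z) = g (.inl z)) {r : L ⊕ ℕ} (hr : ∀ m, r = .inr m → m ∈ d.names) :
    f r = g r := by
  rcases r with z | n
  · exact h z
  have hn := hr n rfl
  -- The difference of the two colorings has color `0` at all tails, so it lies in the kernel of
  -- `block`.
  have key : (fun m : d.names => f (.inr m) - g (.inr m)) = 0 := by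
    apply Matrix.eq_zero_of_mulVec_eq_zero h0
    funext m
    refine (mulVec_matrix hd w (fun r => f r - g r) m).trans ?_
    simp only [hf m m.2, hg m m.2, h, sub_self, Pi.zero_apply]
    have : ∀ r : L ⊕ ℕ, Sum.elim (fun _ : L => (0 : K)) (fun _ => 0) r = 0 := by
      rintro (z | z) <;> rfl
    rw [this, this]
    ring
  exact sub_eq_zero.1 (congrFun key ⟨n, hn⟩)

/-- Cramer's rule: the determinants in the definition of `color` form the vector `cramer`, which
`block` sends to `det` times the column of the tail of `x`. -/
theorem isColoring_color {d : ArcData L} (hd : d.Closed) {w : L → K} (h0 : d.det w ≠ 0) (x : L) :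
    d.IsColoring w (d.color w x) := by
  intro n hn
  have h1 := mulVec_matrix hd w (d.color w x) ⟨n, hn⟩
  have h2 : (fun m : d.names => d.color w x (.inr m)) = (d.det w)⁻¹ •
      (d.block w).cramer
        (fun m : d.names => d.coeff w m (.inl x)) := by
    funext m
    simp only [color, m.2, dif_pos, Pi.smul_apply, Matrix.cramer_apply, smul_eq_mul]
    rw [div_eq_inv_mul]
  rw [h2, Matrix.mulVec_smul, Matrix.mulVec_cramer] at h1
  have h3 : (d.block w).det = d.det w := rfl
  rw [h3, smul_smul, inv_mul_cancel₀ h0, one_smul] at h1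
  have h4 : ∀ r : L ⊕ ℕ, Sum.elim (fun z => d.color w x (.inl z)) (fun _ => 0) r =
      if r = .inl x then 1 else 0 := by
    rintro (z | z)
    · simp [color]
    · simp
  rw [h4, h4] at h1
  simp only [coeff] at h1
  linear_combination -h1

theorem color_inl (d : ArcData L) (w : L → K) (x z : L) :
    d.color w x (.inl z) = if z = x then 1 else 0 := rfl

/-- Colorings depend linearly on the colors at the tails. -/
theorem IsColoring.add {d : ArcData L} {w : L → K} {f g : L ⊕ ℕ → K} (hf : d.IsColoring w f)
    (hg : d.IsColoring w g) (c : K) : d.IsColoring w fun r => f r + c * g r := by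
  intro n hn
  simp only [hf n hn, hg n hn]
  ring

theorem color_eq_of_isColoring {d : ArcData L} (hd : d.Closed) {w : L → K} (h0 : d.det w ≠ 0)
    {x : L} {f : L ⊕ ℕ → K} (hf : d.IsColoring w f)
    (h : ∀ z, f (.inl z) = if z = x then 1 else 0) {r : L ⊕ ℕ}
    (hr : ∀ m, r = .inr m → m ∈ d.names) : d.color w x r = f r :=
  (isColoring_color hd h0 x).unique hd h0 hf (fun z => (h z).symm) hr

theorem det_congr {d d' : ArcData L} {w w' : L → K} (hN : d.names = d'.names)
    (h : ∀ n ∈ d.names, d.wt w n = d'.wt w' n ∧ d.overArc n = d'.overArc n ∧ d.underArc n = d'.underArc n) :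
    d.det w = d'.det w' := by
  unfold det
  rw [← hN]
  unfold detOn
  congr 1
  ext n m
  obtain ⟨h1, h2, h3⟩ := h n n.2
  simp only [Matrix.submatrix_apply, matrix, coeff, h1, h2, h3]

/-- The quotients of determinants need not be compared: the color of `d'` is a coloring for `d` with
the same tails, and such a coloring is unique. -/
theorem color_congr {d d' : ArcData L} (hd : d.Closed) (hd' : d'.Closed) {w w' : L → K}
    (h0 : d.det w ≠ 0) (hN : d.names = d'.names)
    (h : ∀ n ∈ d.names, d.wt w n = d'.wt w' n ∧ d.overArc n = d'.overArc n ∧ d.underArc n = d'.underArc n)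
    (x : L) {r : L ⊕ ℕ} (hr : ∀ m, r = .inr m → m ∈ d.names) : d.color w x r = d'.color w' x r := by
  have h0' : d'.det w' ≠ 0 := det_congr hN h ▸ h0
  refine color_eq_of_isColoring hd h0 (f := d'.color w' x) ?_ (fun z => rfl) hr
  intro n hn
  obtain ⟨h1, h2, h3⟩ := h n hn
  rw [isColoring_color hd' h0' x n (hN ▸ hn), h1, h2, h3]

end ArcData

/-! ### Colorings at `t = 1`, and the nonvanishing of the determinant -/

namespace ArcData

variable {L K : Type*} [DecidableEq L] [Field K] {X Y Z : Finset L}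

/-- When all weights are `1`, the equation at a crossing says that the lower strand keeps its color.
Induction along the strand carries the color of the tail to every arc on it. -/
theorem Describes.eq_of_isColoring_one {D : GaussDiagram X} {d : ArcData L}
    (h : d.Describes D.code) {f : L ⊕ ℕ → K} (hf : d.IsColoring (fun _ => 1) f) {x : L}
    {l m : List Pass} (hl : D.code x = l ++ m) : f (arc x l) = f (.inl x) := by
  induction l using List.reverseRecOn generalizing m with
  | nil => rfl
  | append_singleton l p ih =>
    have hl' : D.code x = l ++ p :: m := by simpa using hl
    by_cases hp : p.2.1 = true
    · rw [arc_append_over x l hp]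
      exact ih hl'
    · rw [Bool.not_eq_true] at hp
      rw [arc_append_under x l hp, ← ih hl']
      have hmem : p ∈ D.code x := by rw [hl']; simp
      have hn := h.mem_names x p hmem
      obtain ⟨y, hy⟩ := h.under_at p.1 hn
      obtain ⟨ep, rfl⟩ := D.pass_unique hmem hy.mem rfl hp
      rw [← ep] at hy
      obtain ⟨-, e⟩ := hy.unique D.simple ⟨l, m, hl', rfl⟩
      rw [hf p.1 hn, e]
      simp [wt]

/-- A vector in the kernel is a coloring with color `0` at all tails. At `t = 1` colors are constant
along strands, and every unknown is the color of the arc that follows some underpass, so the vector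
is zero. -/
theorem Describes.det_one_ne_zero {D : GaussDiagram X} {d : ArcData L} (h : d.Describes D.code) :
    d.det (fun _ => (1 : K)) ≠ 0 := by
  intro h0
  obtain ⟨v, hv, hv0⟩ := Matrix.exists_mulVec_eq_zero_iff.2 h0
  let f : L ⊕ ℕ → K := Sum.elim (fun _ => 0) fun n => if hn : n ∈ d.names then v ⟨n, hn⟩ else 0
  have hfv : (fun m : d.names => f (.inr m)) = v := by
    funext m
    simp [f, m.2]
  have hinl : ∀ r : L ⊕ ℕ, Sum.elim (fun z => f (.inl z)) (fun _ => (0 : K)) r = 0 := by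
    rintro (z | z) <;> rfl
  have hf : d.IsColoring (fun _ => 1) f := by
    intro n hn
    have := mulVec_matrix h.closed (fun _ => 1) f ⟨n, hn⟩
    rw [hfv, hinl, hinl] at this
    have h2 : (d.block fun _ => (1 : K)).mulVec v ⟨n, hn⟩ = 0 := congrFun hv0 _
    rw [h2] at this
    linear_combination -this
  apply hv
  funext n
  rw [← hfv]
  obtain ⟨x, l, m, h1, -⟩ := h.under_at n n.2
  have h2 : D.code x = (l ++ [underpass n (d.sign n)]) ++ m := by simpa using h1
  have := h.eq_of_isColoring_one hf h2
  rw [arc_append_under x l rfl] at this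
  exact this

section Substitution

variable {w : L → RatField Z}

theorem Describes.overStrand_mem {D : GaussDiagram X} {d : ArcData L} (h : d.Describes D.code)
    {n : ℕ} (hn : n ∈ d.names) : d.overStrand n ∈ X := by
  by_contra hx
  have := (h.over_at n hn).mem
  rw [D.code_nil _ hx] at this
  simp at this

theorem substTo_wt {K : Type*} [Field K] [Algebra ℚ K] {d : ArcData L} {v : X → K}
    {w : L → K} (hv : ∀ i : X, v i = w i) (hw : ∀ i, w i ≠ 0) {n : ℕ} (hn : d.overStrand n ∈ X) :
    SubstTo v (d.wt (weight X) n) (d.wt w n) := by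
  refine SubstTo.zpow_units ?_ (hw _) _
  have := SubstTo.poly (v := v) (MvPolynomial.X ⟨d.overStrand n, hn⟩)
  rw [MvPolynomial.aeval_X, hv] at this
  rwa [weight, dif_pos hn]

theorem substTo_ite {σ K : Type*} [Field K] [Algebra ℚ K] {v : σ → K} (p : Prop) [Decidable p] :
    SubstTo v (if p then 1 else 0) (if p then 1 else 0) := by
  split_ifs
  · exact SubstTo.one
  · exact SubstTo.zero

theorem Describes.substTo_coeff {K : Type*} [Field K] [Algebra ℚ K] {D : GaussDiagram X}
    {d : ArcData L} (h : d.Describes D.code) {v : X → K}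
    {w : L → K} (hv : ∀ i : X, v i = w i) (hw : ∀ i, w i ≠ 0) {n : ℕ} (hn : n ∈ d.names)
    (r : L ⊕ ℕ) : SubstTo v (d.coeff (weight X) n r) (d.coeff w n r) := by
  have := substTo_wt hv hw (h.overStrand_mem hn)
  exact ((SubstTo.one.sub this).mul (substTo_ite _)).add (this.mul (substTo_ite _))

theorem Describes.substTo_matrix {K : Type*} [Field K] [Algebra ℚ K] {D : GaussDiagram X}
    {d : ArcData L} (h : d.Describes D.code) {v : X → K}
    {w : L → K} (hv : ∀ i : X, v i = w i) (hw : ∀ i, w i ≠ 0) {n : ℕ} (hn : n ∈ d.names) (m : ℕ) :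
    SubstTo v (d.matrix (weight X) n m) (d.matrix w n m) :=
  (substTo_ite _).sub (h.substTo_coeff hv hw hn _)

theorem Describes.substTo_det {K : Type*} [Field K] [Algebra ℚ K] {D : GaussDiagram X}
    {d : ArcData L} (h : d.Describes D.code) {v : X → K}
    {w : L → K} (hv : ∀ i : X, v i = w i) (hw : ∀ i, w i ≠ 0) :
    SubstTo v (d.det (weight X)) (d.det w) :=
  SubstTo.det fun i j => h.substTo_matrix hv hw i.2 j

theorem Describes.substTo_color {K : Type*} [Field K] [Algebra ℚ K] {D : GaussDiagram X}
    {d : ArcData L} (h : d.Describes D.code) {v : X → K}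
    {w : L → K} (hv : ∀ i : X, v i = w i) (hw : ∀ i, w i ≠ 0) (h0 : d.det w ≠ 0) (x : L)
    (r : L ⊕ ℕ) : SubstTo v (d.color (weight X) x r) (d.color w x r) := by
  rcases r with z | n
  · exact substTo_ite _
  · simp only [color]
    split_ifs with hn
    · refine SubstTo.div (SubstTo.det fun i j => ?_) (h.substTo_det hv hw) h0
      simp only [Matrix.updateCol_apply]
      split_ifs
      · exact h.substTo_coeff hv hw i.2 _
      · exact h.substTo_matrix hv hw i.2 _
    · exact SubstTo.zero

/-- Setting the remaining variables to `1` turns all weights into `1`, and there the determinant is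
nonzero. -/
theorem Describes.det_ne_zero {D : GaussDiagram X} {d : ArcData L} (h : d.Describes D.code)
    (hw : UnitalAtOne w) : d.det w ≠ 0 := by
  have h1 : ValueAtOne (d.det w) (d.det fun _ => (1 : ℚ)) := by
    refine SubstTo.det fun i j => (substTo_ite _).sub ?_
    have hT : SubstTo (fun _ : Z => (1 : ℚ)) (d.wt w i) (d.wt (fun _ => 1) i) :=
      SubstTo.zpow_units (hw _) one_ne_zero _
    exact ((SubstTo.one.sub hT).mul (substTo_ite _)).add (hT.mul (substTo_ite _))
  exact h1.ne_zero h.det_one_ne_zero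

theorem Describes.color_one {D : GaussDiagram X} {d : ArcData L} (h : d.Describes D.code)
    (x y : L) : d.color (fun _ => (1 : K)) x (arc y (D.code y)) = if y = x then 1 else 0 :=
  h.eq_of_isColoring_one (isColoring_color h.closed h.det_one_ne_zero x) (List.append_nil _).symm

end Substitution

end ArcData

/-! ### The element of `Γ` that belongs to a Gauss diagram -/

namespace GaussDiagram

variable {L : Type*} [DecidableEq L] [Nonempty L] {X Y Z : Finset L}

/-- A description of `D`. -/
noncomputable def arcData (D : GaussDiagram X) : ArcData L := D.exists_describes.choose

theorem describes_arcData (D : GaussDiagram X) : D.arcData.Describes D.code :=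
  D.exists_describes.choose_spec

/-- The element of `Γ` that belongs to a Gauss diagram. -/
noncomputable def gamma (D : GaussDiagram X) : Gamma X where
  scalar := D.arcData.det (weight X)
  mat i j := D.arcData.color (weight X) i (arc (j : L) (D.code j))
  scalar_regular := ⟨_, D.describes_arcData.substTo_det (w := fun _ => (1 : ℚ)) (fun _ => rfl)
    fun _ => one_ne_zero⟩
  mat_one i j := by
    have := D.describes_arcData.substTo_color (v := fun _ => (1 : ℚ)) (fun _ => rfl)
      (fun _ => one_ne_zero) D.describes_arcData.det_one_ne_zero i (arc (j : L) (D.code j))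
    rw [D.describes_arcData.color_one] at this
    simp only [eq_comm (a := (j : L)), Subtype.coe_inj] at this
    exact this

variable {w : L → RatField Z}

/-- The definition of `gamma` chooses some description. By `agree` any other description gives the
same value, and in each application below one is taken that suits the diagram. -/
theorem scalarAt_gamma {D : GaussDiagram X} {d : ArcData L} (h : d.Describes D.code)
    (hw : UnitalAtOne w) : D.gamma.scalarAt w = d.det w := by
  have h1 := D.describes_arcData
  obtain ⟨h2, h3⟩ := h1.agree h
  refine (h1.substTo_det (v := fun k : X => w k) (fun _ => rfl) hw.ne_zero).substRat_eq.trans ?_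
  refine ArcData.det_congr h2 fun n hn => ?_
  obtain ⟨e1, e2, e3, e4⟩ := h3 n hn
  exact ⟨by simp only [ArcData.wt, e1, e2], e3, e4⟩

theorem matAt_gamma {D : GaussDiagram X} {d : ArcData L} (h : d.Describes D.code)
    (hw : UnitalAtOne w) {i j : L} (hi : i ∈ X) (hj : j ∈ X) :
    D.gamma.matAt w i j = d.color w i (arc j (D.code j)) := by
  have h1 := D.describes_arcData
  obtain ⟨h2, h3⟩ := h1.agree h
  rw [Gamma.matAt_of_mem _ _ hi hj]
  refine (h1.substTo_color (v := fun k : X => w k) (fun _ => rfl) hw.ne_zero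
    (h1.det_ne_zero hw) _ _).substRat_eq.trans ?_
  refine ArcData.color_congr h1.closed h.closed (h1.det_ne_zero hw) h2 (fun n hn => ?_) _
    fun m hm => h1.last_mem hm
  obtain ⟨e1, e2, e3, e4⟩ := h3 n hn
  exact ⟨by simp only [ArcData.wt, e1, e2], e3, e4⟩

/-- To prove that a diagram has a certain value in `Γ`, it is enough to find its determinant,
and colorings with the right colors at the heads of the strands. -/
theorem gamma_eq {D : GaussDiagram X} {d : ArcData L} (h : d.Describes D.code) {T : Gamma X}
    (hs : ∀ w : L → RatField X, UnitalAtOne w → d.det w = T.scalarAt w)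
    (hm : ∀ w : L → RatField X, UnitalAtOne w → ∀ i ∈ X, ∃ f : L ⊕ ℕ → RatField X,
      d.IsColoring w f ∧ (∀ z, f (.inl z) = if z = i then 1 else 0) ∧
      ∀ j ∈ X, f (arc j (D.code j)) = T.matAt w i j) : D.gamma = T := by
  refine Gamma.ext_at (fun w hw => ?_) (fun w hw i hi j hj => ?_)
  · rw [scalarAt_gamma h hw, hs w hw]
  · obtain ⟨f, h1, h2, h3⟩ := hm w hw i hi
    rw [matAt_gamma h hw hi hj, ← h3 j hj]
    exact ArcData.color_eq_of_isColoring h.closed (h.det_ne_zero hw) h1 h2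
      fun m hm => h.last_mem hm

end GaussDiagram

/-! ### The invariant under stitching and under adding a strand -/

theorem Matrix.det_sub_mulVec_mul {n K : Type*} [Fintype n] [DecidableEq n] [CommRing K]
    (A : Matrix n n K) (x v : n → K) :
    (Matrix.of fun i j => A i j - (A.mulVec x) i * v j).det = A.det * (1 - v ⬝ᵥ x) := by
  -- The matrix determinant lemma: a perturbation of rank one whose column is `A x` factors as `A *
  -- (1 - x vᵀ)`, so no inverse of `A` is needed.
  have e : (Matrix.of fun i j => A i j - (A.mulVec x) i * v j) =
      A * (1 + Matrix.replicateCol Unit x * Matrix.replicateRow Unit (-v)) := by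
    rw [Matrix.mul_add, Matrix.mul_one, ← Matrix.mul_assoc]
    ext i j
    simp [Matrix.mul_apply, Matrix.mulVec, dotProduct, sub_eq_add_neg]
  rw [e, Matrix.det_mul, Matrix.det_one_add_replicateCol_mul_replicateRow]
  simp [sub_eq_add_neg]

namespace ArcData

variable {L K : Type*} [DecidableEq L] [Field K] {X Y Z : Finset L}

theorem _root_.PassAt.mem_label {D : GaussDiagram X} {p : Pass} {x : L} {r : L ⊕ ℕ}
    (h : PassAt D.code p x r) : x ∈ X := by
  by_contra hx
  have := h.mem
  rw [D.code_nil _ hx] at this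
  simp at this

theorem _root_.PassAt.eq_of_inl {c : L → List Pass} {p : Pass} {x z : L}
    (h : PassAt c p x (.inl z)) : z = x := by
  obtain ⟨l, m, -, h2⟩ := h
  exact arc_eq_inl h2.symm

theorem Describes.code_ne_nil_of_inl {c : L → List Pass} {d : ArcData L} (h : d.Describes c)
    {n : ℕ} (hn : n ∈ d.names) {z : L} (hz : d.overArc n = .inl z ∨ d.underArc n = .inl z) :
    c z ≠ [] := by
  rcases hz with hz | hz
  · have h1 := h.over_at n hn
    have := (hz ▸ h1).eq_of_inl
    exact List.ne_nil_of_mem (this ▸ h1.mem)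
  · obtain ⟨x, h1⟩ := h.under_at n hn
    have := (hz ▸ h1).eq_of_inl
    exact List.ne_nil_of_mem (this ▸ h1.mem)

theorem Describes.mem_of_inl {D : GaussDiagram X} {d : ArcData L} (h : d.Describes D.code)
    {n : ℕ} (hn : n ∈ d.names) {z : L} (hz : d.overArc n = .inl z ∨ d.underArc n = .inl z) :
    z ∈ X := by
  by_contra hx
  exact h.code_ne_nil_of_inl hn hz (D.code_nil z hx)

/-- This writes the column of a tail as the image of a color vector, which is the form required by
`Matrix.det_sub_mulVec_mul`. -/
theorem block_mulVec_color {d : ArcData L} (hd : d.Closed) {w : L → K} (h0 : d.det w ≠ 0) (x : L) :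
    (d.block w).mulVec (fun n => d.color w x (.inr n)) =
      fun n : d.names => d.coeff w n (.inl x) := by
  funext n
  rw [mulVec_matrix hd w (d.color w x), isColoring_color hd h0 x n n.2, sub_self, zero_add]
  have h4 : ∀ r : L ⊕ ℕ, Sum.elim (fun z => d.color w x (.inl z)) (fun _ => 0) r =
      if r = .inl x then 1 else 0 := by
    rintro (z | z)
    · simp [color]
    · simp
  rw [h4, h4, coeff]

/-- The arc of the stitched diagram to which an arc of the diagram belongs; `r` is the arc at
the head of `a`. -/
def stitchArc (a b c : L) (r : L ⊕ ℕ) : L ⊕ ℕ → L ⊕ ℕ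
  | .inl z => if z = b then r.elim (fun _ => .inl c) .inr else if z = a then .inl c else .inl z
  | .inr n => .inr n

/-- The description of a stitched diagram. -/
def stitch (a b c : L) (r : L ⊕ ℕ) (d : ArcData L) : ArcData L where
  names := d.names
  sign := d.sign
  overStrand n := GaussDiagram.newStrand a b c (d.overStrand n)
  overArc n := stitchArc a b c r (d.overArc n)
  underArc n := stitchArc a b c r (d.underArc n)

theorem arc_stitch_right (a b c : L) (l m : List Pass) :
    arc c (l ++ m) = stitchArc a b c (arc a l) (arc b m) := by
  rw [arc_append]
  unfold arc
  cases lastUnder m <;> cases lastUnder l <;> simp [stitchArc]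

theorem arc_stitch_left {a b : L} (hab : a ≠ b) (c : L) (r : L ⊕ ℕ) (l : List Pass) :
    arc c l = stitchArc a b c r (arc a l) := by
  unfold arc
  cases lastUnder l <;> simp [stitchArc, hab]

theorem arc_stitch_rest {a b x : L} (ha : x ≠ a) (hb : x ≠ b) (c : L) (r : L ⊕ ℕ)
    (l : List Pass) : arc x l = stitchArc a b c r (arc x l) := by
  unfold arc
  cases lastUnder l <;> simp [stitchArc, ha, hb]

theorem _root_.PassAt.stitch {a b c : L} (h : Stitches a b c X Y) {D : GaussDiagram X} {p : Pass}
    {x : L} {r : L ⊕ ℕ} (hp : PassAt D.code p x r) :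
    PassAt (GaussDiagram.stitch h D).code p (GaussDiagram.newStrand a b c x)
      (stitchArc a b c (arc a (D.code a)) r) := by
  have hx := hp.mem_label
  obtain ⟨l, m, h1, rfl⟩ := hp
  change PassAt (GaussDiagram.stitchCode a b c D.code) _ _ _
  by_cases hxa : x = a
  · subst hxa
    refine ⟨l, m ++ D.code b, ?_, ?_⟩
    · simp [GaussDiagram.stitchCode, GaussDiagram.newStrand, h1]
    · rw [← arc_stitch_left h.ne]
      simp [GaussDiagram.newStrand]
  by_cases hxb : x = b
  · subst hxb
    refine ⟨D.code a ++ l, m, ?_, ?_⟩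
    · simp [GaussDiagram.stitchCode, GaussDiagram.newStrand, h1]
    · rw [← arc_stitch_right]
      simp [GaussDiagram.newStrand]
  have hxc := (h.mem_rest hx hxa hxb).2
  refine ⟨l, m, ?_, ?_⟩
  · simp [GaussDiagram.stitchCode, GaussDiagram.newStrand, hxa, hxb, hxc, h1]
  · rw [← arc_stitch_rest hxa hxb]
    simp [GaussDiagram.newStrand, hxa, hxb]

theorem Describes.stitch {a b c : L} (h : Stitches a b c X Y) {D : GaussDiagram X} {d : ArcData L}
    (hd : d.Describes D.code) :
    (d.stitch a b c (arc a (D.code a))).Describes (GaussDiagram.stitch h D).code where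
  mem_names x p hp := by
    obtain ⟨y, hy, -⟩ := (GaussDiagram.mem_stitchCode h D.code_nil x p).1 hp
    exact hd.mem_names y p hy
  over_at n hn := (hd.over_at n hn).stitch h
  under_at n hn := by
    obtain ⟨x, hx⟩ := hd.under_at n hn
    exact ⟨_, hx.stitch h⟩

theorem arc_code_stitch {a b c : L} (h : Stitches a b c X Y) (D : GaussDiagram X) {j : L}
    (hj : j ∈ Y) : arc j ((GaussDiagram.stitch h D).code j) =
      stitchArc a b c (arc a (D.code a))
        (arc (Gamma.oldRow b c j) (D.code (Gamma.oldRow b c j))) := by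
  change arc j (GaussDiagram.stitchCode a b c D.code j) = _
  by_cases hc : j = c
  · subst hc
    rw [Gamma.oldRow, if_pos rfl, ← arc_stitch_right, GaussDiagram.stitchCode, if_pos rfl]
  · obtain ⟨-, h1, h2⟩ := h.mem_old hj hc
    rw [Gamma.oldRow, if_neg hc, ← arc_stitch_rest h1 h2]
    simp [GaussDiagram.stitchCode, hc, h1, h2]

/-- The tail of `b` is the only tail that can turn into an arc starting at a crossing: it continues
the arc `r` at the head of `a`. -/
theorem stitchArc_eq_inr {a b c : L} {r s : L ⊕ ℕ} {m : ℕ} :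
    (if stitchArc a b c r s = .inr m then (1 : K) else 0) =
      (if s = .inr m then 1 else 0) + (if s = .inl b then 1 else 0) * (if r = .inr m then 1 else 0) := by
  rcases s with z | n
  · by_cases hb : z = b
    · subst hb
      rcases r with z' | n' <;> simp [stitchArc]
    · have e : stitchArc a b c r (.inl z) = .inl (if z = a then c else z) := by
        simp only [stitchArc, if_neg hb]
        split_ifs <;> rfl
      simp [e, hb]
  · simp [stitchArc]

theorem coeff_stitch (a b c : L) (r : L ⊕ ℕ) (d : ArcData L) (w : L → K) (n m : ℕ) :
    (d.stitch a b c r).coeff w n (.inr m) =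
      d.coeff (w ∘ GaussDiagram.newStrand a b c) n (.inr m) +
        d.coeff (w ∘ GaussDiagram.newStrand a b c) n (.inl b) * (if r = .inr m then 1 else 0) := by
  change (1 - d.wt (w ∘ GaussDiagram.newStrand a b c) n) *
      (if stitchArc a b c r (d.overArc n) = .inr m then 1 else 0) +
    d.wt (w ∘ GaussDiagram.newStrand a b c) n *
      (if stitchArc a b c r (d.underArc n) = .inr m then 1 else 0) = _
  rw [stitchArc_eq_inr, stitchArc_eq_inr, coeff, coeff]
  ring

/-- References to the tail of `b` become references to the last arc of `a`. So the column of that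
tail, which is the image of the color vector for `b`, is subtracted from the column of that arc.
This change of rank one multiplies the determinant by `1` minus the color of the head of `a`. -/
theorem det_stitch {a b c : L} (hab : a ≠ b) {D : GaussDiagram X} {d : ArcData L}
    (hd : d.Describes D.code) {w : L → K}
    (h0 : d.det (w ∘ GaussDiagram.newStrand a b c) ≠ 0) :
    (d.stitch a b c (arc a (D.code a))).det w =
      (1 - d.color (w ∘ GaussDiagram.newStrand a b c) b (arc a (D.code a))) *
        d.det (w ∘ GaussDiagram.newStrand a b c) := by
  have key := Matrix.det_sub_mulVec_mul (d.block (w ∘ GaussDiagram.newStrand a b c))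
    (fun n => d.color (w ∘ GaussDiagram.newStrand a b c) b (.inr n))
    (fun n => if arc a (D.code a) = .inr (n : ℕ) then 1 else 0)
  rw [block_mulVec_color hd.closed h0] at key
  -- If `a` has no underpass, its last arc is its tail: the indicator vector is zero, and so is the
  -- color of the tail of `a`, since `a ≠ b`.
  have e1 : (fun n : d.names => if arc a (D.code a) = .inr (n : ℕ) then (1 : K) else 0) ⬝ᵥ
      (fun n : d.names => d.color (w ∘ GaussDiagram.newStrand a b c) b (.inr n)) =
      d.color (w ∘ GaussDiagram.newStrand a b c) b (arc a (D.code a)) := by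
    have h1 := sum_ref (d.color (w ∘ GaussDiagram.newStrand a b c) b) (s := d.names)
      (r := arc a (D.code a)) fun m hm => hd.last_mem hm
    rw [dotProduct, h1]
    rcases hr : arc a (D.code a) with z | n
    · obtain rfl := arc_eq_inl hr
      simp [color_inl, hab]
    · simp
  rw [e1] at key
  rw [mul_comm]
  refine Eq.trans ?_ key
  unfold det detOn
  congr 1
  ext n m
  change (if (n : ℕ) = m then (1 : K) else 0) - (d.stitch a b c _).coeff w n (.inr m) =
    ((if (n : ℕ) = m then (1 : K) else 0) - d.coeff _ n (.inr m)) - _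
  rw [coeff_stitch, ← sub_sub]

/-- Superpose the coloring for the old tail of `i` and `k` times the coloring for the tail of `b`.
The colors at the head of `a` and at the tail of `b` agree if and only if `k * (1 - M b a) = M i a`.
With this `k` the superposition descends to the stitched diagram, and its colors at the heads are
given by `feedback`. -/
theorem exists_isColoring_stitch {a b c : L} (h : Stitches a b c X Y) {D : GaussDiagram X}
    {d : ArcData L} (hd : d.Describes D.code) {w : L → K}
    (h0 : d.det (w ∘ GaussDiagram.newStrand a b c) ≠ 0)
    (h1 : 1 - d.color (w ∘ GaussDiagram.newStrand a b c) b (arc a (D.code a)) ≠ 0)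
    {i : L} (hi : i ∈ Y) : ∃ f : L ⊕ ℕ → K,
      (d.stitch a b c (arc a (D.code a))).IsColoring w f ∧
      (∀ z, f (.inl z) = if z = i then 1 else 0) ∧
      ∀ j ∈ Y, f (arc j ((GaussDiagram.stitch h D).code j)) = Gamma.feedback a b
        (fun i j => d.color (w ∘ GaussDiagram.newStrand a b c) i (arc j (D.code j)))
        (Gamma.oldRow a c i) (Gamma.oldRow b c j) := by
  have hl := h.labels
  set w' := w ∘ GaussDiagram.newStrand a b c
  set k := d.color w' (Gamma.oldRow a c i) (arc a (D.code a)) /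
    (1 - d.color w' b (arc a (D.code a))) with hk
  set F : L ⊕ ℕ → K := fun r => d.color w' (Gamma.oldRow a c i) r + k * d.color w' b r with hF
  have hFc : d.IsColoring w' F :=
    (isColoring_color hd.closed h0 _).add (isColoring_color hd.closed h0 _) k
  have hib : b ≠ Gamma.oldRow a c i := by unfold Gamma.oldRow; grind
  have hFb : F (.inl b) = k := by simp [hF, color_inl, hib]
  have hFa : F (arc a (D.code a)) = k := by
    simp only [hF]
    have : k * (1 - d.color w' b (arc a (D.code a))) =
        d.color w' (Gamma.oldRow a c i) (arc a (D.code a)) := by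
      rw [hk, div_mul_cancel₀ _ h1]
    linear_combination -this
  set f : L ⊕ ℕ → K := Sum.elim (fun z => if z = i then 1 else 0) fun n => F (.inr n) with hf
  -- Tails with labels outside `X` are excluded: if `c` is not in `X` and `i = c`, then `f` is `1`
  -- and `F` is `0` at the tail of `c`.
  have hfs : ∀ r : L ⊕ ℕ, (∀ z, r = .inl z → z ∈ X) →
      f (stitchArc a b c (arc a (D.code a)) r) = F r := by
    rintro (z | n) hr
    · have hz := hr z rfl
      simp only [stitchArc]
      by_cases hzb : z = b
      · rw [if_pos hzb, hzb, hFb, ← hFa]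
        -- If `a` has no underpass, the tail of `b` becomes the tail of `c`, and `k` is the color of
        -- the tail of `a`.
        rcases hra : arc a (D.code a) with z' | n
        · obtain rfl := arc_eq_inl hra
          simp only [hf, hF, Sum.elim_inl, color_inl, if_neg h.ne, Gamma.oldRow]
          grind
        · rfl
      · rw [if_neg hzb]
        simp only [hf, hF, color_inl, if_neg hzb, Gamma.oldRow]
        by_cases hza : z = a
        · rw [if_pos hza, Sum.elim_inl]
          grind
        · rw [if_neg hza, Sum.elim_inl]
          grind
    · rfl
  refine ⟨f, ?_, fun z => rfl, ?_⟩
  · intro n hn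
    change f (.inr n) = (1 - d.wt w' n) * f (stitchArc a b c (arc a (D.code a)) (d.overArc n)) +
      d.wt w' n * f (stitchArc a b c (arc a (D.code a)) (d.underArc n))
    rw [hfs _ fun z hz => hd.mem_of_inl hn (Or.inl hz), hfs _ fun z hz => hd.mem_of_inl hn (Or.inr hz)]
    exact hFc n hn
  · intro j hj
    rw [arc_code_stitch h D hj, hfs]
    · simp only [hF, hk, Gamma.feedback]
      ring
    · intro z hz
      obtain rfl := arc_eq_inl hz
      unfold Gamma.oldRow
      grind

end ArcData

namespace GaussDiagram

variable {L : Type*} [DecidableEq L] [Nonempty L] {X Y Z : Finset L}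

theorem gamma_stitch {a b c : L} (h : Stitches a b c X Y) (D : GaussDiagram X) :
    (stitch h D).gamma = Gamma.stitch h D.gamma := by
  have hd := D.describes_arcData
  refine gamma_eq (hd.stitch h) (fun w hw => ?_) (fun w hw i hi => ?_)
  · rw [Gamma.scalarAt_stitch h _ hw, scalarAt_gamma hd (hw.comp _),
      matAt_gamma hd (hw.comp _) h.mem_right h.mem_left]
    exact ArcData.det_stitch h.ne hd (hd.det_ne_zero (hw.comp _))
  · have h1 := D.gamma.one_sub_matAt_ne_zero (hw.comp (newStrand a b c)) h.mem_right h.mem_left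
      h.ne.symm
    rw [matAt_gamma hd (hw.comp _) h.mem_right h.mem_left] at h1
    obtain ⟨f, hf1, hf2, hf3⟩ := ArcData.exists_isColoring_stitch h hd
      (hd.det_ne_zero (hw.comp _)) h1 hi
    refine ⟨f, hf1, hf2, fun j hj => ?_⟩
    have hl := h.labels
    have e1 : Gamma.oldRow a c i ∈ X := by unfold Gamma.oldRow; grind
    have e2 : Gamma.oldRow b c j ∈ X := by unfold Gamma.oldRow; grind
    rw [hf3 j hj, Gamma.matAt_stitch h _ hw hi hj]
    unfold Gamma.feedback
    rw [matAt_gamma hd (hw.comp _) e1 e2, matAt_gamma hd (hw.comp _) e1 h.mem_left,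
      matAt_gamma hd (hw.comp _) h.mem_right e2, matAt_gamma hd (hw.comp _) h.mem_right h.mem_left]

theorem gamma_one {a : L} (h : Extends a X Y) (D : GaussDiagram X) :
    (one h D).gamma = Gamma.one h D.gamma := by
  have hd := D.describes_arcData
  have ha : D.code a = [] := D.code_nil a h.1
  have hd' : D.arcData.Describes (one h D).code := hd
  refine gamma_eq hd' (fun w hw => ?_) (fun w hw i hi => ?_)
  · rw [Gamma.scalarAt_one h _ hw, scalarAt_gamma hd hw]
  · by_cases hia : i = a
    · subst hia
      -- No crossing meets the new strand, so no equation involves its tail, and the indicator of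
      -- that tail is a coloring.
      refine ⟨fun r => if r = .inl i then 1 else 0, ?_, fun z => by simp, ?_⟩
      · intro n hn
        have h1 : D.arcData.overArc n ≠ .inl i :=
          fun e => hd.code_ne_nil_of_inl hn (Or.inl e) ha
        have h2 : D.arcData.underArc n ≠ .inl i :=
          fun e => hd.code_ne_nil_of_inl hn (Or.inr e) ha
        simp [h1, h2]
      · intro j hj
        rw [Gamma.matAt_one h _ hw hi hj, if_neg (by simp)]
        by_cases hj' : i = j
        · subst hj'
          simp [one, ha, arc_nil]
        · rw [if_neg hj']
          refine if_neg ?_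
          exact fun e => hj' (arc_eq_inl e)
    · refine ⟨D.arcData.color w i, ArcData.isColoring_color hd.closed (hd.det_ne_zero hw) i,
        fun z => rfl, ?_⟩
      intro j hj
      rw [Gamma.matAt_one h _ hw hi hj]
      by_cases hja : j = a
      · subst hja
        rw [if_neg (by simp)]
        simp [one, ha, arc_nil, ArcData.color_inl, eq_comm]
      · rw [if_pos ⟨hia, hja⟩, matAt_gamma hd hw (h.mem_old hi hia) (h.mem_old hj hja)]
        rfl

end GaussDiagram

/-! ### The invariant under renaming of crossings and disjoint union -/

namespace ArcData

section Det

variable {K : Type*} [Field K]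

/-- The determinant of a finite block may be computed with any enumeration of it. Besides the proofs
for blocks, this serves to evaluate small determinants along explicit lists of crossings. -/
theorem det_eq_detOn {m : Type*} [Fintype m] [DecidableEq m] {s : Finset ℕ} (A : Matrix ℕ ℕ K)
    (g : m → ℕ) (hg : Function.Injective g) (hs : ∀ n, n ∈ s ↔ ∃ i, g i = n) :
    (A.submatrix g g).det = detOn s A := by
  let e : m ≃ s := Equiv.ofBijective (fun i => ⟨g i, (hs _).2 ⟨i, rfl⟩⟩)
    ⟨fun i j h => hg (congrArg Subtype.val h), fun ⟨n, hn⟩ => by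
      obtain ⟨i, rfl⟩ := (hs n).1 hn
      exact ⟨i, rfl⟩⟩
  exact Matrix.det_submatrix_equiv_self e (A.submatrix (Subtype.val : s → ℕ) Subtype.val)

theorem detOn_image {s : Finset ℕ} (A : Matrix ℕ ℕ K) {g : ℕ → ℕ} (hg : Function.Injective g) :
    detOn (s.image g) A = detOn s (A.submatrix g g) := by
  rw [← det_eq_detOn A (fun n : s => g n) (hg.comp Subtype.val_injective)]
  · rfl
  · simp

theorem detOn_congr {s : Finset ℕ} {A B : Matrix ℕ ℕ K}
    (h : ∀ i ∈ s, ∀ j ∈ s, A i j = B i j) : detOn s A = detOn s B := by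
  unfold detOn
  congr 1
  ext i j
  exact h i i.2 j j.2

theorem detOn_union {s t : Finset ℕ} (h : Disjoint s t) (A : Matrix ℕ ℕ K)
    (h0 : ∀ i ∈ t, ∀ j ∈ s, A i j = 0) : detOn (s ∪ t) A = detOn s A * detOn t A := by
  have hd : ∀ n, n ∈ s → n ∉ t := fun n hn => Finset.disjoint_left.1 h hn
  have key := Matrix.twoBlockTriangular_det
    (A.submatrix (Subtype.val : (s ∪ t : Finset ℕ) → ℕ) Subtype.val)
    (fun i : (s ∪ t : Finset ℕ) => (i : ℕ) ∈ s) (by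
      rintro ⟨i, hi⟩ h1 ⟨j, hj⟩ h2
      exact h0 i ((Finset.mem_union.1 hi).resolve_left h1) j h2)
  refine key.trans ?_
  congr 1
  · refine det_eq_detOn A (fun i : {i : (s ∪ t : Finset ℕ) // (i : ℕ) ∈ s} => (i.1 : ℕ)) ?_ ?_
    · exact Subtype.val_injective.comp Subtype.val_injective
    · intro n
      exact ⟨fun hn => ⟨⟨⟨n, Finset.mem_union_left _ hn⟩, hn⟩, rfl⟩, by rintro ⟨i, rfl⟩; exact i.2⟩
  · refine det_eq_detOn A (fun i : {i : (s ∪ t : Finset ℕ) // (i : ℕ) ∉ s} => (i.1 : ℕ)) ?_ ?_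
    · exact Subtype.val_injective.comp Subtype.val_injective
    · intro n
      refine ⟨fun hn => ⟨⟨⟨n, Finset.mem_union_right _ hn⟩, fun hs => hd n hs hn⟩, rfl⟩, ?_⟩
      rintro ⟨⟨⟨i, hi⟩, h1⟩, rfl⟩
      exact (Finset.mem_union.1 hi).resolve_left h1

end Det

variable {L K : Type*} [DecidableEq L] [Field K] {X Y Z : Finset L}

/-- The description of a diagram whose crossings have been renamed. -/
noncomputable def relabel (g : ℕ → ℕ) (d : ArcData L) : ArcData L where
  names := d.names.image g
  sign n := d.sign (Function.invFun g n)
  overStrand n := d.overStrand (Function.invFun g n)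
  overArc n := (d.overArc (Function.invFun g n)).map id g
  underArc n := (d.underArc (Function.invFun g n)).map id g

theorem arc_relabel (g : ℕ → ℕ) (x : L) (l : List Pass) :
    arc x (l.map (Pass.relabel g)) = (arc x l).map id g := by
  have : lastUnder (l.map (Pass.relabel g)) = (lastUnder l).map g := by
    simp only [lastUnder, List.filter_map, List.getLast?_map, Option.map_map]
    rfl
  unfold arc
  rw [this]
  cases lastUnder l <;> rfl

theorem _root_.PassAt.relabel {c : L → List Pass} {p : Pass} {x : L} {r : L ⊕ ℕ}
    (h : PassAt c p x r) (g : ℕ → ℕ) :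
    PassAt (fun x => (c x).map (Pass.relabel g)) (p.relabel g) x (r.map id g) := by
  obtain ⟨l, m, h1, rfl⟩ := h
  exact ⟨l.map (Pass.relabel g), m.map (Pass.relabel g), by simp [h1], (arc_relabel g x l).symm⟩

theorem Describes.relabel {c : L → List Pass} {d : ArcData L} (h : d.Describes c) {g : ℕ → ℕ}
    (hg : Function.Injective g) :
    (d.relabel g).Describes fun x => (c x).map (Pass.relabel g) where
  mem_names x p hp := by
    obtain ⟨q, hq, rfl⟩ := List.mem_map.1 hp
    exact Finset.mem_image_of_mem g (h.mem_names x q hq)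
  over_at n hn := by
    obtain ⟨m, hm, rfl⟩ := Finset.mem_image.1 hn
    simp only [ArcData.relabel, Function.leftInverse_invFun hg m]
    exact (h.over_at m hm).relabel g
  under_at n hn := by
    obtain ⟨m, hm, rfl⟩ := Finset.mem_image.1 hn
    simp only [ArcData.relabel, Function.leftInverse_invFun hg m]
    obtain ⟨x, hx⟩ := h.under_at m hm
    exact ⟨x, hx.relabel g⟩

theorem map_id_eq_inr {g : ℕ → ℕ} (hg : Function.Injective g) {r : L ⊕ ℕ} {m : ℕ} :
    r.map id g = .inr (g m) ↔ r = .inr m := by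
  rcases r with z | n <;> simp [hg.eq_iff]

theorem det_relabel {g : ℕ → ℕ} (hg : Function.Injective g) (d : ArcData L) (w : L → K) :
    (d.relabel g).det w = d.det w := by
  unfold det
  refine (detOn_image _ hg).trans (detOn_congr fun i _ j _ => ?_)
  simp only [Matrix.submatrix_apply, matrix, coeff, wt]
  simp only [relabel, Function.leftInverse_invFun hg i, map_id_eq_inr hg, hg.eq_iff]

/-- The coloring is transported along `Function.invFun g`, a left inverse of the injective `g`. -/
theorem color_relabel {g : ℕ → ℕ} (hg : Function.Injective g) {d : ArcData L} (hd : d.Closed)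
    {w : L → K} (h0 : d.det w ≠ 0) (i : L) : ∃ f : L ⊕ ℕ → K, (d.relabel g).IsColoring w f ∧
      (∀ z, f (.inl z) = if z = i then 1 else 0) ∧ ∀ r, f (r.map id g) = d.color w i r := by
  have hf : ∀ r : L ⊕ ℕ, d.color w i ((r.map id g).map id (Function.invFun g)) = d.color w i r := by
    rintro (z | n)
    · rfl
    · simp [Function.leftInverse_invFun hg n]
  refine ⟨fun r => d.color w i (r.map id (Function.invFun g)), ?_, fun z => rfl, hf⟩
  intro n hn
  obtain ⟨m, hm, rfl⟩ := Finset.mem_image.1 hn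
  simp only [wt]
  simp only [relabel, Function.leftInverse_invFun hg m, hf]
  simpa [Function.leftInverse_invFun hg m, wt] using isColoring_color hd h0 i m hm

/-- No equation refers to the tail of a strand that the diagram does not have, so the indicator of
that tail is a coloring. -/
theorem Describes.color_of_notMem {D : GaussDiagram X} {d : ArcData L} (h : d.Describes D.code)
    {w : L → K} (h0 : d.det w ≠ 0) {i : L} (hi : i ∉ X) {r : L ⊕ ℕ}
    (hr : ∀ m, r = .inr m → m ∈ d.names) : d.color w i r = if r = .inl i then 1 else 0 := by
  refine color_eq_of_isColoring h.closed h0 (f := fun r => if r = .inl i then 1 else 0) ?_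
    (fun z => by simp) hr
  intro n hn
  have h1 : d.overArc n ≠ .inl i := fun e => hi (h.mem_of_inl hn (Or.inl e))
  have h2 : d.underArc n ≠ .inl i := fun e => hi (h.mem_of_inl hn (Or.inr e))
  simp [h1, h2]

/-- The description of a disjoint union. -/
def union (d e : ArcData L) : ArcData L where
  names := d.names ∪ e.names
  sign n := if n ∈ d.names then d.sign n else e.sign n
  overStrand n := if n ∈ d.names then d.overStrand n else e.overStrand n
  overArc n := if n ∈ d.names then d.overArc n else e.overArc n
  underArc n := if n ∈ d.names then d.underArc n else e.underArc n

theorem coeff_union_left (d e : ArcData L) (w : L → K) {n : ℕ} (hn : n ∈ d.names) (r : L ⊕ ℕ) :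
    (d.union e).coeff w n r = d.coeff w n r := by
  simp only [coeff, wt, union, if_pos hn]

theorem coeff_union_right (d e : ArcData L) (w : L → K) {n : ℕ} (hn : n ∉ d.names) (r : L ⊕ ℕ) :
    (d.union e).coeff w n r = e.coeff w n r := by
  simp only [coeff, wt, union, if_neg hn]

theorem Closed.matrix_eq_zero {d : ArcData L} (hd : d.Closed) (w : L → K) {n m : ℕ}
    (hn : n ∈ d.names) (hm : m ∉ d.names) : d.matrix w n m = 0 := by
  have h1 : d.overArc n ≠ .inr m := fun e => hm (hd n hn m (Or.inl e))
  have h2 : d.underArc n ≠ .inr m := fun e => hm (hd n hn m (Or.inr e))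
  have h3 : n ≠ m := by rintro rfl; exact hm hn
  simp [matrix, coeff, h1, h2, h3]

/-- The equations of `e` refer only to crossings of `e`. The system is thus block triangular, and
its determinant is the product of those of the two blocks. -/
theorem det_union {d e : ArcData L} (he : e.Closed) (h : Disjoint d.names e.names) (w : L → K) :
    (d.union e).det w = d.det w * e.det w := by
  have h1 : ∀ n ∈ d.names, ∀ m, (d.union e).matrix w n m = d.matrix w n m := fun n hn m => by
    simp only [matrix, coeff_union_left d e w hn]
  have h2 : ∀ n ∈ e.names, ∀ m, (d.union e).matrix w n m = e.matrix w n m := fun n hn m => by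
    simp only [matrix, coeff_union_right d e w (Finset.disjoint_right.1 h hn)]
  refine (detOn_union h _ fun i hi j hj => ?_).trans ?_
  · rw [h2 i hi, he.matrix_eq_zero w hi (Finset.disjoint_left.1 h hj)]
  · exact congrArg₂ _ (detOn_congr fun i hi j _ => h1 i hi j)
      (detOn_congr fun i hi j _ => h2 i hi j)

theorem color_union {d e : ArcData L} (hd : d.Closed) (he : e.Closed)
    (h : Disjoint d.names e.names) {w : L → K} (h0 : d.det w ≠ 0) (h1 : e.det w ≠ 0) (i : L) :
    ∃ f : L ⊕ ℕ → K, (d.union e).IsColoring w f ∧ (∀ z, f (.inl z) = if z = i then 1 else 0) ∧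
      (∀ r : L ⊕ ℕ, (∀ m, r = .inr m → m ∈ d.names) → f r = d.color w i r) ∧
      ∀ r : L ⊕ ℕ, (∀ m, r = .inr m → m ∈ e.names) → f r = e.color w i r := by
  let f : L ⊕ ℕ → K := Sum.elim (fun z => if z = i then 1 else 0) fun n =>
    if n ∈ d.names then d.color w i (.inr n) else e.color w i (.inr n)
  have hf1 : ∀ r : L ⊕ ℕ, (∀ m, r = .inr m → m ∈ d.names) → f r = d.color w i r := by
    rintro (z | n) hr
    · rfl
    · exact if_pos (hr n rfl)
  have hf2 : ∀ r : L ⊕ ℕ, (∀ m, r = .inr m → m ∈ e.names) → f r = e.color w i r := by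
    rintro (z | n) hr
    · rfl
    · exact if_neg (Finset.disjoint_right.1 h (hr n rfl))
  refine ⟨f, ?_, fun z => rfl, hf1, hf2⟩
  intro n hn
  by_cases hnd : n ∈ d.names
  · have hw : (d.union e).wt w n = d.wt w n := by simp only [wt, union, if_pos hnd]
    have ho : (d.union e).overArc n = d.overArc n := if_pos hnd
    have hu : (d.union e).underArc n = d.underArc n := if_pos hnd
    rw [hw, ho, hu, hf1 _ (by simpa using hnd), hf1 _ fun m hm => hd n hnd m (Or.inl hm),
      hf1 _ fun m hm => hd n hnd m (Or.inr hm)]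
    exact isColoring_color hd h0 i n hnd
  · have hne : n ∈ e.names := (Finset.mem_union.1 hn).resolve_left hnd
    have hw : (d.union e).wt w n = e.wt w n := by simp only [wt, union, if_neg hnd]
    have ho : (d.union e).overArc n = e.overArc n := if_neg hnd
    have hu : (d.union e).underArc n = e.underArc n := if_neg hnd
    rw [hw, ho, hu, hf2 _ (by simpa using hne), hf2 _ fun m hm => he n hne m (Or.inl hm),
      hf2 _ fun m hm => he n hne m (Or.inr hm)]
    exact isColoring_color he h1 i n hne

theorem _root_.PassAt.of_eq {c c' : L → List Pass} {p : Pass} {x : L} {r : L ⊕ ℕ}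
    (h : PassAt c p x r) (e : c' x = c x) : PassAt c' p x r := by
  obtain ⟨l, m, h1, rfl⟩ := h
  exact ⟨l, m, e.trans h1, rfl⟩

theorem Describes.union {c c₁ c₂ : L → List Pass} {d e : ArcData L} (hd : d.Describes c₁)
    (he : e.Describes c₂) (h1 : ∀ x, c x = c₁ x ++ c₂ x)
    (h2 : ∀ x, c₁ x = [] ∨ c₂ x = []) : (d.union e).Describes c := by
  have e1 : ∀ x, c₁ x ≠ [] → c x = c₁ x := fun x hx => by
    rw [h1, (h2 x).resolve_left hx, List.append_nil]
  have e2 : ∀ x, c₂ x ≠ [] → c x = c₂ x := fun x hx => by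
    rw [h1, (h2 x).resolve_right hx, List.nil_append]
  refine ⟨fun x p hp => ?_, fun n hn => ?_, fun n hn => ?_⟩
  · rw [h1, List.mem_append] at hp
    exact Finset.mem_union.2 (hp.imp (hd.mem_names x p) (he.mem_names x p))
  · by_cases hnd : n ∈ d.names
    · simp only [ArcData.union, if_pos hnd]
      have := hd.over_at n hnd
      exact this.of_eq (e1 _ (List.ne_nil_of_mem this.mem))
    · simp only [ArcData.union, if_neg hnd]
      have := he.over_at n ((Finset.mem_union.1 hn).resolve_left hnd)
      exact this.of_eq (e2 _ (List.ne_nil_of_mem this.mem))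
  · by_cases hnd : n ∈ d.names
    · simp only [ArcData.union, if_pos hnd]
      obtain ⟨x, hx⟩ := hd.under_at n hnd
      exact ⟨x, hx.of_eq (e1 _ (List.ne_nil_of_mem hx.mem))⟩
    · simp only [ArcData.union, if_neg hnd]
      obtain ⟨x, hx⟩ := he.under_at n ((Finset.mem_union.1 hn).resolve_left hnd)
      exact ⟨x, hx.of_eq (e2 _ (List.ne_nil_of_mem hx.mem))⟩

end ArcData

namespace GaussDiagram

variable {L : Type*} [DecidableEq L] [Nonempty L] {X Y Z : Finset L}

theorem gamma_relabel {D D' : GaussDiagram X} {g : ℕ → ℕ} (hg : Function.Injective g)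
    (h : D'.code = fun x => (D.code x).map (Pass.relabel g)) : D'.gamma = D.gamma := by
  have hd := D.describes_arcData
  have hd' : (D.arcData.relabel g).Describes D'.code := h ▸ hd.relabel hg
  refine gamma_eq hd' (fun w hw => ?_) (fun w hw i hi => ?_)
  · rw [ArcData.det_relabel hg, scalarAt_gamma hd hw]
  · obtain ⟨f, h1, h2, h3⟩ := ArcData.color_relabel hg hd.closed (hd.det_ne_zero hw) i
    refine ⟨f, h1, h2, fun j hj => ?_⟩
    rw [h, ArcData.arc_relabel, h3, matAt_gamma hd hw hi hj]

/-- The diagram with renamed crossings. -/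
def relabel (g : ℕ → ℕ) (hg : Function.Injective g) (D : GaussDiagram X) : GaussDiagram X where
  code x := (D.code x).map (Pass.relabel g)
  code_nil x hx := by rw [D.code_nil x hx, List.map_nil]
  nodup x := by
    have := (D.nodup x).map (f := fun k : ℕ × Bool => (g k.1, k.2)) (by
      rintro ⟨a, b⟩ ⟨c, d⟩ hh
      simpa [hg.eq_iff] using hh)
    simpa [List.map_map, Function.comp_def, Pass.relabel] using this
  disj x y p hp q hq h1 h2 := by
    obtain ⟨p, hp', rfl⟩ := List.mem_map.1 hp
    obtain ⟨q, hq', rfl⟩ := List.mem_map.1 hq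
    exact D.disj x y p hp' q hq' (hg h1) h2
  pair x p hp := by
    obtain ⟨p, hp', rfl⟩ := List.mem_map.1 hp
    obtain ⟨y, hy⟩ := D.pair x p hp'
    exact ⟨y, List.mem_map.2 ⟨_, hy, rfl⟩⟩

theorem gamma_union (h : Splits X Y Z) (D : GaussDiagram X) (E : GaussDiagram Y) :
    (union h D E).gamma = Gamma.union h D.gamma E.gamma := by
  have hl := h.labels
  -- After the renaming that is built into `union`, the crossings of the two diagrams have disjoint
  -- names and the codes are simply put together. The renaming itself does not affect `gamma`.
  set D' := D.relabel _ double_injective with hD'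
  set E' := E.relabel _ double_succ_injective with hE'
  rw [← gamma_relabel double_injective (D := D) (D' := D') rfl,
    ← gamma_relabel double_succ_injective (D := E) (D' := E') rfl]
  have hd := D'.describes_arcData
  have he := E'.describes_arcData
  have hdisj : Disjoint D'.arcData.names E'.arcData.names := by
    rw [Finset.disjoint_left]
    intro n h1 h2
    have h3 := (hd.over_at n h1).mem
    have h4 := (he.over_at n h2).mem
    obtain ⟨p, -, hp⟩ := List.mem_map.1 h3
    obtain ⟨q, -, hq⟩ := List.mem_map.1 h4
    have hp := congrArg Prod.fst hp
    have hq := congrArg Prod.fst hq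
    simp only [Pass.relabel, overpass] at hp hq
    omega
  have hc : ∀ x, (union h D E).code x = D'.code x ++ E'.code x := fun _ => rfl
  have hdis := Finset.disjoint_left.1 h.1
  have hX : ∀ x ∈ X, (union h D E).code x = D'.code x := fun x hx => by
    rw [hc, E'.code_nil x (hdis hx), List.append_nil]
  have hY : ∀ x ∈ Y, (union h D E).code x = E'.code x := fun x hx => by
    rw [hc, D'.code_nil x (fun hh => hdis hh hx), List.nil_append]
  have hu : (D'.arcData.union E'.arcData).Describes (union h D E).code :=
    hd.union he hc fun x => by
      by_cases hx : x ∈ X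
      · exact Or.inr (E'.code_nil x (hdis hx))
      · exact Or.inl (D'.code_nil x hx)
  refine gamma_eq hu (fun w hw => ?_) (fun w hw i hi => ?_)
  · rw [Gamma.scalarAt_union h _ _ hw, scalarAt_gamma hd hw, scalarAt_gamma he hw,
      ArcData.det_union he.closed hdisj]
  · obtain ⟨f, h1, h2, h3, h4⟩ := ArcData.color_union hd.closed he.closed hdisj
      (hd.det_ne_zero hw) (he.det_ne_zero hw) i
    refine ⟨f, h1, h2, fun j hj => ?_⟩
    rw [Gamma.matAt_union h _ _ hw]
    by_cases hjX : j ∈ X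
    · rw [hX j hjX, h3 _ fun m hm => hd.last_mem hm,
        Gamma.matAt_eq_zero E'.gamma _ (Or.inr (hdis hjX)), add_zero]
      by_cases hiX : i ∈ X
      · rw [matAt_gamma hd hw hiX hjX]
      · rw [Gamma.matAt_eq_zero _ _ (Or.inl hiX), hd.color_of_notMem (hd.det_ne_zero hw) hiX
          fun m hm => hd.last_mem hm, if_neg]
        exact fun e => hiX (arc_eq_inl e ▸ hjX)
    · have hjY : j ∈ Y := by grind
      rw [hY j hjY, h4 _ fun m hm => he.last_mem hm,
        Gamma.matAt_eq_zero D'.gamma _ (Or.inr hjX), zero_add]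
      by_cases hiY : i ∈ Y
      · rw [matAt_gamma he hw hiY hjY]
      · rw [Gamma.matAt_eq_zero _ _ (Or.inl hiY), he.color_of_notMem (he.det_ne_zero hw) hiY
          fun m hm => he.last_mem hm, if_neg]
        exact fun e => hiY (arc_eq_inl e ▸ hjY)

end GaussDiagram

/-! ### Cutting diagrams, and local changes -/

theorem List.infix_of_disjoint {α : Type*} {c l b m : List α} (hb : b ≠ [])
    (hcb : ∀ p ∈ c, p ∉ b) (h : c <:+: l ++ b ++ m) : c <:+: l ∨ c <:+: m := by
  have hsub : ∀ c' : List α, (∀ p ∈ c', p ∈ c) → (∀ p ∈ c', p ∈ b) → c' = [] := fun c' h1 h2 =>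
    List.eq_nil_iff_forall_not_mem.2 fun p hp => hcb p (h1 p hp) (h2 p hp)
  rcases List.infix_append_iff.1 h with h | h | ⟨c₁, c₂, rfl, h1, h2⟩
  · rcases List.infix_append_iff.1 h with h | h | ⟨c₁, c₂, rfl, h1, h2⟩
    · exact Or.inl h
    · rw [hsub c (fun p hp => hp) fun p hp => h.subset hp]
      exact Or.inl List.nil_infix
    · rw [hsub c₂ (fun p hp => List.mem_append_right _ hp) fun p hp => h2.subset hp,
        List.append_nil]
      exact Or.inl h1.isInfix
  · exact Or.inr h
  -- Here `c₁` is a suffix of `l ++ b`, so it either contains `b` or is contained in it. Since `c`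
  -- has no element in common with `b`, the first is impossible and the second forces `c₁` to be
  -- empty.
  · obtain ⟨t, ht⟩ := h1
    rcases List.append_eq_append_iff.1 ht with ⟨s, rfl, rfl⟩ | ⟨s, rfl, rfl⟩
    · exact absurd (hsub b (fun p hp => by simp [hp]) fun p hp => hp) hb
    · rw [hsub c₁ (fun p hp => List.mem_append_left _ hp) fun p hp => List.mem_append_right _ hp,
        List.nil_append]
      exact Or.inr h2.isInfix

namespace GaussDiagram

variable {L : Type*} [DecidableEq L] {X Y Z : Finset L}

theorem mem_of_mem_code (D : GaussDiagram X) {x : L} {p : Pass} (h : p ∈ D.code x) : x ∈ X := by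
  by_contra hx
  rw [D.code_nil x hx] at h
  simp at h

/-- Cut the strand `x` into an initial part `l`, which keeps its label, and a final part `m`,
which gets the new label `y`. -/
def split (D : GaussDiagram X) {x y : L} (hx : x ∈ X) (hy : y ∉ X) {l m : List Pass}
    (h : D.code x = l ++ m) : GaussDiagram (insert y X) where
  code z := if z = y then m else if z = x then l else D.code z
  code_nil z hz := by
    rw [Finset.mem_insert, not_or] at hz
    rw [if_neg hz.1, if_neg (by rintro rfl; exact hz.2 hx), D.code_nil z hz.2]
  nodup z := by
    have hd := D.nodup x
    rw [h, List.map_append, List.nodup_append] at hd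
    split_ifs
    · exact hd.2.1
    · exact hd.1
    · exact D.nodup z
  disj z z' p hp q hq h1 h2 := by
    have hd := D.nodup x
    rw [h, List.map_append, List.nodup_append] at hd
    have hlm : ∀ p ∈ l, ∀ q ∈ m, p.1 = q.1 → p.2.1 ≠ q.2.1 := fun p hp q hq e1 e2 =>
      hd.2.2 _ (List.mem_map_of_mem hp) _ (List.mem_map_of_mem hq) (Prod.ext e1 e2)
    have hl : ∀ p ∈ l, p ∈ D.code x := fun p hp => by simp [h, hp]
    have hm : ∀ p ∈ m, p ∈ D.code x := fun p hp => by simp [h, hp]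
    have := D.disj
    split_ifs at hp hq <;> grind
  pair z p hp := by
    have hmem : ∃ z, p ∈ D.code z := by
      split_ifs at hp
      · exact ⟨x, by simp [h, hp]⟩
      · exact ⟨x, by simp [h, hp]⟩
      · exact ⟨z, hp⟩
    obtain ⟨z, hz⟩ := hmem
    obtain ⟨u, hu⟩ := D.pair z p hz
    by_cases hux : u = x
    · subst hux
      rw [h, List.mem_append] at hu
      rcases hu with hu | hu
      · exact ⟨u, by rwa [if_neg (by rintro rfl; exact hy hx), if_pos rfl]⟩
      · exact ⟨y, by rwa [if_pos rfl]⟩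
    · exact ⟨u, by rwa [if_neg (by rintro rfl; exact hy (D.mem_of_mem_code hu)), if_neg hux]⟩

theorem stitches_split {x y : L} (hx : x ∈ X) (hy : y ∉ X) : Stitches x y x (insert y X) X := by
  have hxy : x ≠ y := by rintro rfl; exact hy hx
  refine ⟨X.erase x, hxy, by simp, fun h => hy (Finset.mem_of_mem_erase h), by simp, ?_, ?_⟩
  · rw [Finset.insert_comm, Finset.insert_erase hx]
  · rw [Finset.insert_erase hx]

/-- Cutting is undone by stitching. Hence `gamma D` is determined by `gamma` of the cut diagram,
which is the basis both of the localization of moves and of the generation by crossings. -/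
theorem stitch_split (D : GaussDiagram X) {x y : L} (hx : x ∈ X) (hy : y ∉ X) {l m : List Pass}
    (h : D.code x = l ++ m) : stitch (stitches_split hx hy) (D.split hx hy h) = D := by
  refine ext_on fun z hz => ?_
  have hxy : x ≠ y := by rintro rfl; exact hy hx
  have hzy : z ≠ y := by rintro rfl; exact hy hz
  by_cases hzx : z = x
  · subst hzx
    simp [stitch, stitchCode, split, h, hxy]
  · simp [stitch, stitchCode, split, hzx, hzy]

/-- The part of `D` with strands in `S`. -/
def part (D : GaussDiagram X) (S : Finset L)
    (h : ∀ x ∈ S, ∀ p ∈ D.code x, ∀ y ∉ S, ∀ q ∈ D.code y, p.1 ≠ q.1) : GaussDiagram S where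
  code z := if z ∈ S then D.code z else []
  code_nil z hz := if_neg hz
  nodup z := by
    split_ifs
    · exact D.nodup z
    · simp
  disj x y p hp q hq := by
    split_ifs at hp hq
    · exact D.disj x y p hp q hq
    all_goals simp at hp hq
  pair x p hp := by
    split_ifs at hp with hx
    · obtain ⟨y, hy⟩ := D.pair x p hp
      refine ⟨y, ?_⟩
      rw [if_pos]
      · exact hy
      · by_contra hyS
        exact h x hx p hp y hyS _ hy rfl
    · simp at hp

theorem separate_symm {D : GaussDiagram X} {S : Finset L}
    (h : ∀ x ∈ S, ∀ p ∈ D.code x, ∀ y ∉ S, ∀ q ∈ D.code y, p.1 ≠ q.1) :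
    ∀ x ∈ X \ S, ∀ p ∈ D.code x, ∀ y ∉ X \ S, ∀ q ∈ D.code y, p.1 ≠ q.1 := by
  intro x hx p hp y hy q hq e
  have hyX := D.mem_of_mem_code hq
  simp only [Finset.mem_sdiff, hyX, true_and, not_not] at hx hy
  exact h y hy q hq x hx.2 p hp e.symm

theorem splits_sdiff {S : Finset L} (h : S ⊆ X) : Splits S (X \ S) X :=
  ⟨Finset.disjoint_sdiff, (Finset.union_sdiff_of_subset h).symm⟩

/-- A diagram without crossings between two sets of strands is a disjoint union, up to the names
of the crossings. -/
theorem exists_union_part (D : GaussDiagram X) {S : Finset L} (hS : S ⊆ X)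
    (h : ∀ x ∈ S, ∀ p ∈ D.code x, ∀ y ∉ S, ∀ q ∈ D.code y, p.1 ≠ q.1) :
    ∃ f : ℕ → ℕ, Function.Injective f ∧
      (union (splits_sdiff hS) (D.part S h) (D.part (X \ S) (separate_symm h))).code =
        fun x => (D.code x).map (Pass.relabel f) := by
  classical
  -- The names imitate those in `unionCode`: even for crossings on `S`, odd for all others.
  refine ⟨fun n => if ∃ x ∈ S, ∃ p ∈ D.code x, p.1 = n then 2 * n else 2 * n + 1, ?_, ?_⟩
  · intro n m e
    simp only at e
    split_ifs at e <;> omega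
  · funext z
    by_cases hzS : z ∈ S
    · simp only [union, unionCode, part, Finset.mem_sdiff, hzS, not_true, and_false,
        if_false, List.map_nil, List.append_nil]
      refine List.map_congr_left fun p hp => ?_
      simp only [Pass.relabel]
      rw [if_pos ⟨z, hzS, p, hp, rfl⟩]
    by_cases hzX : z ∈ X
    · simp only [union, unionCode, part, Finset.mem_sdiff, hzS, hzX, not_false_iff, and_true,
        if_false, if_true, List.map_nil, List.nil_append]
      refine List.map_congr_left fun p hp => ?_
      simp only [Pass.relabel]
      rw [if_neg]
      rintro ⟨x, hx, q, hq, e⟩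
      exact h x hx q hq z hzS p hp e
    · simp [union, unionCode, part, hzS, hzX, D.code_nil z hzX]

section Local

variable [Infinite L]

/-- To compare two diagrams that differ only by a local change, one may isolate a part of a
strand. -/
theorem gamma_eq_of_isolate {D D' : GaussDiagram X} {g : Pass → Option Pass}
    (hg : ∀ z, D'.code z = (D.code z).filterMap g) {x : L} {b : List Pass} (hb : b ≠ [])
    (hx : b <:+: D.code x)
    (H : ∀ (Y : Finset L) (E E' : GaussDiagram Y), (∀ z, E'.code z = (E.code z).filterMap g) →
      (∃ z, E.code z = b) → (∀ c : List Pass, c ≠ [] → (∀ p ∈ c, p ∉ b) →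
        ((∃ y, c <:+: D.code y) → ∃ y, c <:+: E.code y) ∧
        ((∃ y, D.code y = c) → ∃ y, E.code y = c)) → E.gamma = E'.gamma) :
    D.gamma = D'.gamma := by
  obtain ⟨l, m, hlm⟩ := hx
  have hxX : x ∈ X := by
    by_contra h
    rw [D.code_nil x h] at hlm
    simp [hb] at hlm
  -- Two new labels are used to cut `x` twice: the initial part keeps the label `x`, the piece `b`
  -- gets `y` and the final part gets `u`. The change `g` acts on single passages, so `D'` can be
  -- cut at the corresponding places; values in `Option` cover both exchanges and erasures.
  obtain ⟨y, hy⟩ := Infinite.exists_notMem_finset X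
  obtain ⟨u, hu⟩ := Infinite.exists_notMem_finset (insert y X)
  have hyX : y ∈ insert y X := Finset.mem_insert_self y X
  have huy : u ≠ y := fun e => hu (e ▸ hyX)
  have huX : u ∉ X := fun h => hu (Finset.mem_insert_of_mem h)
  have hxy : x ≠ y := fun e => hy (e ▸ hxX)
  have hxu : x ≠ u := fun e => huX (e ▸ hxX)
  have e1 : D.code x = l ++ (b ++ m) := by rw [← hlm, List.append_assoc]
  have e2 : (D.split hxX hy e1).code y = b ++ m := by simp [split]
  have e1' : D'.code x = l.filterMap g ++ (b.filterMap g ++ m.filterMap g) := by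
    rw [hg, e1, List.filterMap_append, List.filterMap_append]
  have e2' : (D'.split hxX hy e1').code y = b.filterMap g ++ m.filterMap g := by simp [split]
  have hc : ∀ z, ((D.split hxX hy e1).split hyX hu e2).code z =
      if z = u then m else if z = y then b else if z = x then l else D.code z := by
    intro z
    simp only [split]
    split_ifs <;> rfl
  rw [← D.stitch_split hxX hy e1, ← D'.stitch_split hxX hy e1', gamma_stitch, gamma_stitch,
    ← (D.split hxX hy e1).stitch_split hyX hu e2, ← (D'.split hxX hy e1').stitch_split hyX hu e2',
    gamma_stitch, gamma_stitch]
  congr 2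
  -- The two claims about `c` permit iteration: a piece still to be isolated stays in one piece, and
  -- a piece isolated earlier stays a whole strand.
  refine H _ _ _ ?_ ⟨y, ?_⟩ fun c hc0 hcb => ⟨?_, ?_⟩
  · intro z
    rw [hc]
    simp only [split]
    split_ifs
    · rfl
    · rfl
    · rfl
    · exact hg z
  · rw [hc, if_neg huy.symm, if_pos rfl]
  · rintro ⟨z, hz⟩
    by_cases hzx : z = x
    · subst hzx
      rw [← hlm] at hz
      rcases List.infix_of_disjoint hb hcb hz with hz | hz
      · exact ⟨z, by rwa [hc, if_neg hxu, if_neg hxy, if_pos rfl]⟩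
      · exact ⟨u, by rwa [hc, if_pos rfl]⟩
    · have hzX : z ∈ X := by
        by_contra h
        rw [D.code_nil z h, List.infix_nil] at hz
        exact hc0 hz
      exact ⟨z, by rwa [hc, if_neg (by rintro rfl; exact huX hzX),
        if_neg (by rintro rfl; exact hy hzX), if_neg hzx]⟩
  · rintro ⟨z, rfl⟩
    have hzX : z ∈ X := by
      by_contra h
      exact hc0 (D.code_nil z h)
    have hzx : z ≠ x := by
      rintro rfl
      obtain ⟨p, hp⟩ := List.exists_mem_of_ne_nil b hb
      exact hcb p (by simp [← hlm, hp]) hp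
    exact ⟨z, by rw [hc, if_neg (by rintro rfl; exact huX hzX),
      if_neg (by rintro rfl; exact hy hzX), if_neg hzx]⟩

/-- Diagrams that differ only in a part without connections to the rest. -/
theorem gamma_eq_of_part {D D' : GaussDiagram X} {S : Finset L} (hS : S ⊆ X)
    (h : ∀ x ∈ S, ∀ p ∈ D.code x, ∀ y ∉ S, ∀ q ∈ D.code y, p.1 ≠ q.1)
    (h' : ∀ x ∈ S, ∀ p ∈ D'.code x, ∀ y ∉ S, ∀ q ∈ D'.code y, p.1 ≠ q.1)
    (hc : ∀ y ∉ S, D'.code y = D.code y)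
    (H : (D.part S h).gamma = (D'.part S h').gamma) : D.gamma = D'.gamma := by
  obtain ⟨f, hf, e⟩ := D.exists_union_part hS h
  obtain ⟨f', hf', e'⟩ := D'.exists_union_part hS h'
  rw [← gamma_relabel hf e, ← gamma_relabel hf' e', gamma_union, gamma_union, H]
  congr 2
  refine ext_on fun z hz => ?_
  simp only [part, if_pos hz, hc z (Finset.mem_sdiff.1 hz).2]

/-- If both passages of every crossing on `S` lie on `S`, then these strands split off. The
conditions on `g` ensure that nothing changes off `S`, and that after the change `S` is still not
connected to the rest. -/
theorem gamma_eq_of_isolated {D D' : GaussDiagram X} {g : Pass → Option Pass}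
    (hg : ∀ z, D'.code z = (D.code z).filterMap g) {S : Finset L} (hS : S ⊆ X)
    (h : ∀ x ∈ S, ∀ p ∈ D.code x, ∃ y ∈ S, p.other ∈ D.code y)
    (hfix : ∀ p, (∀ x ∈ S, ∀ q ∈ D.code x, q.1 ≠ p.1) → g p = some p)
    (hnames : ∀ x ∈ S, ∀ p ∈ D.code x, ∀ p', g p = some p' →
      ∃ y ∈ S, ∃ q ∈ D.code y, q.1 = p'.1)
    (H : ∀ F F' : GaussDiagram S, (∀ z ∈ S, F.code z = D.code z) →
      (∀ z ∈ S, F'.code z = (D.code z).filterMap g) → F.gamma = F'.gamma) :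
    D.gamma = D'.gamma := by
  have h1 : ∀ x ∈ S, ∀ p ∈ D.code x, ∀ y ∉ S, ∀ q ∈ D.code y, p.1 ≠ q.1 := by
    intro x hx p hp y hy q hq e
    by_cases hb : p.2.1 = q.2.1
    · exact hy (D.disj x y p hp q hq e hb ▸ hx)
    · obtain ⟨z, hz, hpz⟩ := h x hx p hp
      refine hy (D.disj z y _ hpz q hq e ?_ ▸ hz)
      simp only [Pass.other]
      revert hb
      cases p.2.1 <;> cases q.2.1 <;> simp
  have hc : ∀ y ∉ S, D'.code y = D.code y := by
    intro y hy
    rw [hg]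
    conv_rhs => rw [← List.filterMap_some (l := D.code y)]
    exact List.filterMap_congr fun q hq => hfix q fun x hx p hp => h1 x hx p hp y hy q hq
  have h1' : ∀ x ∈ S, ∀ p ∈ D'.code x, ∀ y ∉ S, ∀ q ∈ D'.code y, p.1 ≠ q.1 := by
    intro x hx p hp y hy q hq
    rw [hg, List.mem_filterMap] at hp
    obtain ⟨p, hp, e⟩ := hp
    obtain ⟨z, hz, r, hr, e⟩ := hnames x hx p hp _ e
    rw [← e]
    exact h1 z hz r hr y hy q (hc y hy ▸ hq)
  refine gamma_eq_of_part hS h1 h1' hc (H _ _ (fun z hz => if_pos hz) fun z hz => ?_)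
  rw [← hg]
  exact if_pos hz

/-- With equal determinants, it is enough to turn every coloring of one diagram into a coloring of
the other with the same colors at tails and heads. -/
theorem gamma_congr {D D' : GaussDiagram X} {d d' : ArcData L} (h : d.Describes D.code)
    (h' : d'.Describes D'.code) (hdet : ∀ w : L → RatField X, d.det w = d'.det w)
    (hcol : ∀ w : L → RatField X, UnitalAtOne w → ∀ f, d.IsColoring w f →
      ∃ g, d'.IsColoring w g ∧ (∀ z, g (.inl z) = f (.inl z)) ∧
        ∀ j ∈ X, g (arc j (D'.code j)) = f (arc j (D.code j))) : D.gamma = D'.gamma := by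
  refine (gamma_eq h' (fun w hw => ?_) (fun w hw i hi => ?_)).symm
  · rw [← hdet, scalarAt_gamma h hw]
  · obtain ⟨g, h1, h2, h3⟩ := hcol w hw _ (ArcData.isColoring_color h.closed (h.det_ne_zero hw) i)
    exact ⟨g, h1, h2, fun j hj => by rw [h3 j hj, matAt_gamma h hw hi hj]⟩

/-- A local change on three pieces of strand. -/
theorem gamma_eq_of_local {D D' : GaussDiagram X} {g : Pass → Option Pass}
    (hg : ∀ z, D'.code z = (D.code z).filterMap g) {b₁ b₂ b₃ : List Pass}
    (hb₁ : b₁ ≠ []) (hb₂ : b₂ ≠ []) (hb₃ : b₃ ≠ [])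
    (hx₁ : ∃ x, b₁ <:+: D.code x) (hx₂ : ∃ x, b₂ <:+: D.code x) (hx₃ : ∃ x, b₃ <:+: D.code x)
    (h₁₂ : ∀ p ∈ b₁, p ∉ b₂) (h₁₃ : ∀ p ∈ b₁, p ∉ b₃) (h₂₃ : ∀ p ∈ b₂, p ∉ b₃)
    (h : ∀ p ∈ b₁ ++ b₂ ++ b₃, p.other ∈ b₁ ++ b₂ ++ b₃)
    (hfix : ∀ p, (∀ q ∈ b₁ ++ b₂ ++ b₃, q.1 ≠ p.1) → g p = some p)
    (hnames : ∀ p ∈ b₁ ++ b₂ ++ b₃, ∀ p', g p = some p' → p' ∈ b₁ ++ b₂ ++ b₃)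
    (H : ∀ (x y z : L) (F F' : GaussDiagram ({x, y, z} : Finset L)), x ≠ y → x ≠ z → y ≠ z →
      F.code x = b₁ → F.code y = b₂ → F.code z = b₃ → F'.code x = b₁.filterMap g →
      F'.code y = b₂.filterMap g → F'.code z = b₃.filterMap g → F.gamma = F'.gamma) :
    D.gamma = D'.gamma := by
  obtain ⟨x, hx⟩ := hx₁
  refine gamma_eq_of_isolate hg hb₁ hx fun X₁ D₁ D₁' hg₁ hz₁ hc₁ => ?_
  obtain ⟨x, hx⟩ := (hc₁ b₂ hb₂ fun p h2 h1 => h₁₂ p h1 h2).1 hx₂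
  refine gamma_eq_of_isolate hg₁ hb₂ hx fun X₂ D₂ D₂' hg₂ hz₂ hc₂ => ?_
  obtain ⟨x, hx⟩ := (hc₂ b₃ hb₃ fun p h3 h2 => h₂₃ p h2 h3).1
    ((hc₁ b₃ hb₃ fun p h3 h1 => h₁₃ p h1 h3).1 hx₃)
  refine gamma_eq_of_isolate hg₂ hb₃ hx fun X₃ D₃ D₃' hg₃ hz₃ hc₃ => ?_
  obtain ⟨x, hx⟩ := (hc₃ b₁ hb₁ h₁₃).2 ((hc₂ b₁ hb₁ h₁₂).2 hz₁)
  obtain ⟨y, hy⟩ := (hc₃ b₂ hb₂ h₂₃).2 hz₂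
  obtain ⟨z, hz⟩ := hz₃
  have hS : ({x, y, z} : Finset L) ⊆ X₃ := by
    intro u hu
    by_contra hX
    have := D₃.code_nil u hX
    simp only [Finset.mem_insert, Finset.mem_singleton] at hu
    rcases hu with rfl | rfl | rfl
    · exact hb₁ (hx ▸ this)
    · exact hb₂ (hy ▸ this)
    · exact hb₃ (hz ▸ this)
  have hmem : ∀ p, p ∈ b₁ ++ b₂ ++ b₃ ↔ ∃ u ∈ ({x, y, z} : Finset L), p ∈ D₃.code u := by
    intro p
    simp [hx, hy, hz]
  have hne : ∀ {b c : List Pass} {u v : L}, b ≠ [] → D₃.code u = b → D₃.code v = c →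
      (∀ p ∈ b, p ∉ c) → u ≠ v := by
    rintro b c u v hb rfl rfl hbc rfl
    obtain ⟨p, hp⟩ := List.exists_mem_of_ne_nil _ hb
    exact hbc p hp hp
  refine gamma_eq_of_isolated hg₃ hS ?_ ?_ ?_ ?_
  · exact fun u hu p hp => (hmem _).1 (h p ((hmem p).2 ⟨u, hu, hp⟩))
  · intro p hp
    refine hfix p fun q hq => ?_
    obtain ⟨u, hu, hqu⟩ := (hmem q).1 hq
    exact hp u hu q hqu
  · intro u hu p hp p' e
    obtain ⟨v, hv, hv'⟩ := (hmem _).1 (hnames p ((hmem p).2 ⟨u, hu, hp⟩) p' e)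
    exact ⟨v, hv, p', hv', rfl⟩
  · intro F F' hF hF'
    exact H x y z F F' (hne hb₁ hx hy h₁₂) (hne hb₁ hx hz h₁₃) (hne hb₂ hy hz h₂₃)
      (by rw [hF x (by simp), hx]) (by rw [hF y (by simp), hy]) (by rw [hF z (by simp), hz])
      (by rw [hF' x (by simp), hx]) (by rw [hF' y (by simp), hy]) (by rw [hF' z (by simp), hz])

/-- A local change on two pieces of strand. -/
theorem gamma_eq_of_local_two {D D' : GaussDiagram X} {g : Pass → Option Pass}
    (hg : ∀ z, D'.code z = (D.code z).filterMap g) {b₁ b₂ : List Pass}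
    (hb₁ : b₁ ≠ []) (hb₂ : b₂ ≠ [])
    (hx₁ : ∃ x, b₁ <:+: D.code x) (hx₂ : ∃ x, b₂ <:+: D.code x)
    (h₁₂ : ∀ p ∈ b₁, p ∉ b₂)
    (h : ∀ p ∈ b₁ ++ b₂, p.other ∈ b₁ ++ b₂)
    (hfix : ∀ p, (∀ q ∈ b₁ ++ b₂, q.1 ≠ p.1) → g p = some p)
    (hnames : ∀ p ∈ b₁ ++ b₂, ∀ p', g p = some p' → p' ∈ b₁ ++ b₂)
    (H : ∀ (x y : L) (F F' : GaussDiagram ({x, y} : Finset L)), x ≠ y →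
      F.code x = b₁ → F.code y = b₂ → F'.code x = b₁.filterMap g →
      F'.code y = b₂.filterMap g → F.gamma = F'.gamma) :
    D.gamma = D'.gamma := by
  obtain ⟨x, hx⟩ := hx₁
  refine gamma_eq_of_isolate hg hb₁ hx fun X₁ D₁ D₁' hg₁ hz₁ hc₁ => ?_
  obtain ⟨x, hx⟩ := (hc₁ b₂ hb₂ fun p h2 h1 => h₁₂ p h1 h2).1 hx₂
  refine gamma_eq_of_isolate hg₁ hb₂ hx fun X₂ D₂ D₂' hg₂ hz₂ hc₂ => ?_
  obtain ⟨x, hx⟩ := (hc₂ b₁ hb₁ h₁₂).2 hz₁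
  obtain ⟨y, hy⟩ := hz₂
  have hS : ({x, y} : Finset L) ⊆ X₂ := by
    intro u hu
    by_contra hX
    have := D₂.code_nil u hX
    simp only [Finset.mem_insert, Finset.mem_singleton] at hu
    rcases hu with rfl | rfl
    · exact hb₁ (hx ▸ this)
    · exact hb₂ (hy ▸ this)
  have hmem : ∀ p, p ∈ b₁ ++ b₂ ↔ ∃ u ∈ ({x, y} : Finset L), p ∈ D₂.code u := by
    intro p
    simp [hx, hy]
  refine gamma_eq_of_isolated hg₂ hS ?_ ?_ ?_ ?_
  · exact fun u hu p hp => (hmem _).1 (h p ((hmem p).2 ⟨u, hu, hp⟩))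
  · intro p hp
    refine hfix p fun q hq => ?_
    obtain ⟨u, hu, hqu⟩ := (hmem q).1 hq
    exact hp u hu q hqu
  · intro u hu p hp p' e
    obtain ⟨v, hv, hv'⟩ := (hmem _).1 (hnames p ((hmem p).2 ⟨u, hu, hp⟩) p' e)
    exact ⟨v, hv, p', hv', rfl⟩
  · intro F F' hF hF'
    refine H x y F F' ?_
      (by rw [hF x (by simp), hx]) (by rw [hF y (by simp), hy])
      (by rw [hF' x (by simp), hx]) (by rw [hF' y (by simp), hy])
    rintro rfl
    obtain ⟨p, hp⟩ := List.exists_mem_of_ne_nil _ hb₁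
    exact h₁₂ p hp (hy ▸ hx ▸ hp)

end Local

end GaussDiagram

/-! ### Invariance under the moves -/

namespace GaussDiagram

variable {L : Type*} [DecidableEq L] {X Y Z : Finset L}

theorem ne_of_adjacent {D : GaussDiagram X} {p q : Pass} (h : Adjacent D.code p q)
    (hb : p.2.1 = q.2.1) : p.1 ≠ q.1 := by
  obtain ⟨x, hx⟩ := h
  have := (D.nodup x).sublist (hx.sublist.map _)
  simp only [List.map_cons, List.map_nil, List.nodup_cons, List.mem_singleton, Prod.mk.injEq,
    not_and] at this
  exact fun e => this.1 e hb

theorem infix_of_mem {c : L → List Pass} {p : Pass} (h : ∃ x, p ∈ c x) : ∃ x, [p] <:+: c x := by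
  obtain ⟨x, hx⟩ := h
  obtain ⟨l, m, e⟩ := List.append_of_mem hx
  exact ⟨x, l, m, by rw [e]; simp⟩

/-- The description of two crossings with the same overstrand, and two understrands. -/
def fork (x y z : L) (n m : ℕ) (s s' : ℤˣ) : ArcData L where
  names := {n, m}
  sign k := if k = n then s else s'
  overStrand _ := x
  overArc _ := .inl x
  underArc k := if k = n then .inl y else .inl z

theorem describes_fork {x y z : L} {D : GaussDiagram ({x, y, z} : Finset L)} {n m : ℕ}
    {s s' : ℤˣ} (hnm : n ≠ m)
    (hx : D.code x = [overpass n s, overpass m s'] ∨ D.code x = [overpass m s', overpass n s])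
    (hy : D.code y = [underpass n s]) (hz : D.code z = [underpass m s']) :
    (fork x y z n m s s').Describes D.code where
  mem_names u p hp := by
    have := D.mem_of_mem_code hp
    simp only [Finset.mem_insert, Finset.mem_singleton] at this
    rcases this with rfl | rfl | rfl
    · rcases hx with hx | hx <;> rw [hx] at hp <;> simp [fork, overpass] at hp ⊢ <;> grind
    · rw [hy] at hp; simp [fork, underpass] at hp ⊢; grind
    · rw [hz] at hp; simp [fork, underpass] at hp ⊢; grind
  over_at k hk := by
    simp only [fork, Finset.mem_insert, Finset.mem_singleton] at hk
    rcases hk with rfl | rfl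
    · rcases hx with hx | hx
      · exact ⟨[], [overpass m s'], by simp [fork, hx], rfl⟩
      · exact ⟨[overpass m s'], [], by simp [fork, hx], rfl⟩
    · rcases hx with hx | hx
      · exact ⟨[overpass n s], [], by simp [fork, hx, hnm.symm], rfl⟩
      · exact ⟨[], [overpass n s], by simp [fork, hx, hnm.symm], rfl⟩
  under_at k hk := by
    simp only [fork, Finset.mem_insert, Finset.mem_singleton] at hk
    rcases hk with rfl | rfl
    · exact ⟨y, [], [], by simp [fork, hy], by simp [fork, arc_nil]⟩
    · exact ⟨z, [], [], by simp [fork, hz, hnm.symm], by simp [fork, hnm.symm, arc_nil]⟩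

/-- Overpasses do not end arcs. Once the pieces are isolated, the same `fork` describes both
diagrams, so the two linear systems are literally equal. -/
theorem gamma_oc [Infinite L] {D D' : GaussDiagram X} {n m : ℕ} {s s' : ℤˣ}
    (h : Adjacent D.code (overpass n s) (overpass m s'))
    (hD : D'.code = swapCode (overpass n s) (overpass m s') D.code) : D.gamma = D'.gamma := by
  have hnm : n ≠ m := ne_of_adjacent h rfl
  obtain ⟨v, hv, hv'⟩ := h.mem
  have hu1 := D.pair v _ hv
  have hu2 := D.pair v _ hv'
  refine gamma_eq_of_local (g := some ∘ Equiv.swap (overpass n s) (overpass m s'))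
    (b₁ := [overpass n s, overpass m s']) (b₂ := [underpass n s]) (b₃ := [underpass m s'])
    (fun z => by rw [hD, List.filterMap_eq_map]; rfl) (by simp) (by simp) (by simp) h
    (infix_of_mem hu1) (infix_of_mem hu2) ?_ ?_ ?_ ?_ ?_ ?_ ?_
  · simp [overpass, underpass]
  · simp [overpass, underpass]
  · simp [underpass, hnm]
  · simp [overpass, underpass, Pass.other]
  · intro p hp
    have h1 := hp (overpass n s) (by simp)
    have h2 := hp (overpass m s') (by simp)
    exact congrArg some (Equiv.swap_apply_of_ne_of_ne (fun e => h1 (e ▸ rfl)) fun e => h2 (e ▸ rfl))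
  · rintro p hp _ ⟨⟩
    rw [Equiv.swap_apply_def]
    split_ifs <;> simp_all
  · intro x y z F F' hxy hxz hyz hx hy hz hx' hy' hz'
    have e1 : Equiv.swap (overpass n s) (overpass m s') (underpass n s) = underpass n s :=
      Equiv.swap_apply_of_ne_of_ne (by simp [overpass, underpass]) (by simp [overpass, underpass])
    have e2 : Equiv.swap (overpass n s) (overpass m s') (underpass m s') = underpass m s' :=
      Equiv.swap_apply_of_ne_of_ne (by simp [overpass, underpass]) (by simp [overpass, underpass])
    simp only [List.filterMap_eq_map, List.map_cons, List.map_nil, Equiv.swap_apply_left,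
      Equiv.swap_apply_right, e1, e2] at hx' hy' hz'
    refine gamma_congr (describes_fork hnm (Or.inl hx) hy hz) (describes_fork hnm (Or.inr hx') hy' hz')
      (fun w => rfl) fun w hw f hf => ⟨f, hf, fun z => rfl, fun j hj => ?_⟩
    simp only [Finset.mem_insert, Finset.mem_singleton] at hj
    rcases hj with rfl | rfl | rfl
    · rw [hx, hx']; rfl
    · rw [hy, hy']
    · rw [hz, hz']

/-- The description of two consecutive crossings of the strand `y` under the strand `x`. -/
def bigon (x y : L) (n m : ℕ) (s : ℤˣ) (p : Prop) [Decidable p] : ArcData L where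
  names := {n, m}
  sign k := if k = n then s else -s
  overStrand _ := x
  overArc _ := .inl x
  underArc k := if k = n then if p then .inl y else .inr m else if p then .inr n else .inl y

theorem describes_bigon {x y : L} {D : GaussDiagram ({x, y} : Finset L)} {n m : ℕ}
    {s : ℤˣ} (hnm : n ≠ m) (p : Prop) [Decidable p]
    (hx : D.code x = [overpass n s, overpass m (-s)])
    (hy : D.code y = if p then [underpass n s, underpass m (-s)] else
      [underpass m (-s), underpass n s]) : (bigon x y n m s p).Describes D.code where
  mem_names u q hq := by
    have := D.mem_of_mem_code hq
    simp only [Finset.mem_insert, Finset.mem_singleton] at this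
    rcases this with rfl | rfl
    · rw [hx] at hq; simp [bigon, overpass] at hq ⊢; grind
    · rw [hy] at hq; simp [bigon, underpass] at hq ⊢; grind
  over_at k hk := by
    simp only [bigon, Finset.mem_insert, Finset.mem_singleton] at hk
    rcases hk with rfl | rfl
    · exact ⟨[], [overpass m (-s)], by simp [bigon, hx], rfl⟩
    · exact ⟨[overpass n s], [], by simp [bigon, hx, hnm.symm], rfl⟩
  under_at k hk := by
    simp only [bigon, Finset.mem_insert, Finset.mem_singleton] at hk
    refine ⟨y, ?_⟩
    rcases hk with rfl | rfl <;> by_cases hp : p <;> simp only [hp, if_true, if_false] at hy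
    · exact ⟨[], [underpass m (-s)], by simp [bigon, hy], by simp [bigon, hp, arc_nil]⟩
    · exact ⟨[underpass m (-s)], [], by simp [bigon, hy], by simp [bigon, hp, arc, lastUnder, underpass]⟩
    · exact ⟨[underpass n s], [], by simp [bigon, hy, hnm.symm],
        by simp [bigon, hp, hnm.symm, arc, lastUnder, underpass]⟩
    · exact ⟨[], [underpass n s], by simp [bigon, hy, hnm.symm], by simp [bigon, hp, hnm.symm, arc_nil]⟩

theorem det_bigon {K : Type*} [Field K] {x y : L} {n m : ℕ} {s : ℤˣ} (hnm : n ≠ m) (p : Prop)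
    [Decidable p] (w : L → K) : (bigon x y n m s p).det w = 1 := by
  unfold ArcData.det
  rw [← ArcData.det_eq_detOn _ ![n, m], Matrix.det_fin_two]
  · by_cases hp : p <;> simp [ArcData.matrix, ArcData.coeff, bigon, hp, hnm, hnm.symm]
  · intro i j
    fin_cases i <;> fin_cases j <;> simp [hnm, hnm.symm]
  · intro k
    simp [bigon, eq_comm]

theorem trivial_describes (x₀ : L) {D : GaussDiagram X} (h : ∀ x ∈ X, D.code x = []) :
    (⟨∅, fun _ => 1, fun _ => x₀, fun _ => .inl x₀, fun _ => .inl x₀⟩ : ArcData L).Describes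
      D.code where
  mem_names x p hp := by
    rw [h x (D.mem_of_mem_code hp)] at hp
    simp at hp
  over_at n hn := by simp at hn
  under_at n hn := by simp at hn

/-- Passing under `x` acts on colors as an affine map that fixes the color of `x` and has slope
`t^s`. The two crossings have slopes inverse to each other and the same fixed point, so their
composition is the identity; the determinant is `1` as for a diagram without crossings. -/
theorem gamma_r2 [Infinite L] {D D' : GaussDiagram X} {n m : ℕ} {s : ℤˣ}
    (h1 : Adjacent D.code (overpass n s) (overpass m (-s)))
    (h2 : Adjacent D.code (underpass n s) (underpass m (-s)) ∨
      Adjacent D.code (underpass m (-s)) (underpass n s))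
    (hD : D'.code = eraseCode n m D.code) : D.gamma = D'.gamma := by
  classical
  have hnm : n ≠ m := ne_of_adjacent h1 rfl
  -- The proposition `p` records whether the two pieces are parallel, so that both cases can be
  -- treated together.
  obtain ⟨p, hp⟩ : ∃ p : Prop, ∃ x, (if p then [underpass n s, underpass m (-s)] else
      [underpass m (-s), underpass n s]) <:+: D.code x := by
    rcases h2 with h2 | h2
    · exact ⟨True, by simpa [Adjacent] using h2⟩
    · exact ⟨False, by simpa [Adjacent] using h2⟩
  have hmem : ∀ q, q ∈ (if p then [underpass n s, underpass m (-s)] else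
      [underpass m (-s), underpass n s]) ↔ q = underpass n s ∨ q = underpass m (-s) := by
    intro q
    split_ifs <;> simp [or_comm]
  refine gamma_eq_of_local_two
    (g := Option.guard fun q : Pass => decide (q.1 ≠ n ∧ q.1 ≠ m))
    (b₁ := [overpass n s, overpass m (-s)])
    (fun z => by rw [hD, List.filterMap_eq_filter]; rfl) (by simp) (by split_ifs <;> simp) h1 hp
    ?_ ?_ ?_ ?_ ?_
  · intro q hq
    rw [hmem]
    simp only [List.mem_cons, List.not_mem_nil, or_false] at hq
    rcases hq with rfl | rfl <;> simp [overpass, underpass]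
  · intro q hq
    rw [List.mem_append, hmem] at hq ⊢
    simp only [List.mem_cons, List.not_mem_nil, or_false] at hq ⊢
    rcases hq with (rfl | rfl) | rfl | rfl <;> simp [overpass, underpass, Pass.other]
  · intro q hq
    have h1 := hq (overpass n s) (by simp)
    have h2 := hq (overpass m (-s)) (by simp)
    simp only [overpass] at h1 h2
    simp [Option.guard, Ne.symm h1, Ne.symm h2]
  · intro q hq q' e
    simp only [Option.guard, Option.ite_none_right_eq_some, Option.some.injEq] at e
    exact e.2 ▸ hq
  · intro x y F F' hxy hx hy hx' hy'
    rw [List.filterMap_eq_filter] at hx' hy'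
    have hx' : F'.code x = [] := by rw [hx']; simp [overpass]
    have hy' : F'.code y = [] := by
      rw [hy', List.filter_eq_nil_iff]
      intro q hq
      rcases (hmem q).1 hq with rfl | rfl <;> simp [underpass]
    refine gamma_congr (describes_bigon hnm p hx hy) (trivial_describes x (D := F') ?_) ?_ ?_
    · intro u hu
      simp only [Finset.mem_insert, Finset.mem_singleton] at hu
      rcases hu with rfl | rfl
      · exact hx'
      · exact hy'
    · intro w
      rw [det_bigon hnm]
      simp [ArcData.det, ArcData.detOn]
    · intro w hw f hf
      refine ⟨f, fun k hk => by simp at hk, fun z => rfl, fun j hj => ?_⟩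
      have e1 := hf n (by simp [bigon])
      have e2 := hf m (by simp [bigon])
      have e3 : w x ^ (s : ℤ) * w x ^ ((-s : ℤˣ) : ℤ) = 1 := by
        rw [← zpow_add₀ (hw.ne_zero x)]
        simp
      simp only [bigon, ArcData.wt, if_true, hnm.symm, if_false] at e1 e2
      simp only [Finset.mem_insert, Finset.mem_singleton] at hj
      rcases hj with rfl | rfl
      · rw [hx, hx']; rfl
      · rw [hy, hy']
        by_cases hp : p
        · simp only [hp, if_true] at e1 e2 ⊢
          change f (.inl j) = f (.inr m)
          rw [e2, e1]
          linear_combination (f (.inl x) - f (.inl j)) * e3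
        · simp only [hp, if_false] at e1 e2 ⊢
          change f (.inl j) = f (.inr n)
          rw [e1, e2]
          linear_combination (f (.inl x) - f (.inl j)) * e3

/-- The description of three pieces of strand in the position of the third Reidemeister move. -/
def triangle (x y z : L) (n₁ n₂ n₃ : ℕ) (s₁ s₂ s₃ : ℤˣ) (p q : Prop) [Decidable p] [Decidable q] :
    ArcData L where
  names := {n₁, n₂, n₃}
  sign k := if k = n₁ then s₁ else if k = n₂ then s₂ else s₃
  overStrand k := if k = n₃ then y else x
  overArc k := if k = n₃ then if p then .inr n₁ else .inl y else .inl x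
  underArc k := if k = n₁ then .inl y else if k = n₂ then if q then .inl z else .inr n₃ else
    if q then .inr n₂ else .inl z

theorem describes_triangle {x y z : L} {D : GaussDiagram ({x, y, z} : Finset L)} {n₁ n₂ n₃ : ℕ}
    {s₁ s₂ s₃ : ℤˣ} (h₁₂ : n₁ ≠ n₂) (h₁₃ : n₁ ≠ n₃) (h₂₃ : n₂ ≠ n₃) (p q : Prop) [Decidable p]
    [Decidable q]
    (hx : D.code x = [overpass n₁ s₁, overpass n₂ s₂] ∨
      D.code x = [overpass n₂ s₂, overpass n₁ s₁])
    (hy : D.code y = if p then [underpass n₁ s₁, overpass n₃ s₃] else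
      [overpass n₃ s₃, underpass n₁ s₁])
    (hz : D.code z = if q then [underpass n₂ s₂, underpass n₃ s₃] else
      [underpass n₃ s₃, underpass n₂ s₂]) :
    (triangle x y z n₁ n₂ n₃ s₁ s₂ s₃ p q).Describes D.code where
  mem_names u r hr := by
    have := D.mem_of_mem_code hr
    simp only [Finset.mem_insert, Finset.mem_singleton] at this
    rcases this with rfl | rfl | rfl
    · rcases hx with hx | hx <;> rw [hx] at hr <;> simp [triangle, overpass] at hr ⊢ <;> grind
    · rw [hy] at hr; simp [triangle, underpass, overpass] at hr ⊢; grind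
    · rw [hz] at hr; simp [triangle, underpass] at hr ⊢; grind
  over_at k hk := by
    simp only [triangle, Finset.mem_insert, Finset.mem_singleton] at hk
    rcases hk with rfl | rfl | rfl
    · rcases hx with hx | hx
      · exact ⟨[], [overpass n₂ s₂], by simp [triangle, hx, h₁₃], by simp [triangle, h₁₃, arc_nil]⟩
      · exact ⟨[overpass n₂ s₂], [], by simp [triangle, hx, h₁₃],
          by simp [triangle, h₁₃, arc, lastUnder, overpass]⟩
    · rcases hx with hx | hx
      · exact ⟨[overpass n₁ s₁], [], by simp [triangle, hx, h₁₂.symm, h₂₃],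
          by simp [triangle, h₂₃, arc, lastUnder, overpass]⟩
      · exact ⟨[], [overpass n₁ s₁], by simp [triangle, hx, h₁₂.symm, h₂₃],
          by simp [triangle, h₂₃, arc_nil]⟩
    · by_cases hp : p <;> simp only [hp, if_true, if_false] at hy
      · exact ⟨[underpass n₁ s₁], [], by simp [triangle, hy, h₁₃.symm, h₂₃.symm],
          by simp [triangle, hp, arc, lastUnder, underpass]⟩
      · exact ⟨[], [underpass n₁ s₁], by simp [triangle, hy, h₁₃.symm, h₂₃.symm],
          by simp [triangle, hp, arc_nil]⟩
  under_at k hk := by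
    simp only [triangle, Finset.mem_insert, Finset.mem_singleton] at hk
    rcases hk with rfl | rfl | rfl
    · refine ⟨y, ?_⟩
      by_cases hp : p <;> simp only [hp, if_true, if_false] at hy
      · exact ⟨[], [overpass n₃ s₃], by simp [triangle, hy], by simp [triangle, arc_nil]⟩
      · exact ⟨[overpass n₃ s₃], [], by simp [triangle, hy],
          by simp [triangle, arc, lastUnder, overpass]⟩
    · refine ⟨z, ?_⟩
      by_cases hq : q <;> simp only [hq, if_true, if_false] at hz
      · exact ⟨[], [underpass n₃ s₃], by simp [triangle, hz, h₁₂.symm],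
          by simp [triangle, hq, h₁₂.symm, arc_nil]⟩
      · exact ⟨[underpass n₃ s₃], [], by simp [triangle, hz, h₁₂.symm],
          by simp [triangle, hq, h₁₂.symm, arc, lastUnder, underpass]⟩
    · refine ⟨z, ?_⟩
      by_cases hq : q <;> simp only [hq, if_true, if_false] at hz
      · exact ⟨[underpass n₂ s₂], [], by simp [triangle, hz, h₁₃.symm, h₂₃.symm],
          by simp [triangle, hq, h₁₃.symm, h₂₃.symm, arc, lastUnder, underpass]⟩
      · exact ⟨[], [underpass n₂ s₂], by simp [triangle, hz, h₁₃.symm, h₂₃.symm],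
          by simp [triangle, hq, h₁₃.symm, h₂₃.symm, arc_nil]⟩

/-- References between the crossings have no cycle: `n₃` may refer to `n₁`, and exactly one of `n₂`,
`n₃` refers to the other. In a suitable order the matrix is triangular with `1` on the diagonal. -/
theorem det_triangle {K : Type*} [Field K] (x y z : L) {n₁ n₂ n₃ : ℕ} (s₁ s₂ s₃ : ℤˣ)
    (h₁₂ : n₁ ≠ n₂) (h₁₃ : n₁ ≠ n₃) (h₂₃ : n₂ ≠ n₃) (p q : Prop) [Decidable p] [Decidable q]
    (w : L → K) : (triangle x y z n₁ n₂ n₃ s₁ s₂ s₃ p q).det w = 1 := by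
  unfold ArcData.det
  rw [← ArcData.det_eq_detOn _ ![n₁, n₂, n₃], Matrix.det_fin_three]
  · by_cases hp : p <;> by_cases hq : q <;> simp [ArcData.matrix, ArcData.coeff, triangle, hp, hq,
      h₁₂, h₁₂.symm, h₁₃, h₁₃.symm, h₂₃, h₂₃.symm]
  · intro i j
    fin_cases i <;> fin_cases j <;> simp [h₁₂, h₁₂.symm, h₁₃, h₁₃.symm, h₂₃, h₂₃.symm]
  · intro k
    simp [triangle, Fin.exists_fin_succ, eq_comm]

/-- The reason is self-distributivity: passing under `x` is an affine map with fixed point the color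
of `x`, and affine maps preserve the combination `(1 - t) * u + t * v` formed where `z` passes under
`y`. The signs decide the order of the crossings on `y` and `z`, and thus whether the map or its
inverse acts. -/
theorem exists_isColoring_triangle {K : Type*} [Field K] (x y z : L) {n₁ n₂ n₃ : ℕ}
    (s₁ s₂ s₃ : ℤˣ) (h₁₂ : n₁ ≠ n₂) (h₁₃ : n₁ ≠ n₃) (h₂₃ : n₂ ≠ n₃) {w : L → K}
    (hw : w x ≠ 0) {f : L ⊕ ℕ → K}
    (hf : (triangle x y z n₁ n₂ n₃ s₁ s₂ s₃ (s₂ * s₃ = 1) (s₁ * s₃ = 1)).IsColoring w f) :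
    ∃ g : L ⊕ ℕ → K,
      (triangle x y z n₁ n₂ n₃ s₁ s₂ s₃ (¬ s₂ * s₃ = 1) (¬ s₁ * s₃ = 1)).IsColoring w g ∧
      (∀ u, g (.inl u) = f (.inl u)) ∧ g (.inr n₁) = f (.inr n₁) ∧
      g (if s₁ * s₃ = 1 then .inr n₂ else .inr n₃) =
        f (if s₁ * s₃ = 1 then .inr n₃ else .inr n₂) := by
  have e1 := hf n₁ (by simp [triangle])
  have e2 := hf n₂ (by simp [triangle])
  have e3 := hf n₃ (by simp [triangle])
  simp only [triangle, ArcData.wt, h₁₂.symm, h₁₃, h₁₃.symm, h₂₃, h₂₃.symm, if_true, if_false]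
    at e1 e2 e3
  -- The arc after `n₁` and the arc at the head of `z` keep their colors, but the latter now starts
  -- at the other one of `n₂` and `n₃`. Only the inner arc of `z` gets a new color, read off from
  -- its equation in the reversed order.
  let g : L ⊕ ℕ → K := Sum.elim (fun u => f (.inl u)) fun k =>
    if k = n₁ then f (.inr n₁) else
    if k = n₂ then
      if s₁ * s₃ = 1 then f (.inr n₃) else
        (1 - w x ^ (s₂ : ℤ)) * f (.inl x) + w x ^ (s₂ : ℤ) * f (.inl z)
    else
      if s₁ * s₃ = 1 then
        (1 - w y ^ (s₃ : ℤ)) * (if s₂ * s₃ = 1 then f (.inl y) else f (.inr n₁)) +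
          w y ^ (s₃ : ℤ) * f (.inl z)
      else f (.inr n₂)
  refine ⟨g, ?_, fun u => rfl, by simp [g], ?_⟩
  · intro k hk
    simp only [triangle, Finset.mem_insert, Finset.mem_singleton] at hk
    have hwi : w x * (w x)⁻¹ = 1 := mul_inv_cancel₀ hw
    rcases hk with rfl | rfl | rfl
    · simpa [triangle, ArcData.wt, g, h₁₃] using e1
    · rcases Int.units_eq_one_or s₁ with rfl | rfl <;>
        rcases Int.units_eq_one_or s₂ with rfl | rfl <;>
        rcases Int.units_eq_one_or s₃ with rfl | rfl <;>
        simp [triangle, ArcData.wt, g, h₁₂.symm, h₁₃.symm, h₂₃, h₂₃.symm] at e1 e2 e3 ⊢ <;>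
        grind
    · rcases Int.units_eq_one_or s₁ with rfl | rfl <;>
        rcases Int.units_eq_one_or s₂ with rfl | rfl <;>
        rcases Int.units_eq_one_or s₃ with rfl | rfl <;>
        simp [triangle, ArcData.wt, g, h₁₂.symm, h₁₃.symm, h₂₃.symm] at e1 e2 e3 ⊢ <;>
        grind
  · split_ifs with h <;> simp [g, h, h₁₂.symm, h₁₃.symm, h₂₃.symm]

/-- On the isolated pieces, the move reverses the order on the top piece and negates the two
propositions that fix the orders on the middle and bottom pieces. Both determinants are `1`, and the
colorings correspond by `exists_isColoring_triangle`. -/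
theorem gamma_r3 [Infinite L] {D D' : GaussDiagram X} {n₁ n₂ n₃ : ℕ} {s₁ s₂ s₃ : ℤˣ}
    (h₁₂ : n₁ ≠ n₂) (h₁₃ : n₁ ≠ n₃) (h₂₃ : n₂ ≠ n₃)
    (htop : Adjacent D.code (overpass n₁ s₁) (overpass n₂ s₂))
    (hmiddle : AdjacentSign D.code (s₂ * s₃) (underpass n₁ s₁) (overpass n₃ s₃))
    (hbottom : AdjacentSign D.code (s₁ * s₃) (underpass n₂ s₂) (underpass n₃ s₃))
    (hD : D'.code = swapCode (overpass n₁ s₁) (overpass n₂ s₂)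
      (swapCode (underpass n₁ s₁) (overpass n₃ s₃)
        (swapCode (underpass n₂ s₂) (underpass n₃ s₃) D.code))) : D.gamma = D'.gamma := by
  have key : ∀ {e : ℤˣ} {p q : Pass}, AdjacentSign D.code e p q →
      ∃ x, (if e = 1 then [p, q] else [q, p]) <:+: D.code x := by
    rintro e p q (⟨rfl, h⟩ | ⟨rfl, h⟩)
    · simpa [Adjacent] using h
    · simpa [Adjacent] using h
  have hb : ∀ (e : ℤˣ) (p q r : Pass),
      r ∈ (if e = 1 then [p, q] else [q, p]) ↔ r = p ∨ r = q := by
    intro e p q r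
    split_ifs <;> simp [or_comm]
  set f : Pass → Pass := fun r => Equiv.swap (overpass n₁ s₁) (overpass n₂ s₂)
    (Equiv.swap (underpass n₁ s₁) (overpass n₃ s₃)
      (Equiv.swap (underpass n₂ s₂) (underpass n₃ s₃) r)) with hf
  have f1 : f (overpass n₁ s₁) = overpass n₂ s₂ := by
    simp [hf, Equiv.swap_apply_def, overpass, underpass, h₁₃]
  have f2 : f (overpass n₂ s₂) = overpass n₁ s₁ := by
    simp [hf, Equiv.swap_apply_def, overpass, underpass, h₁₂.symm, h₂₃]
  have f3 : f (underpass n₁ s₁) = overpass n₃ s₃ := by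
    simp [hf, Equiv.swap_apply_def, overpass, underpass, h₁₂, h₁₃, h₁₃.symm, h₂₃.symm]
  have f4 : f (overpass n₃ s₃) = underpass n₁ s₁ := by
    simp [hf, Equiv.swap_apply_def, overpass, underpass]
  have f5 : f (underpass n₂ s₂) = underpass n₃ s₃ := by
    simp [hf, Equiv.swap_apply_def, overpass, underpass, h₁₃.symm]
  have f6 : f (underpass n₃ s₃) = underpass n₂ s₂ := by
    simp [hf, Equiv.swap_apply_def, overpass, underpass, h₁₂.symm, h₂₃.symm]
  have hfix : ∀ r : Pass, r.1 ≠ n₁ → r.1 ≠ n₂ → r.1 ≠ n₃ → f r = r := by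
    rintro ⟨n, b, s⟩ h1 h2 h3
    simp only at h1 h2 h3
    simp [hf, Equiv.swap_apply_def, overpass, underpass, h1, h2, h3]
  refine gamma_eq_of_local (g := some ∘ f) (fun z => ?_) ?_ ?_ ?_ htop (key hmiddle) (key hbottom)
    ?_ ?_ ?_ ?_ ?_ ?_ ?_
  · rw [hD, List.filterMap_eq_map]
    simp only [swapCode, List.map_map]
    rfl
  · simp
  · split_ifs <;> simp
  · split_ifs <;> simp
  · intro r hr
    rw [hb]
    simp only [List.mem_cons, List.not_mem_nil, or_false] at hr
    rcases hr with rfl | rfl <;> simp [overpass, underpass, h₁₃, h₂₃]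
  · intro r hr
    rw [hb]
    simp only [List.mem_cons, List.not_mem_nil, or_false] at hr
    rcases hr with rfl | rfl <;> simp [overpass, underpass]
  · intro r hr
    rw [hb] at hr ⊢
    rcases hr with rfl | rfl <;> simp [overpass, underpass, h₁₂, h₁₃]
  · intro r hr
    simp only [List.mem_append, hb, List.mem_cons, List.not_mem_nil, or_false] at hr ⊢
    rcases hr with ((rfl | rfl) | rfl | rfl) | rfl | rfl <;> simp [overpass, underpass, Pass.other]
  · intro r hr
    simp only [List.mem_append, hb, List.mem_cons, List.not_mem_nil, or_false] at hr
    exact congrArg some (hfix r (Ne.symm (hr (overpass n₁ s₁) (by simp)))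
      (Ne.symm (hr (overpass n₂ s₂) (by simp))) (Ne.symm (hr (overpass n₃ s₃) (by simp))))
  · rintro r hr _ ⟨⟩
    simp only [List.mem_append, hb, List.mem_cons, List.not_mem_nil, or_false] at hr ⊢
    rcases hr with ((rfl | rfl) | rfl | rfl) | rfl | rfl <;> simp [f1, f2, f3, f4, f5, f6]
  · intro x y z F F' hxy hxz hyz hx hy hz hx' hy' hz'
    simp only [List.filterMap_eq_map, List.map_cons, List.map_nil, f1, f2, f3, f4, f5, f6,
      apply_ite (List.map f)] at hx' hy' hz'
    refine gamma_congr (describes_triangle h₁₂ h₁₃ h₂₃ _ _ (Or.inl hx) hy hz)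
      (describes_triangle h₁₂ h₁₃ h₂₃ (¬ s₂ * s₃ = 1) (¬ s₁ * s₃ = 1) (Or.inr hx')
        (by rw [hy', ite_not]) (by rw [hz', ite_not])) (fun w => ?_) fun w hw f hf => ?_
    · rw [det_triangle _ _ _ _ _ _ h₁₂ h₁₃ h₂₃, det_triangle _ _ _ _ _ _ h₁₂ h₁₃ h₂₃]
    · obtain ⟨g, hg, hg1, hg2, hg3⟩ :=
        exists_isColoring_triangle x y z s₁ s₂ s₃ h₁₂ h₁₃ h₂₃ (hw.ne_zero x) hf
      refine ⟨g, hg, hg1, fun j hj => ?_⟩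
      simp only [Finset.mem_insert, Finset.mem_singleton] at hj
      rcases hj with rfl | rfl | rfl
      · rw [hx, hx']
        exact hg1 j
      -- In either order the head of `y` lies on the arc after `n₁`, because `n₃` is passed over.
      · rw [hy, hy']
        split_ifs
        · exact hg2
        · exact hg2
      · rw [hz, hz']
        split_ifs at hg3 ⊢
        · exact hg3
        · exact hg3

theorem gamma_move [Infinite L] {D D' : GaussDiagram X} (h : GaussMove D D') :
    D.gamma = D'.gamma := by
  cases h with
  | relabel f hf h => exact (gamma_relabel hf h).symm
  | r2 n m s h1 h2 h => exact gamma_r2 h1 h2 h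
  | r3 n₁ n₂ n₃ s₁ s₂ s₃ h₁₂ h₁₃ h₂₃ h1 h2 h3 h => exact gamma_r3 h₁₂ h₁₃ h₂₃ h1 h2 h3 h
  | oc n m s s' h1 h => exact gamma_oc h1 h

end GaussDiagram

/-! ### Generation of the w-tangles by crossings -/

namespace GaussDiagram

variable {L : Type*} [DecidableEq L] {X Y Z : Finset L}

/-- A measure for the number of cuts and of unions that are needed to build `D` from
crossings. -/
def complexity (D : GaussDiagram X) : ℕ := ∑ x ∈ X, (2 * (D.code x).length - 1)

/-- A strand with `k > 0` passages counts `2 * k - 1`, and by truncation an empty one counts `0`. A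
cut into two nonempty pieces therefore lowers the sum by `1`. -/
theorem complexity_split (D : GaussDiagram X) {x y : L} (hx : x ∈ X) (hy : y ∉ X)
    {l m : List Pass} (hl : l ≠ []) (hm : m ≠ []) (h : D.code x = l ++ m) :
    (D.split hx hy h).complexity < D.complexity := by
  have hxy : x ≠ y := by rintro rfl; exact hy hx
  have h1 := List.length_pos_iff.2 hl
  have h2 := List.length_pos_iff.2 hm
  unfold complexity
  rw [Finset.sum_insert hy, ← Finset.add_sum_erase X _ hx, ← Finset.add_sum_erase X _ hx,
    Finset.sum_congr rfl (g := fun x => 2 * (D.code x).length - 1)]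
  · simp only [split, if_true, if_neg hxy, h, List.length_append]
    omega
  · intro z hz
    have hzy : z ≠ y := by rintro rfl; exact hy (Finset.mem_of_mem_erase hz)
    simp only [split, if_neg hzy, if_neg (Finset.ne_of_mem_erase hz)]

theorem eq_trivial {D : GaussDiagram X} (h : ∀ x, D.code x = []) : D = trivial X :=
  GaussDiagram.ext (funext h)

end GaussDiagram

namespace WTangle

variable {L : Type*} [DecidableEq L] [Infinite L] {X Y Z : Finset L}

/-- The w-tangles are generated by the crossings under stitching and disjoint unions. -/
theorem induction {P : ∀ X : Finset L, WTangle X → Prop} (htriv : ∀ X, P X (trivial X))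
    (hcross : ∀ (a b : L) (hab : a ≠ b) (s : ℤˣ), P {a, b} (crossing a b hab s))
    (hstitch : ∀ {a b c : L} {X Y : Finset L} (h : Stitches a b c X Y) (T : WTangle X),
      P X T → P Y ((wTangles L).stitch h T))
    (hunion : ∀ {X Y Z : Finset L} (h : Splits X Y Z) (T : WTangle X) (U : WTangle Y),
      P X T → P Y U → P Z ((wTangles L).union h T U)) (X : Finset L) (T : WTangle X) : P X T := by
  obtain ⟨D, rfl⟩ := Quot.exists_rep T
  induction hn : D.complexity using Nat.strong_induction_on generalizing X with
  | _ n ih =>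
  subst hn
  -- A strand with several passages is cut after the first one. Otherwise each strand has at most
  -- one passage, so the two strands of any crossing carry nothing else and split off.
  by_cases h2 : ∃ x, 2 ≤ (D.code x).length
  · obtain ⟨x, hx⟩ := h2
    obtain ⟨p, m, hm⟩ : ∃ p m, D.code x = [p] ++ m := by
      cases e : D.code x with
      | nil => simp [e] at hx
      | cons p m => exact ⟨p, m, rfl⟩
    have hm0 : m ≠ [] := by
      rintro rfl
      simp [hm] at hx
    have hxX : x ∈ X := D.mem_of_mem_code (p := p) (by simp [hm])
    obtain ⟨y, hy⟩ := Infinite.exists_notMem_finset X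
    have := hstitch (GaussDiagram.stitches_split hxX hy) _
      (ih _ (D.complexity_split hxX hy (by simp) hm0 hm) _ _ rfl)
    change P X (Quot.mk _ (GaussDiagram.stitch _ _)) at this
    rwa [GaussDiagram.stitch_split] at this
  push Not at h2
  by_cases h0 : ∀ x, D.code x = []
  · rw [GaussDiagram.eq_trivial h0]
    exact htriv X
  push Not at h0
  obtain ⟨x, hx⟩ := h0
  have hone : ∀ {x : L} {p : Pass}, p ∈ D.code x → D.code x = [p] := by
    intro x p hp
    have h3 := h2 x
    cases e : D.code x with
    | nil => simp [e] at hp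
    | cons q m =>
      rw [e] at hp h3
      have : m = [] := by simpa using h3
      subst this
      simpa [eq_comm] using hp
  obtain ⟨p, hp⟩ := List.exists_mem_of_ne_nil _ hx
  obtain ⟨⟨a, ha⟩, b, hb⟩ := D.exists_over_under hp
  set k := p.1
  set s := p.2.2
  have hab : a ≠ b := by
    rintro rfl
    have := hone ha
    rw [hone hb] at this
    simp [overpass, underpass] at this
  have hS : ({a, b} : Finset L) ⊆ X := by
    intro u hu
    simp only [Finset.mem_insert, Finset.mem_singleton] at hu
    rcases hu with rfl | rfl
    · exact D.mem_of_mem_code ha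
    · exact D.mem_of_mem_code hb
  have hsep : ∀ x ∈ ({a, b} : Finset L), ∀ p ∈ D.code x, ∀ y ∉ ({a, b} : Finset L),
      ∀ q ∈ D.code y, p.1 ≠ q.1 := by
    intro x hx p hp y hy q hq e
    have hpk : p.1 = k := by
      simp only [Finset.mem_insert, Finset.mem_singleton] at hx
      rcases hx with rfl | rfl
      · rw [hone ha, List.mem_singleton] at hp
        rw [hp]; rfl
      · rw [hone hb, List.mem_singleton] at hp
        rw [hp]; rfl
    apply hy
    rcases hq2 : q.2.1 with _ | _
    · rw [D.disj y b q hq _ hb (e.symm.trans hpk) hq2]; simp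
    · rw [D.disj y a q hq _ ha (e.symm.trans hpk) hq2]; simp
  obtain ⟨f, hf, e⟩ := D.exists_union_part hS hsep
  have h3 : (Quot.mk _ D : WTangle X) = (wTangles L).union (GaussDiagram.splits_sdiff hS)
      (Quot.mk _ (D.part _ hsep)) (Quot.mk _ (D.part _ (GaussDiagram.separate_symm hsep))) :=
    Quot.sound (.relabel f hf e)
  have h4 : (Quot.mk _ (D.part _ hsep) : WTangle ({a, b} : Finset L)) = crossing a b hab s := by
    -- The only crossing of `crossing a b hab s` is named `0`; the shift renames it to `k`.
    refine (Quot.sound (.relabel (fun i => k + i) (add_right_injective k) ?_)).symm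
    funext u
    simp only [GaussDiagram.part, GaussDiagram.crossing, Finset.mem_insert, Finset.mem_singleton]
    by_cases hua : u = a
    · subst hua
      simp [hone ha, Pass.relabel, overpass]
    by_cases hub : u = b
    · subst hub
      simp [hone hb, Pass.relabel, underpass, hua]
    · simp [hua, hub]
  rw [h3, h4]
  refine hunion _ _ _ (hcross a b hab s) (ih _ ?_ _ _ rfl)
  -- The two strands that split off have one passage each and count `1` each, so the rest is smaller
  -- by `2`.
  unfold GaussDiagram.complexity
  rw [← Finset.sum_sdiff hS, Finset.sum_pair hab, hone ha, hone hb,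
    Finset.sum_congr rfl (g := fun x => 2 * (D.code x).length - 1)]
  · simp
  · intro z hz
    simp only [GaussDiagram.part, if_pos hz]

end WTangle

/-! ### Values on diagrams without crossings and on a single crossing -/

namespace GaussDiagram

variable {L : Type*} [DecidableEq L] [Infinite L] {X Y Z : Finset L}

theorem scalarAt_gamma_trivial {w : L → RatField Z} (hw : UnitalAtOne w) :
    (trivial X).gamma.scalarAt w = 1 := by
  obtain ⟨x⟩ : Nonempty L := inferInstance
  rw [scalarAt_gamma (trivial_describes x (D := trivial X) fun _ _ => rfl) hw]
  simp [ArcData.det, ArcData.detOn]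

theorem matAt_gamma_trivial {w : L → RatField Z} (hw : UnitalAtOne w) {i j : L} (hi : i ∈ X)
    (hj : j ∈ X) : (trivial X).gamma.matAt w i j = if i = j then 1 else 0 := by
  obtain ⟨x⟩ : Nonempty L := inferInstance
  rw [matAt_gamma (trivial_describes x (D := trivial X) fun _ _ => rfl) hw hi hj]
  simp [trivial, arc_nil, ArcData.color_inl, eq_comm]

theorem describes_crossing {a b : L} (hab : a ≠ b) (s : ℤˣ) :
    (⟨{0}, fun _ => s, fun _ => a, fun _ => .inl a, fun _ => .inl b⟩ : ArcData L).Describes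
      (crossing a b hab s).code where
  mem_names x p hp := by
    simp only [crossing] at hp
    split_ifs at hp <;> simp_all [overpass, underpass]
  over_at n hn := by
    obtain rfl := Finset.mem_singleton.1 hn
    exact ⟨[], [], by simp [crossing], rfl⟩
  under_at n hn := by
    obtain rfl := Finset.mem_singleton.1 hn
    exact ⟨b, [], [], by simp [crossing, hab.symm], rfl⟩

theorem scalarAt_gamma_crossing {a b : L} (hab : a ≠ b) (s : ℤˣ) {w : L → RatField Z}
    (hw : UnitalAtOne w) : (crossing a b hab s).gamma.scalarAt w = 1 := by
  rw [scalarAt_gamma (describes_crossing hab s) hw]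
  unfold ArcData.det
  rw [← ArcData.det_eq_detOn _ (fun _ : Unit => 0)]
  · simp [ArcData.matrix, ArcData.coeff]
  · exact Function.injective_of_subsingleton _
  · simp [eq_comm]

theorem matAt_gamma_crossing {a b : L} (hab : a ≠ b) (s : ℤˣ) {w : L → RatField Z}
    (hw : UnitalAtOne w) {i : L} (hi : i ∈ ({a, b} : Finset L)) :
    (crossing a b hab s).gamma.matAt w i a = (if i = a then 1 else 0) ∧
    (crossing a b hab s).gamma.matAt w i b =
      if i = a then 1 - w a ^ (s : ℤ) else w a ^ (s : ℤ) := by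
  have hd := describes_crossing hab s
  rw [matAt_gamma hd hw hi (by simp), matAt_gamma hd hw hi (by simp)]
  have h := ArcData.isColoring_color hd.closed (hd.det_ne_zero hw) i 0 (by simp)
  constructor
  · simp [crossing, arc, lastUnder, overpass, ArcData.color_inl, eq_comm]
  · have e : arc b ((crossing a b hab s).code b) = .inr 0 := by
      simp [crossing, arc, lastUnder, underpass, hab.symm]
    rw [e, h]
    simp only [Finset.mem_insert, Finset.mem_singleton] at hi
    rcases hi with rfl | rfl
    · simp [ArcData.color_inl, ArcData.wt, hab.symm]
    · simp [ArcData.color_inl, ArcData.wt, hab, hab.symm]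

end GaussDiagram

/-! ### The homomorphism, its uniqueness, and the kink -/

namespace WTangle

variable {L : Type*} [DecidableEq L] [Infinite L] {X Y Z : Finset L}

/-- The invariant of w-tangles with values in `Γ`. -/
noncomputable def gamma (T : WTangle X) : Gamma X :=
  Quot.lift GaussDiagram.gamma (fun _ _ => GaussDiagram.gamma_move) T

theorem gamma_stitch {a b c : L} (h : Stitches a b c X Y) (T : WTangle X) :
    gamma ((wTangles L).stitch h T) = Gamma.stitch h T.gamma := by
  obtain ⟨D, rfl⟩ := Quot.exists_rep T
  exact GaussDiagram.gamma_stitch h D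

theorem gamma_one {a : L} (h : Extends a X Y) (T : WTangle X) :
    gamma ((wTangles L).one h T) = Gamma.one h T.gamma := by
  obtain ⟨D, rfl⟩ := Quot.exists_rep T
  exact GaussDiagram.gamma_one h D

theorem gamma_union (h : Splits X Y Z) (T : WTangle X) (U : WTangle Y) :
    gamma ((wTangles L).union h T U) = Gamma.union h T.gamma U.gamma := by
  obtain ⟨D, rfl⟩ := Quot.exists_rep T
  obtain ⟨E, rfl⟩ := Quot.exists_rep U
  exact GaussDiagram.gamma_union h D E

/-- By the unit law, renaming `a` to `b` is the same as adding a trivial strand `u` and stitching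
`u` to `a` as `b`, on both sides. So nothing new has to be computed. -/
theorem gamma_rename {a b : L} (h : Relabels a b X Y) (T : WTangle X) :
    gamma ((wTangles L).rename h T) = Gamma.rename h T.gamma := by
  obtain ⟨u, hu⟩ := Infinite.exists_notMem_finset X
  obtain ⟨S, ha, hb, rfl, rfl⟩ := id h
  simp only [Finset.mem_insert, not_or] at hu
  have h1 : Extends u (insert a S) (insert u (insert a S)) := ⟨by simp [hu], rfl⟩
  have h2 : Stitches u a b (insert u (insert a S)) (insert b S) :=
    ⟨S, hu.1, hu.2, ha, hb, rfl, rfl⟩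
  exact (congrArg gamma ((wTangles_isMetaMonoid L).left_one h1 h2 h T)).symm.trans <|
    (gamma_stitch h2 _).trans <| (congrArg (Gamma.stitch h2) (gamma_one h1 T)).trans <|
    (Gamma.isPreMetaMonoid L).left_one h1 h2 h _

/-- For a crossing, the only nonzero off-diagonal entry `1 - t_a^s` is in row `a` and vanishes at
`t_a = 1`. The condition passes to all w-tangles because it is closed under stitching and union. -/
theorem gamma_rowCondition (T : WTangle X) : Gamma.RowCondition X T.gamma := by
  refine induction (P := fun X T => Gamma.RowCondition X (gamma T)) (fun X => ?_)
    (fun a b hab s => ?_) (fun h T hT => ?_) (fun h T U hT hU => ?_) X T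
  · refine Gamma.rowCondition_of_matAt fun w hw i hi j hj hij _ => ?_
    exact (GaussDiagram.matAt_gamma_trivial hw hi hj).trans (if_neg hij)
  · refine Gamma.rowCondition_of_matAt fun w hw i hi j hj hij hwi => ?_
    obtain ⟨h1, h2⟩ := GaussDiagram.matAt_gamma_crossing hab s hw hi
    change (GaussDiagram.crossing a b hab s).gamma.matAt w i j = 0
    simp only [Finset.mem_insert, Finset.mem_singleton] at hi hj
    rcases hj with rfl | rfl
    · rw [h1, if_neg hij]
    · obtain rfl := hi.resolve_right hij
      rw [h2, if_pos rfl, hwi]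
      simp
  · rw [gamma_stitch]
    exact (Gamma.isClosed_rowCondition L).stitch h _ hT
  · rw [gamma_union]
    exact (Gamma.isClosed_rowCondition L).union h _ _ hT hU

/-- `T` and all w-tangles obtained from it by less than `n` deletions are such that `gamma`
respects deletions in them. -/
def RespectsDel : ℕ → ∀ X : Finset L, WTangle X → Prop
  | 0, _, _ => True
  | n + 1, X, T => ∀ (a : L) (Z : Finset L) (h : Extends a Z X),
      gamma ((wTangles L).del h T) = Gamma.del h T.gamma ∧
        RespectsDel n Z ((wTangles L).del h T)

theorem respectsDel_trivial (n : ℕ) (X : Finset L) : RespectsDel n X (trivial X) := by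
  induction n generalizing X with
  | zero => exact True.intro
  | succ n ih =>
    intro a Z h
    -- Adding a strand does not change the code, so the trivial w-tangle is obtained from a smaller
    -- one, and the law for `e_a` followed by `η_a` applies.
    have h1 : (trivial X : WTangle X) = (wTangles L).one h (trivial Z) := rfl
    have h2 : (wTangles L).del h (trivial X) = trivial Z := by
      rw [h1]
      exact (wTangles_isMetaMonoid L).one_del h (trivial Z)
    refine ⟨?_, by rw [h2]; exact ih Z⟩
    rw [h2, h1, gamma_one]
    exact ((Gamma.isPreMetaMonoid L).one_del h _).symm

theorem del_crossing {a b e : L} (hab : a ≠ b) (s : ℤˣ) (h : Extends e X {a, b}) :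
    (wTangles L).del h (crossing a b hab s) = trivial X := by
  refine congrArg (Quot.mk _) (GaussDiagram.eq_trivial fun x => ?_)
  have he := h.mem_new
  simp only [Finset.mem_insert, Finset.mem_singleton] at he
  simp only [GaussDiagram.del, GaussDiagram.crossing]
  rcases he with rfl | rfl <;> split_ifs <;>
    simp_all [GaussDiagram.offStrand, overpass, underpass]

theorem respectsDel_crossing (n : ℕ) {a b : L} (hab : a ≠ b) (s : ℤˣ) :
    RespectsDel n {a, b} (crossing a b hab s) := by
  cases n with
  | zero => exact True.intro
  | succ n =>
    intro e Z h
    rw [del_crossing]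
    refine ⟨?_, respectsDel_trivial n Z⟩
    refine Gamma.ext_at (fun w hw => ?_) (fun w hw i hi j hj => ?_)
    · rw [Gamma.scalarAt_del h _ hw]
      exact (GaussDiagram.scalarAt_gamma_trivial hw).trans
        (GaussDiagram.scalarAt_gamma_crossing hab s (hw.update e)).symm
    · rw [Gamma.matAt_del h _ hw hi hj]
      refine (GaussDiagram.matAt_gamma_trivial hw hi hj).trans ?_
      obtain ⟨h1, h2⟩ :=
        GaussDiagram.matAt_gamma_crossing hab s (hw.update e) (h.mem_of_mem hi)
      change _ = (GaussDiagram.crossing a b hab s).gamma.matAt _ i j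
      have hl := h.labels
      have he := h.mem_new
      simp only [Finset.mem_insert, Finset.mem_singleton] at hl he
      -- One strand is left, so only a diagonal entry has to be checked. It is `1` for the
      -- overstrand, and `t_a^s` for the understrand, where `t_a` has been set to `1`.
      have hij : i = j := by grind
      subst hij
      rw [if_pos rfl]
      rcases he with rfl | rfl
      · have : i = b := by grind
        subst this
        rw [h2, if_neg hab.symm]
        simp
      · have : i = a := by grind
        subst this
        rw [h1, if_pos rfl]

/-- If the stitched strand is deleted, `(*)` for w-tangles turns this into two deletions from `T`,
which is why the hypothesis must cover repeated deletions; on the other side `(*)` holds because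
`gamma T` satisfies the row condition. A deletion of any other strand commutes with the stitching.
-/
theorem respectsDel_stitch {a b c : L} (h : Stitches a b c X Y) {T : WTangle X}
    (hT : ∀ n, RespectsDel n X T) (n : ℕ) : RespectsDel n Y ((wTangles L).stitch h T) := by
  induction n generalizing X Y with
  | zero => exact True.intro
  | succ n ih =>
    intro d Z hd
    by_cases hdc : d = c
    · subst hdc
      obtain ⟨S, hab, ha, hb, hc, rfl, rfl⟩ := id h
      have hZ : Z = S := by
        have := hd.labels
        ext u
        grind
      subst hZ
      have h1 : Extends b (insert a Z) (insert a (insert b Z)) :=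
        ⟨by simp [hab.symm, hb], Finset.insert_comm _ _ _⟩
      have h2 : Extends a Z (insert a Z) := ⟨ha, rfl⟩
      have e : (wTangles L).del hd ((wTangles L).stitch h T) =
        (wTangles L).del h2 ((wTangles L).del h1 T) :=
        (wTangles_isMetaMonoid L).stitch_del h hd h1 h2 T
      have hT1 : ∀ n, RespectsDel n _ ((wTangles L).del h1 T) := fun n => (hT (n + 1) _ _ h1).2
      rw [e]
      refine ⟨?_, (hT1 (n + 1) _ _ h2).2⟩
      rw [(hT1 1 _ _ h2).1, (hT 1 _ _ h1).1, gamma_stitch]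
      exact (Gamma.RowCondition.stitch_del h hd h1 h2 T.gamma_rowCondition).symm
    · obtain ⟨S, hab, ha, hb, hc, rfl, rfl⟩ := id h
      have hdS : d ∈ S := by
        have := hd.mem_new
        simpa [hdc] using this
      have hda : d ≠ a := by rintro rfl; exact ha hdS
      have hdb : d ≠ b := by rintro rfl; exact hb hdS
      have hZ : Z = insert c (S.erase d) := by
        have := hd.labels
        ext u
        grind
      have h1 : Extends d (insert a (insert b (S.erase d))) (insert a (insert b S)) := by
        refine ⟨by simp [hda, hdb], ?_⟩
        ext u
        grind
      have h2 : Stitches a b c (insert a (insert b (S.erase d))) Z :=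
        ⟨S.erase d, hab, by simp [ha], by simp [hb], by simp [hc], rfl, hZ⟩
      have hn : d ∉ ({a, b, c} : Finset L) := by simp [hda, hdb, hdc]
      have e : (wTangles L).del hd ((wTangles L).stitch h T) =
          (wTangles L).stitch h2 ((wTangles L).del h1 T) :=
        (wTangles_isMetaMonoid L).stitch_del_comm hn h hd h1 h2 T
      rw [e]
      refine ⟨?_, ih h2 fun n => (hT (n + 1) _ _ h1).2⟩
      exact (gamma_stitch h2 _).trans <| (congrArg (Gamma.stitch h2) (hT 1 _ _ h1).1).trans <|
        ((Gamma.isPreMetaMonoid L).stitch_del_comm hn h hd h1 h2 _).symm.trans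
          (congrArg (Gamma.del hd) (gamma_stitch h T)).symm

theorem respectsDel_union (h : Splits X Y Z) {T : WTangle X} {U : WTangle Y}
    (hT : ∀ n, RespectsDel n X T) (hU : ∀ n, RespectsDel n Y U) (n : ℕ) :
    RespectsDel n Z ((wTangles L).union h T U) := by
  induction n generalizing X Y Z with
  | zero => exact True.intro
  | succ n ih =>
    intro d V hd
    -- It suffices to treat a deleted strand of the first factor, since the union is commutative.
    have key : ∀ {X Y : Finset L} (h : Splits X Y Z) {T : WTangle X} {U : WTangle Y},
        (∀ n, RespectsDel n X T) → (∀ n, RespectsDel n Y U) → d ∈ X →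
        gamma ((wTangles L).del hd ((wTangles L).union h T U)) =
          Gamma.del hd (gamma ((wTangles L).union h T U)) ∧
          RespectsDel n V ((wTangles L).del hd ((wTangles L).union h T U)) := by
      intro X Y h T U hT hU hdX
      have h1 : Extends d (X.erase d) X := ⟨by simp, (Finset.insert_erase hdX).symm⟩
      have h2 : Splits (X.erase d) Y V := by
        have := hd.labels
        have := h.labels
        refine ⟨h.1.mono_left (Finset.erase_subset _ _), ?_⟩
        ext u
        grind
      have e : (wTangles L).del hd ((wTangles L).union h T U) =
          (wTangles L).union h2 ((wTangles L).del h1 T) U :=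
        (wTangles_isMetaMonoid L).union_del h hd h1 h2 T U
      rw [e]
      refine ⟨?_, ih h2 (fun n => (hT (n + 1) _ _ h1).2) hU⟩
      exact (gamma_union h2 _ U).trans <|
        (congrArg (fun V => Gamma.union h2 V U.gamma) (hT 1 _ _ h1).1).trans <|
        ((Gamma.isPreMetaMonoid L).union_del h hd h1 h2 _ _).symm.trans
          (congrArg (Gamma.del hd) (gamma_union h T U)).symm
    by_cases hdX : d ∈ X
    · exact key h hT hU hdX
    · have h' : Splits Y X Z := ⟨h.1.symm, h.2.trans (Finset.union_comm _ _)⟩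
      have e : (wTangles L).union h T U = (wTangles L).union h' U T :=
        (wTangles_isMetaMonoid L).union_comm h h' T U
      rw [e]
      have := h.labels
      have := hd.mem_new
      exact key h' hU hT (by grind)

theorem gamma_del {a : L} (h : Extends a X Y) (T : WTangle Y) :
    gamma ((wTangles L).del h T) = Gamma.del h T.gamma := by
  have : ∀ n, RespectsDel n Y T := induction (P := fun X T => ∀ n, RespectsDel n X T)
    (fun X n => respectsDel_trivial n X) (fun _ _ hab s n => respectsDel_crossing n hab s)
    (fun h _ hT => respectsDel_stitch h hT) (fun h _ _ hT hU => respectsDel_union h hT hU) Y T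
  exact (this 1 a X h).1

/-- The homomorphism from w-tangles to `Γ`. -/
noncomputable def gammaHom (L : Type*) [DecidableEq L] [Infinite L] :
    MetaMonoidHom (wTangles L) (gammaCalculus L) where
  toFun _ T := gamma T
  map_stitch h T := gamma_stitch h T
  map_one h T := gamma_one h T
  map_del h T := gamma_del h T
  map_union h T U := gamma_union h T U
  map_rename h T := gamma_rename h T

theorem weight_of_mem {a : L} (ha : a ∈ X) : weight X a = tvar ⟨a, ha⟩ := dif_pos ha

theorem sendsCrossings_gammaHom : SendsCrossings (gammaHom L) := by
  intro a b hab s ha hb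
  change (GaussDiagram.crossing a b hab s).gamma.scalar = 1 ∧ _
  have hw := unitalAtOne_weight ({a, b} : Finset L)
  obtain ⟨h1, h2⟩ := GaussDiagram.matAt_gamma_crossing hab s hw ha
  obtain ⟨h3, h4⟩ := GaussDiagram.matAt_gamma_crossing hab s hw hb
  rw [if_pos rfl] at h1 h2
  rw [if_neg hab.symm] at h3 h4
  rw [weight_of_mem ha] at h2 h4
  refine ⟨?_, ?_, ?_, ?_, ?_⟩
  · rw [← Gamma.scalarAt_weight]
    exact GaussDiagram.scalarAt_gamma_crossing hab s hw
  all_goals refine (Gamma.matAt_weight _ _ _).symm.trans ?_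
  · exact h1
  · exact h2
  · exact h3
  · exact h4

theorem _root_.Gamma.IsCrossing.unique {a b : L} {s : ℤˣ} {T U : Gamma ({a, b} : Finset L)}
    (hT : Gamma.IsCrossing a b s T) (hU : Gamma.IsCrossing a b s U) : T = U := by
  have ha : a ∈ ({a, b} : Finset L) := by simp
  have hb : b ∈ ({a, b} : Finset L) := by simp
  obtain ⟨t1, t2, t3, t4, t5⟩ := hT ha hb
  obtain ⟨u1, u2, u3, u4, u5⟩ := hU ha hb
  refine Gamma.ext (t1.trans u1.symm) ?_
  ext ⟨i, hi⟩ ⟨j, hj⟩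
  have hi' := hi
  have hj' := hj
  simp only [Finset.mem_insert, Finset.mem_singleton] at hi' hj'
  rcases hi' with rfl | rfl <;> rcases hj' with rfl | rfl
  · exact t2.trans u2.symm
  · exact t3.trans u3.symm
  · exact t4.trans u4.symm
  · exact t5.trans u5.symm

/-- Agreement on crossings spreads by stitching and union. The generation lemma also starts from the
diagrams without crossings, so agreement on these has to be derived from the crossings as well. -/
theorem hom_unique {φ ψ : MetaMonoidHom (wTangles L) (gammaCalculus L)} (hφ : SendsCrossings φ)
    (hψ : SendsCrossings ψ) : φ = ψ := by
  have hc : ∀ (a b : L) (hab : a ≠ b) (s : ℤˣ),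
      φ.toFun {a, b} (crossing a b hab s) = ψ.toFun {a, b} (crossing a b hab s) :=
    fun a b hab s => (hφ a b hab s).unique (hψ a b hab s)
  have hdel : ∀ {a : L} {X Y : Finset L} (h : Extends a X Y) (T : (wTangles L).carrier Y),
      φ.toFun Y T = ψ.toFun Y T →
      φ.toFun X ((wTangles L).del h T) = ψ.toFun X ((wTangles L).del h T) := by
    intro a X Y h T hT
    rw [φ.map_del, ψ.map_del, hT]
  have hone : ∀ {a : L} {X Y : Finset L} (h : Extends a X Y) (T : (wTangles L).carrier X),
      φ.toFun X T = ψ.toFun X T →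
      φ.toFun Y ((wTangles L).one h T) = ψ.toFun Y ((wTangles L).one h T) := by
    intro a X Y h T hT
    rw [φ.map_one, ψ.map_one, hT]
  -- No operation produces the empty diagram out of nothing, so a homomorphism is not a priori fixed
  -- on it. It arises from a crossing by deleting both strands; trivial strands can then be added
  -- one by one.
  have hempty : φ.toFun ∅ (trivial ∅) = ψ.toFun ∅ (trivial ∅) := by
    obtain ⟨a, b, hab⟩ := exists_pair_ne L
    have h1 : Extends a {b} ({a, b} : Finset L) := ⟨by simpa using hab, rfl⟩
    have h2 : Extends b ∅ ({b} : Finset L) := ⟨by simp, rfl⟩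
    have e : (wTangles L).del h2 ((wTangles L).del h1 (crossing a b hab 1)) = trivial ∅ :=
      (congrArg ((wTangles L).del h2) (del_crossing hab 1 h1)).trans
        ((wTangles_isMetaMonoid L).one_del h2 (trivial ∅))
    exact e ▸ hdel h2 _ (hdel h1 _ (hc a b hab 1))
  have key : ∀ X T, φ.toFun X T = ψ.toFun X T := by
    refine induction (fun X => ?_) hc (fun {a b c X Y} h T hT => ?_)
      (fun {X Y Z} h T U hT hU => ?_)
    · induction X using Finset.induction_on with
      | empty => exact hempty
      | insert a X ha ih => exact hone ⟨ha, rfl⟩ (trivial X) ih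
    · exact (φ.map_stitch h T).trans <| (congrArg _ hT).trans (ψ.map_stitch h T).symm
    · exact (φ.map_union h T U).trans <| (congrArg₂ _ hT hU).trans (ψ.map_union h T U).symm
  obtain ⟨f, _⟩ := φ
  obtain ⟨g, _⟩ := ψ
  obtain rfl : f = g := funext fun X => funext (key X)
  rfl

theorem tvar_zpow_ne_one (i : X) (s : ℤˣ) : (tvar i : RatField X) ^ (s : ℤ) ≠ 1 := by
  have h1 : (tvar i : RatField X) ≠ 1 := by
    intro h
    have := IsFractionRing.injective (MvPolynomial X ℚ) (RatField X)
      (h.trans (map_one (algebraMap (MvPolynomial X ℚ) (RatField X))).symm)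
    -- Setting all variables to `0` distinguishes a variable from the constant `1`.
    have := congrArg (MvPolynomial.eval fun _ => (0 : ℚ)) this
    simp at this
  rcases Int.units_eq_one_or s with rfl | rfl
  · simpa using h1
  · simpa using h1

/-- In the formula for `m^{b,a}_c` the pivot is `1 - M a b = 1 - (1 - t^s) = t^s`, which becomes the
scalar. Since `M b a = 0`, the matrix entry is `M b b * M a a / t^s = t^s / t^s = 1`. -/
theorem isKink_gamma {a b c : L} (hab : a ≠ b) (s : ℤˣ)
    (h : Stitches b a c ({a, b} : Finset L) {c}) :
    Gamma.IsKink c s (gamma (WTangle.kink hab s h)) := by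
  intro hc
  have hw := unitalAtOne_weight ({c} : Finset L)
  have hw' := hw.comp (GaussDiagram.newStrand b a c)
  obtain ⟨h1, h2⟩ := GaussDiagram.matAt_gamma_crossing hab s hw' (i := a) (by simp)
  obtain ⟨h3, h4⟩ := GaussDiagram.matAt_gamma_crossing hab s hw' (i := b) (by simp)
  have hwa : (weight ({c} : Finset L) ∘ GaussDiagram.newStrand b a c) a = tvar ⟨c, hc⟩ := by
    simp [GaussDiagram.newStrand, weight_of_mem hc]
  have h0 : (tvar ⟨c, hc⟩ : RatField ({c} : Finset L)) ^ (s : ℤ) ≠ 0 :=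
    zpow_ne_zero _ (weight_of_mem hc ▸ hw.ne_zero c)
  rw [hwa] at h2 h4
  rw [if_pos rfl] at h1 h2
  rw [if_neg hab.symm] at h3 h4
  have e : gamma (WTangle.kink hab s h) =
      Gamma.stitch h (GaussDiagram.crossing a b hab s).gamma := gamma_stitch h _
  rw [e]
  constructor
  · rw [← Gamma.scalarAt_weight, Gamma.scalarAt_stitch h _ hw, h2,
      GaussDiagram.scalarAt_gamma_crossing hab s hw']
    ring
  · ext ⟨i, hi⟩ ⟨j, hj⟩
    obtain rfl := Finset.mem_singleton.1 hi
    obtain rfl := Finset.mem_singleton.1 hj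
    rw [← Gamma.matAt_weight, Gamma.matAt_stitch h _ hw hi hi, Matrix.one_apply_eq]
    simp only [Gamma.oldRow, if_true, Gamma.feedback]
    rw [h1, h2, h3, h4, sub_sub_cancel]
    field_simp
    ring

theorem gamma_kink_ne {a b c : L} (hab : a ≠ b) (s : ℤˣ)
    (h : Stitches b a c ({a, b} : Finset L) {c}) :
    gamma (WTangle.kink hab s h) ≠ gamma (trivial {c}) := by
  intro e
  have hc : c ∈ ({c} : Finset L) := by simp
  apply tvar_zpow_ne_one ⟨c, hc⟩ s
  rw [← (isKink_gamma hab s h hc).1, e, ← Gamma.scalarAt_weight]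
  exact GaussDiagram.scalarAt_gamma_trivial (unitalAtOne_weight _)

end WTangle

theorem mainTheorem4 {L : Type*} [DecidableEq L] [Infinite L] :
    IsMetaMonoid (wTangles L) ∧
    IsPreMetaMonoid (gammaCalculus L) ∧
    (∃ hP : (gammaCalculus L).IsClosed Gamma.RowCondition,
      IsMetaMonoid ((gammaCalculus L).restrict Gamma.RowCondition hP)) ∧
    ∃ φ : MetaMonoidHom (wTangles L) (gammaCalculus L),
      SendsCrossings φ ∧
      (∀ ψ : MetaMonoidHom (wTangles L) (gammaCalculus L), SendsCrossings ψ → ψ = φ) ∧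
      (∀ (X : Finset L) (T : WTangle X), Gamma.RowCondition X (φ.toFun X T)) ∧
      ∀ (a b c : L) (hab : a ≠ b) (s : ℤˣ) (h : Stitches b a c ({a, b} : Finset L) {c}),
        Gamma.IsKink c s (φ.toFun {c} (WTangle.kink hab s h)) ∧
        φ.toFun {c} (WTangle.kink hab s h) ≠ φ.toFun {c} (WTangle.trivial {c}) :=
  ⟨wTangles_isMetaMonoid L, Gamma.isPreMetaMonoid L,
    ⟨Gamma.isClosed_rowCondition L, Gamma.isMetaMonoid_restrict L⟩,
    WTangle.gammaHom L, WTangle.sendsCrossings_gammaHom,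
    fun _ hψ => WTangle.hom_unique hψ WTangle.sendsCrossings_gammaHom,
    fun _ T => T.gamma_rowCondition,
    fun _ _ _ hab s h => ⟨WTangle.isKink_gamma hab s h, WTangle.gamma_kink_ne hab s h⟩⟩
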